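/- Let $K$ be a field, $r\ge 1$, and for $i=1,\dots,r$ let $R_i=K[x_{i,1},\dots,x_{i,n_i}]$ be a standard graded polynomial ring with homogeneous maximal ideal $\mathbf x_i=(x_{i,1},\dots,x_{i,n_i})$, let $\mathfrak a_i\subseteq \mathbf x_i^2$ be a homogeneous ideal, and let $A_i=R_i/\mathfrak a_i$, with canonical projection $\pi_i\colon A_i\to K$. Let $Q=R_1\otimes_K\cdots\otimes_K R_r$ be the polynomial ring in all the variables and $N=n_1+\cdots+n_r$. For a graded algebra $A$ over a standard graded polynomial ring $R$ over $K$ write $$P^R_A(t,s)=\sum_{i,j}\dim_K[\operatorname{Tor}^R_i(A,K)]_j\,t^is^j .$$ Let $A_1\times_K\cdots\times_K A_r=\{(a_1,\dots,a_r)\in\prod_i A_i : \pi_i(a_i)=\pi_j(a_j)\text{ for all }i,j\}$ be the fiber product, regarded as a graded $Q$-module through $x_{i,k}\mapsto(0,\dots,0,x_{i,k},0,\dots,0)$. (1) One has $$P^Q_{A_1\times_K\cdots\times_K A_r}(t,s)=\sum_{i=1}^r\bigl(P^{R_i}_{A_i}(t,s)-1\bigr)(1+st)^{N-n_i}+(r-1)\frac{(1+st)^N-Nst-1}{t}-\sum_{i=1}^r\frac{(1+st)^{N-n_i}-(N-n_i)st-1}{t}+1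 .$$ (2) Assume moreover that $A_1,\dots,A_r$ are Artinian Gorenstein, all of the same socle degree $e\ge 3$. Let $f_i\colon A_i\to K(-e)$ be orientations (nonzero graded $K$-linear maps), and let $\tau_i\in (A_i)_e$ be the Thom class of $\pi_i$, that is, $f_i(\tau_i a)=\pi_i(a)$ for all $a\in A_i$. Let $$A_1\#_K\cdots\#_K A_r=(A_1\times_K\cdots\times_K A_r)/\langle(\tau_1,0,\dots,0,\tau_i,0,\dots,0)\mid 2\le i\le r\rangle$$ be the connected sum. Then $$\begin{aligned}P^Q_{A_1\#_K\cdots\#_K A_r}(t,s)={}&\sum_{i=1}^r\bigl(P^{R_i}_{A_i}(t,s)-1-s^{n_i+e}t^{n_i}\bigr)(1+st)^{N-n_i}+1+s^{N+e}t^N\\&+(r-1)\frac{(1+st)^N-Nst-1}{t}-\sum_{i=1}^r\frac{(1+st)^{N-n_i}-(N-n_i)st-1}{t}\\&+(r-1)s^{N+e}t^{N+1}\Bigl[(1+s^{-1}t^{-1})^N-\frac{N}{st}-1\Bigr]\\&-s^{N+e}t^{N+1}\sum_{i=1}^r\Bigl[(1+s^{-1}t^{-1})^{N-n_i}-\frac{N-n_i}{st}-1\Bigr].\end{aligned}$$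 -/

import Mathlib

universe u

open MvPolynomial

noncomputable section

/-! ## Graded Tor, graded Betti numbers and Poincaré series

`R = K[x_s : s ∈ σ]` carries the standard grading.  `[Tor_i^R(M, K)]_j` is computed from the
functorial graded free resolution of `M`: every step is the free module on all homogeneous
elements of the module being covered, a generator having the degree of its element. -/

section GradedTor

/-- The subquotient `Z / (Z ∩ B)`; it is `Z / B` if `B ≤ Z`. -/
abbrev SubQuotient {k : Type u} [Field k] {V : Type u} [AddCommGroup V] [Module k V]
    (Z B : Submodule k V) : Type u :=
  Z ⧸ B.comap Z.subtype

/-- The set of generators of the free cover: the pairs `(j, x)` with `x` homogeneous of degree `j`,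
where `H j` is the set of homogeneous elements of degree `j`. -/
abbrev HomogGen {M : Type u} (H : ℕ → Set M) : Type u := {p : ℕ × M // p.2 ∈ H p.1}

variable (K : Type u) [Field K] (σ : Type)

/-- A free module `F = ⊕_{b ∈ gen} R(-deg b)`, represented by `gen →₀ R`,
together with a submodule of syzygies still to be resolved. -/
structure ResolutionStage where
  gen : Type u
  deg : gen → ℕ
  syz : Submodule (MvPolynomial σ K) (gen →₀ MvPolynomial σ K)

variable {K σ}

/-- `v ∈ ⊕_b R(-deg b)` is homogeneous of degree `j`: its coordinate at `b` is a form of degree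
`j - deg b` (and it vanishes if `j < deg b`). -/
def FreeHomogeneous {gen : Type u} (deg : gen → ℕ) (j : ℕ) (v : gen →₀ MvPolynomial σ K) : Prop :=
  ∀ b, v b = 0 ∨ ∃ k, deg b + k = j ∧ (v b).IsHomogeneous k

/-- The free cover by homogeneous elements: the generator `(j, x)` is sent to `x`. -/
def coverMap {M : Type u} [AddCommGroup M] [Module (MvPolynomial σ K) M] (H : ℕ → Set M) :
    (HomogGen H →₀ MvPolynomial σ K) →ₗ[MvPolynomial σ K] M :=
  Finsupp.linearCombination (MvPolynomial σ K) (fun p => p.1.2)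

/-- The free cover of a graded module, with the kernel as syzygies. -/
def coverStage {M : Type u} [AddCommGroup M] [Module (MvPolynomial σ K) M] (H : ℕ → Set M) :
    ResolutionStage K σ where
  gen := HomogGen H
  deg := fun p => p.1.1
  syz := LinearMap.ker (coverMap (K := K) (σ := σ) H)

namespace ResolutionStage

/-- The homogeneous syzygies of degree `j`. -/
def homogSyz (S : ResolutionStage K σ) (j : ℕ) : Set (S.gen →₀ MvPolynomial σ K) :=
  {v | v ∈ S.syz ∧ FreeHomogeneous S.deg j v}

/-- The next step of the resolution: cover the graded module of syzygies. -/
def next (S : ResolutionStage K σ) : ResolutionStage K σ := coverStage S.homogSyz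

/-- The differential `F_{i+1} → F_i` from the cover of the syzygies. -/
def diff (S : ResolutionStage K σ) :
    (S.next.gen →₀ MvPolynomial σ K) →ₗ[MvPolynomial σ K] (S.gen →₀ MvPolynomial σ K) :=
  coverMap S.homogSyz

/-- The differential `F_{i+1} ⊗_R K → F_i ⊗_R K`, with `F ⊗_R K` written as `gen →₀ K`: the
constant terms of the entries of the matrix of `F_{i+1} → F_i`. -/
def redDiff (S : ResolutionStage K σ) : (S.next.gen →₀ K) →ₗ[K] (S.gen →₀ K) :=
  Finsupp.linearCombination K (fun b =>
    Finsupp.mapRange (constantCoeff (R := K) (σ := σ)) (map_zero _)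
      (S.diff (Finsupp.single b (1 : MvPolynomial σ K))))

/-- The degree `j` part of `F ⊗_R K`. -/
def redPart (S : ResolutionStage K σ) (j : ℕ) : Submodule K (S.gen →₀ K) :=
  Finsupp.supported K K {b | S.deg b = j}

end ResolutionStage

/-- The stages `F_0, F_1, F_2, …` of the graded free resolution of the graded module `M = ⊕ gr j`. -/
def resStage {M : Type u} [AddCommGroup M] [Module (MvPolynomial σ K) M] (gr : ℕ → Set M) :
    ℕ → ResolutionStage K σ
  | 0 => coverStage gr
  | i + 1 => (resStage gr i).next

/-- The degree `j` cycles of `F_i ⊗_R K`. -/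
def torCycles {M : Type u} [AddCommGroup M] [Module (MvPolynomial σ K) M] (gr : ℕ → Set M) :
    (i j : ℕ) → Submodule K ((resStage (K := K) (σ := σ) gr i).gen →₀ K)
  | 0, j => (resStage gr 0).redPart j
  | i + 1, j => (resStage gr i).next.redPart j ⊓ LinearMap.ker (resStage gr i).redDiff

/-- The degree `j` boundaries of `F_i ⊗_R K`. -/
def torBoundaries {M : Type u} [AddCommGroup M] [Module (MvPolynomial σ K) M] (gr : ℕ → Set M)
    (i j : ℕ) : Submodule K ((resStage (K := K) (σ := σ) gr i).gen →₀ K) :=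
  ((resStage gr i).next.redPart j).map (resStage gr i).redDiff

variable (K σ) in
/-- The `K`-vector space `[Tor_i^R(M, K)]_j`. -/
abbrev GradedTor {M : Type u} [AddCommGroup M] [Module (MvPolynomial σ K) M] (gr : ℕ → Set M)
    (i j : ℕ) : Type u :=
  SubQuotient (torCycles (K := K) (σ := σ) gr i j) (torBoundaries (K := K) (σ := σ) gr i j)

/-- The graded Betti number `β_{ij}^R(A) = dim_K [Tor_i^R(A, K)]_j` of a graded algebra `A`,
an `R`-module through `φ : R → A`. -/
def gradedBetti {A : Type u} [CommRing A] [Algebra K A] (φ : MvPolynomial σ K →ₐ[K] A)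
    (gr : ℕ → Submodule K A) (i j : ℕ) : ℕ :=
  letI : Module (MvPolynomial σ K) A := Module.compHom A (φ : MvPolynomial σ K →+* A)
  Module.finrank K (GradedTor K σ (fun k => (gr k : Set A)) i j)

end GradedTor

/-! ### Poincaré series

They live in `ℤ⟦t, s⟧` (variable `0` is `t`, variable `1` is `s`); formulas with negative powers of
`t` and `s` are read in its field of fractions. -/

/-- The fraction field of `ℤ⟦t, s⟧`. -/
abbrev SeriesField : Type := FractionRing (MvPowerSeries (Fin 2) ℤ)

/-- The variable `t`, recording the homological degree. -/
def tVar : SeriesField := algebraMap (MvPowerSeries (Fin 2) ℤ) SeriesField (MvPowerSeries.X 0)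

/-- The variable `s`, recording the internal degree. -/
def sVar : SeriesField := algebraMap (MvPowerSeries (Fin 2) ℤ) SeriesField (MvPowerSeries.X 1)

/-- `P^R_A(t, s) = ∑_{i,j} β_{ij}^R(A) t^i s^j`. -/
def poincareSeries {K : Type u} [Field K] {σ : Type} {A : Type u} [CommRing A] [Algebra K A]
    (φ : MvPolynomial σ K →ₐ[K] A) (gr : ℕ → Submodule K A) : MvPowerSeries (Fin 2) ℤ :=
  fun m => (gradedBetti φ gr (m 0) (m 1) : ℤ)

/-- The Poincaré series, viewed in the fraction field of `ℤ⟦t, s⟧`. -/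
def poincareFrac {K : Type u} [Field K] {σ : Type} {A : Type u} [CommRing A] [Algebra K A]
    (φ : MvPolynomial σ K →ₐ[K] A) (gr : ℕ → Submodule K A) : SeriesField :=
  algebraMap (MvPowerSeries (Fin 2) ℤ) SeriesField (poincareSeries φ gr)

/-! ## Fiber products and connected sums of graded algebras -/

section Constructions

variable {K : Type u} [Field K]

/-- The fiber product `A_1 ×_T ⋯ ×_T A_r`, a subalgebra of the product. -/
def fiberProduct {I : Type} {A : I → Type u} [∀ i, CommRing (A i)] [∀ i, Algebra K (A i)]
    {T : Type u} [CommRing T] [Algebra K T] (π : ∀ i, A i →ₐ[K] T) : Subalgebra K (∀ i, A i) where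
  carrier := {a | ∀ i j, π i (a i) = π j (a j)}
  mul_mem' := fun {a b} ha hb i j => by simp only [Pi.mul_apply, map_mul, ha i j, hb i j]
  add_mem' := fun {a b} ha hb i j => by simp only [Pi.add_apply, map_add, ha i j, hb i j]
  algebraMap_mem' := fun c i j => by simp

/-- The degree `d` part of the fiber product: all its tuples with entries of degree `d`. -/
def fiberProductGrading {I : Type} {A : I → Type u} [∀ i, CommRing (A i)] [∀ i, Algebra K (A i)]
    {T : Type u} [CommRing T] [Algebra K T] (π : ∀ i, A i →ₐ[K] T)
    (gr : ∀ i, ℕ → Submodule K (A i)) (d : ℕ) : Submodule K (fiberProduct π) :=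
  (Submodule.pi Set.univ (fun i => gr i d)).comap (fiberProduct π).val.toLinearMap

/-- The ideal `⟨(τ_1, 0, …, 0, τ_i, 0, …, 0) | i ≠ 1⟩` of the fiber product; `o` is the index
written `1` here. -/
def connectedSumIdeal {I : Type} [DecidableEq I] {A : I → Type u} [∀ i, CommRing (A i)]
    [∀ i, Algebra K (A i)] {T : Type u} [CommRing T] [Algebra K T] (π : ∀ i, A i →ₐ[K] T)
    (o : I) (τ : ∀ i, A i) : Ideal (fiberProduct π) :=
  Ideal.span {x | ∃ i, i ≠ o ∧ (x : ∀ i, A i) = Pi.single o (τ o) + Pi.single i (τ i)}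

/-- The multi-factor connected sum `A_1 #_T ⋯ #_T A_r` with Thom classes `τ_i`. -/
def ConnectedSum {I : Type} [DecidableEq I] {A : I → Type u} [∀ i, CommRing (A i)]
    [∀ i, Algebra K (A i)] {T : Type u} [CommRing T] [Algebra K T] (π : ∀ i, A i →ₐ[K] T)
    (o : I) (τ : ∀ i, A i) : Type u :=
  fiberProduct π ⧸ connectedSumIdeal π o τ

instance {I : Type} [DecidableEq I] {A : I → Type u} [∀ i, CommRing (A i)]
    [∀ i, Algebra K (A i)] {T : Type u} [CommRing T] [Algebra K T] (π : ∀ i, A i →ₐ[K] T)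
    (o : I) (τ : ∀ i, A i) : CommRing (ConnectedSum π o τ) :=
  inferInstanceAs (CommRing (fiberProduct π ⧸ connectedSumIdeal π o τ))

instance {I : Type} [DecidableEq I] {A : I → Type u} [∀ i, CommRing (A i)]
    [∀ i, Algebra K (A i)] {T : Type u} [CommRing T] [Algebra K T] (π : ∀ i, A i →ₐ[K] T)
    (o : I) (τ : ∀ i, A i) : Algebra K (ConnectedSum π o τ) :=
  inferInstanceAs (Algebra K (fiberProduct π ⧸ connectedSumIdeal π o τ))

/-- The quotient map from the fiber product to the connected sum. -/
def connectedSumMk {I : Type} [DecidableEq I] {A : I → Type u} [∀ i, CommRing (A i)]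
    [∀ i, Algebra K (A i)] {T : Type u} [CommRing T] [Algebra K T] (π : ∀ i, A i →ₐ[K] T)
    (o : I) (τ : ∀ i, A i) : fiberProduct π →ₐ[K] ConnectedSum π o τ :=
  Ideal.Quotient.mkₐ K (connectedSumIdeal π o τ)

/-- The grading of the connected sum induced by that of the fiber product. -/
def connectedSumGrading {I : Type} [DecidableEq I] {A : I → Type u} [∀ i, CommRing (A i)]
    [∀ i, Algebra K (A i)] {T : Type u} [CommRing T] [Algebra K T] (π : ∀ i, A i →ₐ[K] T)
    (gr : ∀ i, ℕ → Submodule K (A i)) (o : I) (τ : ∀ i, A i) (d : ℕ) :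
    Submodule K (ConnectedSum π o τ) :=
  (fiberProductGrading π gr d).map (connectedSumMk π o τ).toLinearMap

/-- The socle `(0 : m_A)`, where `m_A = ⊕_{i ≥ 1} A_i`. -/
def gradedSocle {A : Type u} [CommRing A] [Algebra K A] (gr : ℕ → Submodule K A) :
    Submodule K A where
  carrier := {a | ∀ b ∈ ⨆ i ∈ Set.Ici 1, gr i, a * b = 0}
  add_mem' := fun {x y} hx hy b hb => by rw [add_mul, hx b hb, hy b hb, add_zero]
  zero_mem' := fun b _ => zero_mul b
  smul_mem' := fun c x hx b hb => by rw [smul_mul_assoc, hx b hb, smul_zero]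

/-- `A` is a graded Artinian Gorenstein `K`-algebra of socle degree `d`: it is finite dimensional,
its socle is one dimensional and `d` is the largest degree with `A_d ≠ 0`. -/
structure IsArtinianGorenstein {A : Type u} [CommRing A] [Algebra K A] (gr : ℕ → Submodule K A)
    (d : ℕ) : Prop where
  finite : Module.Finite K A
  socle : Module.finrank K (gradedSocle gr) = 1
  top_ne : gr d ≠ ⊥
  above : ∀ j, d < j → gr j = ⊥

/-- An orientation: a nonzero morphism of graded vector spaces `A → K(-d)`. -/
def IsOrientation {A : Type u} [CommRing A] [Algebra K A] (gr : ℕ → Submodule K A) (d : ℕ)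
    (f : A →ₗ[K] K) : Prop :=
  f ≠ 0 ∧ ∀ j, j ≠ d → ∀ a ∈ gr j, f a = 0

/-- `τ` is the Thom class of `π : A → T`, where `A`, `T` are oriented by `fA`, `fT`, and `k` is the
difference of the socle degrees of `A` and `T`. -/
def IsThomClass {A : Type u} [CommRing A] [Algebra K A] (gr : ℕ → Submodule K A)
    {T : Type u} [CommRing T] [Algebra K T] (fA : A →ₗ[K] K) (fT : T →ₗ[K] K) (π : A →ₐ[K] T)
    (k : ℕ) (τ : A) : Prop :=
  τ ∈ gr k ∧ ∀ a, fA (τ * a) = fT (π a)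

end Constructions

/-! ## Quotients of polynomial rings -/

section Presentations

variable {K : Type u} [Field K]

variable (K) in
/-- The homogeneous maximal ideal of a polynomial ring, generated by the variables. -/
def varIdeal (σ : Type) : Ideal (MvPolynomial σ K) := Ideal.span (Set.range X)

/-- The grading of `R / 𝔞` induced by the standard grading of the polynomial ring `R`. -/
def quotGrading {σ : Type} (𝔞 : Ideal (MvPolynomial σ K)) (d : ℕ) :
    Submodule K (MvPolynomial σ K ⧸ 𝔞) :=
  (homogeneousSubmodule σ K d).map (Ideal.Quotient.mkₐ K 𝔞).toLinearMap

theorem aeval_zero_of_le_sq {σ : Type} {𝔞 : Ideal (MvPolynomial σ K)}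
    (h : 𝔞 ≤ varIdeal K σ ^ 2) (a : MvPolynomial σ K) (ha : a ∈ 𝔞) :
    aeval (fun _ : σ => (0 : K)) a = 0 := by
  have h1 : varIdeal K σ ≤ RingHom.ker (aeval (R := K) (fun _ : σ => (0 : K))) := by
    rw [varIdeal, Ideal.span_le]
    rintro _ ⟨i, rfl⟩
    simp [RingHom.mem_ker]
  exact h1 (Ideal.pow_le_self two_ne_zero (h ha))

/-- The canonical projection `R / 𝔞 → K`, killing all variables. -/
def canonicalProj {σ : Type} (𝔞 : Ideal (MvPolynomial σ K)) (h : 𝔞 ≤ varIdeal K σ ^ 2) :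
    (MvPolynomial σ K ⧸ 𝔞) →ₐ[K] K :=
  Ideal.Quotient.liftₐ 𝔞 (aeval (fun _ : σ => (0 : K))) (aeval_zero_of_le_sq h)

variable {r : ℕ} {n : Fin r → ℕ}

/-- The canonical projections `A_i = R_i / 𝔞_i → K`, where `R_i = K[x_{i,1}, …, x_{i,n_i}]`. -/
def projFamily (𝔞 : ∀ i, Ideal (MvPolynomial (Fin (n i)) K))
    (h : ∀ i, 𝔞 i ≤ varIdeal K (Fin (n i)) ^ 2) (i : Fin r) :
    (MvPolynomial (Fin (n i)) K ⧸ 𝔞 i) →ₐ[K] K :=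
  canonicalProj (𝔞 i) (h i)

/-- The map `Q → A_1 ×_K ⋯ ×_K A_r`, `x_{i,k} ↦ (0, …, 0, x_{i,k}, 0, …, 0)`, where
`Q = R_1 ⊗_K ⋯ ⊗_K R_r` is the polynomial ring in all the variables `x_{i,k}`. -/
def toFiberProduct (𝔞 : ∀ i, Ideal (MvPolynomial (Fin (n i)) K))
    (h : ∀ i, 𝔞 i ≤ varIdeal K (Fin (n i)) ^ 2) :
    MvPolynomial (Σ i, Fin (n i)) K →ₐ[K] fiberProduct (projFamily 𝔞 h) :=
  aeval fun p => ⟨Pi.single p.1 (Ideal.Quotient.mk (𝔞 p.1) (X p.2)), by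
    have key : ∀ i, projFamily 𝔞 h i ((Pi.single p.1 (Ideal.Quotient.mk (𝔞 p.1) (X p.2)) :
        ∀ i, MvPolynomial (Fin (n i)) K ⧸ 𝔞 i) i) = 0 := by
      intro i
      by_cases hi : i = p.1
      · subst hi
        rw [Pi.single_eq_same]
        exact (Ideal.Quotient.lift_mk _ _ _).trans (aeval_X _ _)
      · rw [Pi.single_eq_of_ne hi, map_zero]
    exact fun i j => (key i).trans (key j).symm⟩

/-- The map `Q → A_1 #_K ⋯ #_K A_r`. -/
def toConnectedSum [NeZero r] (𝔞 : ∀ i, Ideal (MvPolynomial (Fin (n i)) K))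
    (h : ∀ i, 𝔞 i ≤ varIdeal K (Fin (n i)) ^ 2)
    (τ : ∀ i, MvPolynomial (Fin (n i)) K ⧸ 𝔞 i) :
    MvPolynomial (Σ i, Fin (n i)) K →ₐ[K] ConnectedSum (projFamily 𝔞 h) 0 τ :=
  (connectedSumMk (projFamily 𝔞 h) 0 τ).comp (toFiberProduct 𝔞 h)

/-- `P^R_A(t, s)` for `A = R / 𝔞`. -/
def quotientSeries {σ : Type} (𝔞 : Ideal (MvPolynomial σ K)) : SeriesField :=
  poincareFrac (A := MvPolynomial σ K ⧸ 𝔞) (Ideal.Quotient.mkₐ K 𝔞) (quotGrading 𝔞)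

/-- `P^Q_{A_1 ×_K ⋯ ×_K A_r}(t, s)` for `A_i = R_i / 𝔞_i`. -/
def fiberProductSeries (𝔞 : ∀ i, Ideal (MvPolynomial (Fin (n i)) K))
    (h : ∀ i, 𝔞 i ≤ varIdeal K (Fin (n i)) ^ 2) : SeriesField :=
  poincareFrac (A := fiberProduct (projFamily 𝔞 h)) (toFiberProduct 𝔞 h)
    (fiberProductGrading (projFamily 𝔞 h) (fun i => quotGrading (𝔞 i)))

/-- `P^Q_{A_1 #_K ⋯ #_K A_r}(t, s)` for `A_i = R_i / 𝔞_i` with Thom classes `τ_i`. -/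
def connectedSumSeries [NeZero r] (𝔞 : ∀ i, Ideal (MvPolynomial (Fin (n i)) K))
    (h : ∀ i, 𝔞 i ≤ varIdeal K (Fin (n i)) ^ 2)
    (τ : ∀ i, MvPolynomial (Fin (n i)) K ⧸ 𝔞 i) : SeriesField :=
  poincareFrac (A := ConnectedSum (projFamily 𝔞 h) 0 τ) (toConnectedSum 𝔞 h τ)
    (connectedSumGrading (projFamily 𝔞 h) (fun i => quotGrading (𝔞 i)) 0 τ)

end Presentations

end

attribute [local instance] MvPolynomial.gradedAlgebra

set_option linter.unusedSectionVars false

/-! Tor over a polynomial ring with values in `K` is Koszul homology, so the Betti numbers of `A`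
depend only on dimensions and ranks: in total degree `j` the Koszul chains of homological degree `i`
are `C(n,i)` copies of `A_{j-i}`. Let `H` be the Hilbert series, let `ρ_d` be the polynomial whose
`i`-th coefficient is the rank of the differential on `i`-chains with values in `A_d`, and let `ρ =
∑ s^d ρ_d(st)`. Rank-nullity gives `t P = t (1+st)^n H - (1+t) ρ` (`X_mul_poincareSeries`). It
remains to compare `H` and `ρ` for the factors, the fiber product and the connected sum.

Fiber product. In degree `d ≥ 1` the gluing condition is empty, so the part of degree `d` is the
product of the `(A_k)_d`, and the variables of the other factors act on `(A_k)_d` as zero. Each such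
variable multiplies the rank polynomial by `1+X` (`rankPoly_of_embedding`), so that `ρ_d = ∑
(1+X)^{N-n_k} ρ_{k,d}`. In degree `0` there is only `K·1`; since `𝔞_k ⊆ 𝐱_k²` the variables stay
linearly independent, and `ρ_0 = (1+X)^N - 1` (`rankPoly_of_linearIndependent`). The whole
correction sits in degree `0`. Eliminating `H` and `ρ` of the factors by their own identities gives
(1).

Connected sum. The quotient identifies the socles of the `A_k` up to sign, so only degree `e`
changes, from dimension `r` to dimension `1`, and only the differential from degree `e-1` to degree
`e` is affected. By Gorenstein duality the variables have a dual family in degree `e-1`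
(`exists_dual_family`). Hence every chain with values in the socle is a boundary, except on the full
set of variables, and `ρ_{e-1} = X((1+X)^m - X^m)` for `m` variables (`rankPoly_of_dual`). This
holds for each `A_k` and for the connected sum; the difference gives (2).

The Tor of the definition is matched with Koszul homology by dimension shifting along `0 → Syz → F →
M → 0`. The Koszul complex of the free module `F` is acyclic in positive degrees by an explicit
homotopy; Tor in degrees `0` and `1` is compared directly. -/

noncomputable section

/-! ## Koszul complexes of commuting endomorphisms -/

section Koszul

variable {K : Type*} [Field K] {σ : Type*} [Fintype σ] [DecidableEq σ]
  {M : Type*} [AddCommGroup M] [Module K M] {M' : Type*} [AddCommGroup M'] [Module K M']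

/-- The sign of `k` in `S ∪ {k}`: the parity of the number of elements of `S` before `k`. -/
def koszulSign (K : Type*) [Field K] (rk : σ → ℕ) (k : σ) (S : Finset σ) : K :=
  (-1) ^ (S.filter fun l => rk l < rk k).card

/-- The Koszul differential of a family of endomorphisms on the chains `Finset σ → M`. -/
def koszulD (rk : σ → ℕ) (x : σ → Module.End K M) : (Finset σ → M) →ₗ[K] (Finset σ → M) :=
  LinearMap.pi fun S => ∑ k ∈ Sᶜ, koszulSign K rk k S • (x k ∘ₗ LinearMap.proj (insert k S))

theorem koszulD_apply (rk : σ → ℕ) (x : σ → Module.End K M) (f : Finset σ → M) (S : Finset σ) :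
    koszulD rk x f S = ∑ k ∈ Sᶜ, koszulSign K rk k S • x k (f (insert k S)) := by
  simp [koszulD]

theorem koszulSign_insert_of_lt {rk : σ → ℕ} {k l : σ} {S : Finset σ} (hl : l ∉ S)
    (h : rk l < rk k) : koszulSign K rk k (insert l S) = - koszulSign K rk k S := by
  simp only [koszulSign]
  rw [Finset.filter_insert, if_pos h, Finset.card_insert_of_notMem (by simp [hl]), pow_succ]
  ring

theorem koszulSign_insert_of_le {rk : σ → ℕ} {k l : σ} {S : Finset σ}
    (h : rk k ≤ rk l) : koszulSign K rk k (insert l S) = koszulSign K rk k S := by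
  simp only [koszulSign]
  rw [Finset.filter_insert, if_neg (not_lt.2 h)]

theorem koszulSign_mul_self (rk : σ → ℕ) (k : σ) (S : Finset σ) :
    koszulSign K rk k S * koszulSign K rk k S = 1 := by
  simp [koszulSign, ← mul_pow]

theorem koszulSign_ne_zero (rk : σ → ℕ) (k : σ) (S : Finset σ) : koszulSign K rk k S ≠ 0 := by
  simp [koszulSign]

theorem koszulSign_eq_one {rk : σ → ℕ} {k : σ} {S : Finset σ} (h : ∀ l ∈ S, rk k ≤ rk l) :
    koszulSign K rk k S = 1 := by
  rw [koszulSign, Finset.filter_false_of_mem fun l hl => not_lt.2 (h l hl)]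
  simp

theorem koszulSign_mul_swap {rk : σ → ℕ} (hrk : Function.Injective rk) {k l : σ} {S : Finset σ}
    (hk : k ∉ S) (hl : l ∉ S) (hkl : k ≠ l) :
    koszulSign K rk k S * koszulSign K rk l (insert k S) =
      - (koszulSign K rk l S * koszulSign K rk k (insert l S)) := by
  rcases lt_or_gt_of_ne (fun h => hkl (hrk h)) with h | h
  · rw [koszulSign_insert_of_lt hk h, koszulSign_insert_of_le h.le]
    ring
  · rw [koszulSign_insert_of_lt hl h, koszulSign_insert_of_le h.le]
    ring

/-- The terms removing `k` and then `l`, or `l` and then `k`, cancel: the operators commute and the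
signs are opposite by `koszulSign_mul_swap`. -/
theorem koszulD_koszulD {rk : σ → ℕ} (hrk : Function.Injective rk) {x : σ → Module.End K M}
    (hx : ∀ k l v, x k (x l v) = x l (x k v)) (f : Finset σ → M) :
    koszulD rk x (koszulD rk x f) = 0 := by
  ext S
  simp only [koszulD_apply, map_sum, map_smul, Finset.smul_sum, smul_smul, Pi.zero_apply]
  rw [Finset.sum_sigma']
  refine Finset.sum_involution (fun p _ => ⟨p.2, p.1⟩) ?_ ?_ ?_ ?_
  · rintro ⟨k, l⟩ h
    simp only [Finset.mem_sigma, Finset.mem_compl, Finset.mem_insert, not_or] at h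
    obtain ⟨hk, hlk, hl⟩ := h
    rw [koszulSign_mul_swap hrk hk hl (Ne.symm hlk), hx k l, Finset.insert_comm l k, neg_smul,
      neg_add_cancel]
  · rintro ⟨k, l⟩ h _ h'
    simp only [Finset.mem_sigma, Finset.mem_compl, Finset.mem_insert, not_or] at h
    exact h.2.1 (by simpa using congrArg Sigma.fst h')
  · rintro ⟨k, l⟩ h
    simp only [Finset.mem_sigma, Finset.mem_compl, Finset.mem_insert, not_or] at h ⊢
    exact ⟨h.2.2, fun e => h.2.1 e.symm, h.1⟩
  · rintro ⟨k, l⟩ h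
    rfl

theorem koszulD_comp (rk : σ → ℕ) {x : σ → Module.End K M} {x' : σ → Module.End K M'}
    (φ : M →ₗ[K] M') (hφ : ∀ k v, φ (x k v) = x' k (φ v)) (f : Finset σ → M) :
    koszulD rk x' (fun S => φ (f S)) = fun S => φ (koszulD rk x f S) := by
  ext S
  simp [koszulD_apply, hφ]

/-- The chains of homological degree `i` with values in `V`. -/
def koszulPart (σ : Type*) (V : Submodule K M) (i : ℕ) : Submodule K (Finset σ → M) :=
  Submodule.pi Set.univ fun S => if S.card = i then V else ⊥

theorem mem_koszulPart {V : Submodule K M} {i : ℕ} {f : Finset σ → M} :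
    f ∈ koszulPart σ V i ↔ ∀ S, f S ∈ V ∧ (S.card ≠ i → f S = 0) := by
  simp only [koszulPart, Submodule.mem_pi, Set.mem_univ, true_imp_iff]
  refine forall_congr' fun S => ?_
  split_ifs with h
  · simp [h]
  · simp only [Submodule.mem_bot, h, ne_eq, not_false_eq_true, true_imp_iff]
    exact ⟨fun h => ⟨h ▸ V.zero_mem, h⟩, fun h => h.2⟩

theorem koszulD_mem_koszulPart (rk : σ → ℕ) {x : σ → Module.End K M} {V W : Submodule K M}
    (h : ∀ k, ∀ v ∈ V, x k v ∈ W) {i : ℕ} {f : Finset σ → M} (hf : f ∈ koszulPart σ V (i + 1)) :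
    koszulD rk x f ∈ koszulPart σ W i := by
  rw [mem_koszulPart] at hf ⊢
  intro S
  rw [koszulD_apply]
  refine ⟨W.sum_mem fun k _ => W.smul_mem _ (h k _ (hf _).1), fun hS =>
    Finset.sum_eq_zero fun k hk => ?_⟩
  rw [(hf (insert k S)).2, map_zero, smul_zero]
  rw [Finset.card_insert_of_notMem (by simpa using hk)]
  omega

theorem koszulD_koszulPart_zero (rk : σ → ℕ) (x : σ → Module.End K M) {V : Submodule K M}
    {f : Finset σ → M} (hf : f ∈ koszulPart σ V 0) : koszulD rk x f = 0 := by
  rw [mem_koszulPart] at hf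
  ext S
  rw [koszulD_apply]
  refine Finset.sum_eq_zero fun k hk => ?_
  rw [(hf (insert k S)).2, map_zero, smul_zero]
  simp

/-- Chains with values in the image of `V` lift to chains with values in `V`. -/
theorem exists_lift_koszulPart (φ : M →ₗ[K] M') {V : Submodule K M} {V' : Submodule K M'}
    (h : ∀ v ∈ V', ∃ w ∈ V, φ w = v) {i : ℕ} {f : Finset σ → M'} (hf : f ∈ koszulPart σ V' i) :
    ∃ g ∈ koszulPart σ V i, (fun S => φ (g S)) = f := by
  classical
  rw [mem_koszulPart] at hf
  choose g hg hg' using fun S => h (f S) (hf S).1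
  refine ⟨fun S => if S.card = i then g S else 0, ?_, ?_⟩
  · rw [mem_koszulPart]
    intro S
    by_cases hS : S.card = i <;> simp [hS, hg]
  · ext S
    by_cases hS : S.card = i
    · simp [hS, hg']
    · simp [hS, (hf S).2 hS]

theorem comp_mem_koszulPart (φ : M →ₗ[K] M') {V : Submodule K M} {V' : Submodule K M'}
    (h : ∀ v ∈ V, φ v ∈ V') {i : ℕ} {f : Finset σ → M} (hf : f ∈ koszulPart σ V i) :
    (fun S => φ (f S)) ∈ koszulPart σ V' i := by
  rw [mem_koszulPart] at hf ⊢
  exact fun S => ⟨h _ (hf S).1, fun hS => by simp [(hf S).2 hS]⟩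

/-- The degree `j - i` part of a graded module (zero if `j < i`). -/
def shiftedPart (gr : ℕ → Submodule K M) (i j : ℕ) : Submodule K M :=
  if i ≤ j then gr (j - i) else ⊥

theorem shiftedPart_zero (gr : ℕ → Submodule K M) (j : ℕ) : shiftedPart gr 0 j = gr j := by
  simp [shiftedPart]

theorem shiftedPart_smul {x : σ → Module.End K M} {gr : ℕ → Submodule K M}
    (h : ∀ k d, ∀ v ∈ gr d, x k v ∈ gr (d + 1)) (i j : ℕ) (k : σ) :
    ∀ v ∈ shiftedPart gr (i + 1) j, x k v ∈ shiftedPart gr i j := by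
  intro v hv
  unfold shiftedPart at hv ⊢
  split_ifs at hv with h1
  · rw [if_pos (by omega), show j - i = j - (i + 1) + 1 by omega]
    exact h k _ v hv
  · rw [Submodule.mem_bot] at hv
    simp [hv]

/-- The cycles of homological degree `i` and total degree `j`. -/
def koszulCycles (rk : σ → ℕ) (x : σ → Module.End K M) (gr : ℕ → Submodule K M) (i j : ℕ) :
    Submodule K (Finset σ → M) :=
  koszulPart σ (shiftedPart gr i j) i ⊓ LinearMap.ker (koszulD rk x)

/-- The boundaries of homological degree `i` and total degree `j`. -/
def koszulBoundaries (rk : σ → ℕ) (x : σ → Module.End K M) (gr : ℕ → Submodule K M) (i j : ℕ) :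
    Submodule K (Finset σ → M) :=
  (koszulPart σ (shiftedPart gr (i + 1) j) (i + 1)).map (koszulD rk x)

end Koszul

/-- Two subquotients related by a correspondence have the same dimension. -/
theorem finrank_subQuotient_eq {k : Type*} [Field k] {V V' W : Type*} [AddCommGroup V]
    [Module k V] [AddCommGroup V'] [Module k V'] [AddCommGroup W] [Module k W]
    {Z B : Submodule k V} {Z' B' : Submodule k V'} (Γ : Submodule k W)
    (p : W →ₗ[k] V) (q : W →ₗ[k] V')
    (hp : ∀ w ∈ Γ, p w ∈ Z) (hq : ∀ w ∈ Γ, q w ∈ Z')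
    (hp' : ∀ z ∈ Z, ∃ w ∈ Γ, p w = z) (hq' : ∀ z ∈ Z', ∃ w ∈ Γ, q w = z)
    (h : ∀ w ∈ Γ, p w ∈ B ↔ q w ∈ B') :
    Module.finrank k (Z ⧸ B.comap Z.subtype) = Module.finrank k (Z' ⧸ B'.comap Z'.subtype) := by
  let P : Γ →ₗ[k] Z ⧸ B.comap Z.subtype :=
    (B.comap Z.subtype).mkQ ∘ₗ (p.comp Γ.subtype).codRestrict Z fun w => hp w w.2
  let Q : Γ →ₗ[k] Z' ⧸ B'.comap Z'.subtype :=
    (B'.comap Z'.subtype).mkQ ∘ₗ (q.comp Γ.subtype).codRestrict Z' fun w => hq w w.2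
  have hP : Function.Surjective P := by
    refine (Submodule.mkQ_surjective _).comp fun z => ?_
    obtain ⟨w, hw, e⟩ := hp' z z.2
    exact ⟨⟨w, hw⟩, Subtype.ext e⟩
  have hQ : Function.Surjective Q := by
    refine (Submodule.mkQ_surjective _).comp fun z => ?_
    obtain ⟨w, hw, e⟩ := hq' z z.2
    exact ⟨⟨w, hw⟩, Subtype.ext e⟩
  have hker : LinearMap.ker P = LinearMap.ker Q := by
    ext w
    have h1 : P w = 0 ↔ p w ∈ B := Submodule.Quotient.mk_eq_zero _
    have h2 : Q w = 0 ↔ q w ∈ B' := Submodule.Quotient.mk_eq_zero _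
    rw [LinearMap.mem_ker, LinearMap.mem_ker, h1, h2, h w w.2]
  exact ((P.quotKerEquivOfSurjective hP).symm.trans
    ((Submodule.quotEquivOfEq _ _ hker).trans (Q.quotKerEquivOfSurjective hQ))).finrank_eq

end

noncomputable section

/-! ## The Koszul complex of a free graded module -/

section FreeKoszul

variable {K : Type u} [Field K] {σ : Type}

/-- `p ↦ ∑ a, coeff (a + e_m) p x^a`, the sum being over the monomials `x^a` without variables
before `x_m`. -/
def divideByFirst (rk : σ → ℕ) (m : σ) (p : MvPolynomial σ K) : MvPolynomial σ K :=
  open Classical in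
  ∑ a ∈ (p.divMonomial (Finsupp.single m 1)).support with ∀ l ∈ a.support, rk m ≤ rk l,
    monomial a (coeff a (p.divMonomial (Finsupp.single m 1)))

theorem coeff_divideByFirst_of_le {rk : σ → ℕ} {m : σ} (p : MvPolynomial σ K) {a : σ →₀ ℕ}
    (h : ∀ l ∈ a.support, rk m ≤ rk l) :
    coeff a (divideByFirst rk m p) = coeff (a + Finsupp.single m 1) p := by
  classical
  rw [divideByFirst, coeff_sum]
  simp only [coeff_monomial, coeff_divMonomial]
  rw [Finset.sum_ite_eq']
  simp only [Finset.mem_filter, mem_support_iff, coeff_divMonomial]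
  rw [add_comm a]
  split_ifs with h'
  · rfl
  · by_contra h''
    exact h' ⟨fun h3 => h'' h3.symm, h⟩

theorem coeff_divideByFirst_of_not_le {rk : σ → ℕ} {m : σ} (p : MvPolynomial σ K) {a : σ →₀ ℕ}
    (h : ¬ ∀ l ∈ a.support, rk m ≤ rk l) : coeff a (divideByFirst rk m p) = 0 := by
  classical
  rw [divideByFirst, coeff_sum]
  refine Finset.sum_eq_zero fun b hb => ?_
  rw [coeff_monomial, if_neg]
  rintro rfl
  exact h (Finset.mem_filter.1 hb).2

theorem divideByFirst_zero (rk : σ → ℕ) (m : σ) :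
    divideByFirst rk m (0 : MvPolynomial σ K) = 0 := by
  simp [divideByFirst]

theorem weight_one_apply (a : σ →₀ ℕ) : Finsupp.weight (1 : σ → ℕ) a = a.degree := by
  rw [Finsupp.degree_eq_weight_one]
  rfl

variable {gen : Type u}

theorem freeHomogeneous_iff {deg : gen → ℕ} {j : ℕ} {v : gen →₀ MvPolynomial σ K} :
    FreeHomogeneous deg j v ↔ ∀ b a, coeff a (v b) ≠ 0 → deg b + a.degree = j := by
  constructor
  · intro h b a ha
    rcases h b with h | ⟨k, hk, h⟩
    · simp [h] at ha
    · have := h ha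
      rw [weight_one_apply] at this
      omega
  · intro h b
    by_cases h0 : v b = 0
    · exact Or.inl h0
    · obtain ⟨a, ha⟩ := ne_zero_iff.1 h0
      refine Or.inr ⟨a.degree, h b a ha, fun c hc => ?_⟩
      have h1 := h b a ha
      have h2 := h b c hc
      rw [weight_one_apply]
      omega

/-- The forms of degree `j` in the free module `⊕_b R(-deg b)`. -/
def freePart (deg : gen → ℕ) (j : ℕ) : Submodule K (gen →₀ MvPolynomial σ K) where
  carrier := {v | FreeHomogeneous deg j v}
  zero_mem' := fun b => Or.inl rfl
  add_mem' := by
    intro v w hv hw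
    simp only [Set.mem_ofPred_eq, freeHomogeneous_iff] at hv hw ⊢
    intro b a h
    by_cases h1 : coeff a (v b) = 0
    · exact hw b a (by simpa [h1] using h)
    · exact hv b a h1
  smul_mem' := by
    intro c v hv
    simp only [Set.mem_ofPred_eq, freeHomogeneous_iff] at hv ⊢
    intro b a h
    exact hv b a (by intro h1; simp [h1] at h)

theorem mem_freePart {deg : gen → ℕ} {j : ℕ} {v : gen →₀ MvPolynomial σ K} :
    v ∈ freePart deg j ↔ ∀ b a, coeff a (v b) ≠ 0 → deg b + a.degree = j :=
  freeHomogeneous_iff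

/-- Multiplication by the variables. -/
def varMul (M : Type*) [AddCommGroup M] [Module K M] [Module (MvPolynomial σ K) M]
    [IsScalarTower K (MvPolynomial σ K) M] (k : σ) : Module.End K M :=
  (LinearMap.lsmul (MvPolynomial σ K) M (X k)).restrictScalars K

theorem varMul_apply {M : Type*} [AddCommGroup M] [Module K M] [Module (MvPolynomial σ K) M]
    [IsScalarTower K (MvPolynomial σ K) M] (k : σ) (v : M) :
    varMul (K := K) M k v = (X k : MvPolynomial σ K) • v := rfl

theorem coeff_varMul [DecidableEq σ] (k : σ) (v : gen →₀ MvPolynomial σ K) (b : gen)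
    (a : σ →₀ ℕ) : coeff a (varMul (K := K) _ k v b) =
      if k ∈ a.support then coeff (a - Finsupp.single k 1) (v b) else 0 := by
  rw [varMul_apply, Finsupp.smul_apply, smul_eq_mul, coeff_X_mul']

theorem varMul_mem_freePart (deg : gen → ℕ) (k : σ) (d : ℕ) (v : gen →₀ MvPolynomial σ K)
    (hv : v ∈ freePart deg d) : varMul (K := K) _ k v ∈ freePart deg (d + 1) := by
  classical
  rw [mem_freePart] at hv ⊢
  intro b a h
  rw [coeff_varMul] at h
  split_ifs at h with hk
  · have h1 := hv b _ h
    have h2 : a - Finsupp.single k 1 + Finsupp.single k 1 = a :=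
      tsub_add_cancel_of_le (by simpa [Nat.one_le_iff_ne_zero] using hk)
    rw [← h2]
    rw [map_add, Finsupp.degree_single]
    omega
  · exact absurd rfl h

variable [Fintype σ] [DecidableEq σ]

theorem mem_koszulPart_freePart {deg : gen → ℕ} {i j : ℕ}
    {f : Finset σ → gen →₀ MvPolynomial σ K} :
    f ∈ koszulPart σ (shiftedPart (freePart (K := K) (σ := σ) deg) i j) i ↔
      ∀ S b a, coeff a (f S b) ≠ 0 → S.card = i ∧ deg b + a.degree + i = j := by
  rw [mem_koszulPart]
  constructor
  · intro h S b a ha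
    by_cases hS : S.card = i
    · refine ⟨hS, ?_⟩
      have h1 := (h S).1
      rw [shiftedPart] at h1
      split_ifs at h1 with hi
      · have := mem_freePart.1 h1 b a ha
        omega
      · rw [Submodule.mem_bot] at h1
        simp [h1] at ha
    · simp [(h S).2 hS] at ha
  · intro h S
    constructor
    · rw [shiftedPart]
      split_ifs with hi
      · rw [mem_freePart]
        intro b a ha
        have := (h S b a ha).2
        omega
      · rw [Submodule.mem_bot]
        ext b a
        by_contra ha
        have := (h S b a ha).2
        omega
    · intro hS
      ext b a
      by_contra ha
      exact hS (h S b a ha).1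

open Classical in
/-- The contracting homotopy of the Koszul complex of a free module. -/
def koszulHomotopy (rk : σ → ℕ) (f : Finset σ → gen →₀ MvPolynomial σ K) (S : Finset σ) :
    gen →₀ MvPolynomial σ K :=
  if h : ∃ m ∈ S, ∀ l ∈ S, rk m ≤ rk l then
    (f (S.erase h.choose)).mapRange (divideByFirst rk h.choose) (divideByFirst_zero rk _)
  else 0

theorem coeff_koszulHomotopy {rk : σ → ℕ} (hrk : Function.Injective rk)
    (f : Finset σ → gen →₀ MvPolynomial σ K) {S : Finset σ} {m : σ} (hm : m ∈ S)
    (hS : ∀ l ∈ S, rk m ≤ rk l) (b : gen) {a : σ →₀ ℕ} (ha : ∀ l ∈ a.support, rk m ≤ rk l) :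
    coeff a (koszulHomotopy rk f S b) = coeff (a + Finsupp.single m 1) (f (S.erase m) b) := by
  have h : ∃ m ∈ S, ∀ l ∈ S, rk m ≤ rk l := ⟨m, hm, hS⟩
  have e : h.choose = m := hrk (le_antisymm (h.choose_spec.2 m hm) (hS _ h.choose_spec.1))
  rw [koszulHomotopy, dif_pos h, Finsupp.mapRange_apply, e, coeff_divideByFirst_of_le _ ha]

theorem coeff_koszulHomotopy_of_lt {rk : σ → ℕ} 
    (f : Finset σ → gen →₀ MvPolynomial σ K) {S : Finset σ} {m : σ} 
    (hS : ∀ l ∈ S, rk m < rk l) (b : gen) {a : σ →₀ ℕ} (ha : m ∈ a.support) :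
    coeff a (koszulHomotopy rk f S b) = 0 := by
  rw [koszulHomotopy]
  split_ifs with h
  · rw [Finsupp.mapRange_apply, coeff_divideByFirst_of_not_le]
    exact fun h' => absurd (h' m ha) (not_le.2 (hS _ h.choose_spec.1))
  · simp

theorem coeff_koszulD (rk : σ → ℕ) (f : Finset σ → gen →₀ MvPolynomial σ K) (S : Finset σ)
    (b : gen) (a : σ →₀ ℕ) :
    coeff a (koszulD rk (varMul (K := K) _) f S b) = ∑ k ∈ Sᶜ, koszulSign K rk k S *
      if k ∈ a.support then coeff (a - Finsupp.single k 1) (f (insert k S) b) else 0 := by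
  rw [koszulD_apply, Finsupp.finsetSum_apply, coeff_sum]
  refine Finset.sum_congr rfl fun k _ => ?_
  rw [Finsupp.smul_apply, coeff_smul, smul_eq_mul, coeff_varMul]

/-- The homotopy moves the first variable of a term `x^a e_S` from `x^a` into `S`. Let `m` be the
first index occurring in `S` or in `a`. If `m ∈ S`, the summand `k = m` of the differential of `f`
at `S \ {m}` returns the coefficient of `f S`, and the others cancel against the differential of the
homotopy, since `m` precedes `k`. If `m ∉ S`, the second term vanishes and only `k = m` survives in
the first. Only `S = ∅`, `a = 0` is excluded: the constants, which are the homology in degree `0`.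
-/
theorem koszulHomotopy_spec {rk : σ → ℕ} (hrk : Function.Injective rk)
    (f : Finset σ → gen →₀ MvPolynomial σ K) (S : Finset σ) (b : gen) (a : σ →₀ ℕ)
    (h : (S ∪ a.support).Nonempty) :
    coeff a (koszulD rk (varMul (K := K) _) (koszulHomotopy rk f) S b) +
      coeff a (koszulHomotopy rk (koszulD rk (varMul (K := K) _) f) S b) = coeff a (f S b) := by
  obtain ⟨m, hm, hmin⟩ := Finset.exists_min_image _ rk h
  have hS : ∀ l ∈ S, rk m ≤ rk l := fun l hl => hmin l (Finset.mem_union_left _ hl)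
  have ha : ∀ l ∈ a.support, rk m ≤ rk l := fun l hl => hmin l (Finset.mem_union_right _ hl)
  have hsub : ∀ k, ∀ l ∈ (a - Finsupp.single k 1).support, rk m ≤ rk l := fun k l hl =>
    ha l (Finsupp.support_mono tsub_le_self hl)
  by_cases hmS : m ∈ S
  · rw [coeff_koszulHomotopy hrk _ hmS hS b ha, coeff_koszulD, coeff_koszulD,
      Finset.compl_erase, Finset.sum_insert (by simpa using hmS), Finset.insert_erase hmS,
      koszulSign_eq_one fun l hl => hS l (Finset.mem_of_mem_erase hl), if_pos (by simp), one_mul,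
      add_tsub_cancel_right, add_left_comm, ← Finset.sum_add_distrib, add_eq_left]
    refine Finset.sum_eq_zero fun k hk => ?_
    have hkS : k ∉ S := by simpa using hk
    have hkm : k ≠ m := fun e => hkS (e ▸ hmS)
    by_cases hka : k ∈ a.support
    · have hlt : rk m < rk k := lt_of_le_of_ne (ha k hka) fun e => hkm (hrk e).symm
      have e1 : koszulSign K rk k S = - koszulSign K rk k (S.erase m) := by
        conv_lhs => rw [← Finset.insert_erase hmS]
        exact koszulSign_insert_of_lt (by simp) hlt
      have e2 : a + Finsupp.single m 1 - Finsupp.single k 1 =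
          a - Finsupp.single k 1 + Finsupp.single m 1 :=
        tsub_add_eq_add_tsub (by simpa [Nat.one_le_iff_ne_zero] using hka) |>.symm
      rw [if_pos hka, if_pos (by simp at hka; simp [hka]), e1, e2,
        coeff_koszulHomotopy hrk _ (Finset.mem_insert_of_mem hmS)
          (by simpa using ⟨hlt.le, hS⟩) b (hsub k),
        Finset.erase_insert_of_ne hkm]
      ring
    · rw [if_neg hka, if_neg]
      · ring
      · simp at hka
        simp [hka, hkm.symm]
  · have hma : m ∈ a.support := (Finset.mem_union.1 hm).resolve_left hmS
    have hlt : ∀ l ∈ S, rk m < rk l := fun l hl =>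
      lt_of_le_of_ne (hS l hl) fun e => hmS (hrk e ▸ hl)
    rw [coeff_koszulHomotopy_of_lt _ hlt b hma, add_zero, coeff_koszulD,
      Finset.sum_eq_single m]
    · rw [koszulSign_eq_one hS, if_pos hma, one_mul,
        coeff_koszulHomotopy hrk _ (Finset.mem_insert_self _ _) (by simpa using hS) b (hsub m),
        Finset.erase_insert hmS,
        tsub_add_cancel_of_le (by simpa [Nat.one_le_iff_ne_zero] using hma)]
    · intro k hk hkm
      split_ifs with hka
      · rw [coeff_koszulHomotopy_of_lt (m := m), mul_zero]
        · simpa using ⟨lt_of_le_of_ne (ha k hka) fun e => hkm (hrk e).symm, hlt⟩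
        · simp at hma
          simp [hma, hkm]
      · rw [mul_zero]
    · intro h
      exact absurd (by simpa using hmS) h

theorem koszulHomotopy_mem {rk : σ → ℕ} {deg : gen → ℕ} {i j : ℕ}
    {f : Finset σ → gen →₀ MvPolynomial σ K}
    (hf : f ∈ koszulPart σ (shiftedPart (freePart (K := K) (σ := σ) deg) i j) i) :
    koszulHomotopy rk f ∈
      koszulPart σ (shiftedPart (freePart (K := K) (σ := σ) deg) (i + 1) j) (i + 1) := by
  rw [mem_koszulPart_freePart] at hf ⊢
  intro S b a h
  rw [koszulHomotopy] at h
  split_ifs at h with h'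
  · rw [Finsupp.mapRange_apply] at h
    by_cases h2 : ∀ l ∈ a.support, rk h'.choose ≤ rk l
    · rw [coeff_divideByFirst_of_le _ h2] at h
      have := hf _ _ _ h
      rw [Finset.card_erase_of_mem h'.choose_spec.1, map_add, Finsupp.degree_single] at this
      have : 0 < S.card := Finset.card_pos.2 ⟨_, h'.choose_spec.1⟩
      omega
    · exact absurd (coeff_divideByFirst_of_not_le _ h2) h
  · simp at h

/-- The Koszul complex of a free graded module is acyclic in positive homological degrees. -/
theorem exists_koszulD_eq_of_cycle {rk : σ → ℕ} (hrk : Function.Injective rk) {deg : gen → ℕ}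
    {i j : ℕ} {f : Finset σ → gen →₀ MvPolynomial σ K}
    (hf : f ∈ koszulPart σ (shiftedPart (freePart (K := K) (σ := σ) deg) (i + 1) j) (i + 1))
    (h : koszulD rk (varMul (K := K) _) f = 0) :
    ∃ g ∈ koszulPart σ (shiftedPart (freePart (K := K) (σ := σ) deg) (i + 2) j) (i + 2),
      koszulD rk (varMul (K := K) _) g = f := by
  refine ⟨_, koszulHomotopy_mem (rk := rk) hf, ?_⟩
  have h0 : koszulHomotopy rk (0 : Finset σ → gen →₀ MvPolynomial σ K) = 0 := by
    ext S b a
    rw [koszulHomotopy]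
    split_ifs <;> simp
  ext S b a
  by_cases hS : S.Nonempty
  · have := koszulHomotopy_spec hrk f S b a (hS.mono Finset.subset_union_left)
    rw [h, h0] at this
    simpa using this
  -- The homotopy identity may fail at `S = ∅`, but a chain of positive homological degree vanishes
  -- there.
  · have hS' : S.card ≠ i + 1 := by
      rw [Finset.not_nonempty_iff_eq_empty.1 hS]
      simp
    rw [(mem_koszulPart.1 hf S).2 hS']
    have hm := koszulD_mem_koszulPart rk (shiftedPart_smul (x := varMul (K := K) (σ := σ) _)
      (varMul_mem_freePart deg) (i + 1) j) (koszulHomotopy_mem (rk := rk) hf)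
    rw [(mem_koszulPart.1 hm S).2 hS']

/-- The `0`-chains of a free module that are boundaries are those without constant terms. -/
theorem exists_koszulD_eq_of_constantCoeff {rk : σ → ℕ} (hrk : Function.Injective rk)
    {deg : gen → ℕ} {j : ℕ} {v : gen →₀ MvPolynomial σ K} (hv : v ∈ freePart (K := K) deg j)
    (h : ∀ b, constantCoeff (v b) = 0) :
    ∃ g ∈ koszulPart σ (shiftedPart (freePart (K := K) (σ := σ) deg) 1 j) 1,
      koszulD rk (varMul (K := K) _) g = Pi.single ∅ v := by
  have hf : (Pi.single ∅ v : Finset σ → gen →₀ MvPolynomial σ K) ∈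
      koszulPart σ (shiftedPart (freePart (K := K) (σ := σ) deg) 0 j) 0 := by
    rw [mem_koszulPart, shiftedPart_zero]
    intro S
    by_cases hS : S = ∅
    · subst hS
      simp [hv]
    · simp [Pi.single_eq_of_ne hS]
  have hg := koszulHomotopy_mem (rk := rk) hf
  have hm := koszulD_mem_koszulPart rk (shiftedPart_smul (x := varMul (K := K) (σ := σ) _)
      (varMul_mem_freePart deg) 0 j) hg
  refine ⟨_, hg, ?_⟩
  ext S b a
  by_cases hS : S = ∅
  · subst hS
    rw [Pi.single_eq_same]
    -- The homotopy identity says nothing about the constant term; here both sides have none, by `h`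
    -- and because boundaries are multiples of variables.
    by_cases ha : a = 0
    · subst ha
      rw [coeff_koszulD]
      simpa [constantCoeff_eq] using (h b).symm
    · have := koszulHomotopy_spec hrk (Pi.single ∅ v) ∅ b a (by simpa using ha)
      rw [koszulD_koszulPart_zero rk _ hf, Pi.single_eq_same] at this
      rw [← this, left_eq_add]
      rw [koszulHomotopy, dif_neg (by simp)]
      simp
  · rw [(mem_koszulPart.1 hm S).2 (by simpa using hS), Pi.single_eq_of_ne hS]

theorem constantCoeff_koszulD (rk : σ → ℕ) (f : Finset σ → gen →₀ MvPolynomial σ K)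
    (S : Finset σ) (b : gen) :
    constantCoeff (koszulD rk (varMul (K := K) _) f S b) = 0 := by
  rw [constantCoeff_eq, coeff_koszulD]
  simp

end FreeKoszul

end

noncomputable section

/-! ## Graded Tor as Koszul homology -/

section Bridge

variable {K : Type u} [Field K] {σ : Type}

section Reduction

variable {gen : Type u}

/-- The inclusion `F ⊗_R K → F` as constant vectors. -/
def constVec : (gen →₀ K) →ₗ[K] (gen →₀ MvPolynomial σ K) :=
  Finsupp.mapRange.linearMap (Algebra.linearMap K (MvPolynomial σ K))

theorem constVec_apply (c : gen →₀ K) (b : gen) : constVec (σ := σ) c b = C (c b) := rfl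

theorem constVec_single (b : gen) (c : K) :
    constVec (σ := σ) (Finsupp.single b c) = Finsupp.single b (C c) := by
  simp [constVec, algebraMap_eq]

theorem constVec_mem_freePart {deg : gen → ℕ} {j : ℕ} {c : gen →₀ K}
    (hc : c ∈ Finsupp.supported K K {b | deg b = j}) :
    constVec c ∈ freePart (K := K) (σ := σ) deg j := by
  classical
  rw [mem_freePart]
  intro b a h
  rw [constVec_apply, coeff_C] at h
  split_ifs at h with h0
  · have : b ∈ {b | deg b = j} := hc (by simpa using h)
    rw [← h0, map_zero, add_zero]
    exact this
  · exact absurd rfl h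

end Reduction

variable {M : Type u} [AddCommGroup M] [Module K M] [Module (MvPolynomial σ K) M]
  [IsScalarTower K (MvPolynomial σ K) M] {gr : ℕ → Submodule K M}

/-- The generators of the free cover. -/
abbrev CoverGen (gr : ℕ → Submodule K M) : Type u := HomogGen fun k => (gr k : Set M)

/-- The degrees of the generators of the free cover. -/
def coverDeg (gr : ℕ → Submodule K M) (p : CoverGen gr) : ℕ := p.1.1

theorem varMul_comm (k l : σ) (v : M) :
    varMul (K := K) M k (varMul (K := K) M l v) = varMul (K := K) M l (varMul (K := K) M k v) := by
  simp only [varMul_apply, smul_smul, mul_comm]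

theorem monomial_smul_mem (hgr : ∀ k d, ∀ v ∈ gr d, varMul (K := K) (σ := σ) M k v ∈ gr (d + 1))
    (a : σ →₀ ℕ) {d : ℕ} {v : M} (hv : v ∈ gr d) (c : K) :
    monomial a c • v ∈ gr (d + a.degree) := by
  suffices h : ∀ d, ∀ v ∈ gr d, monomial a (1 : K) • v ∈ gr (d + a.degree) by
    have e : monomial a c = c • monomial a (1 : K) := by simp [smul_monomial]
    rw [e, smul_assoc]
    exact (gr _).smul_mem c (h d v hv)
  clear hv v d c
  induction a using Finsupp.induction_linear with
  | zero =>
    intro d v hv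
    simpa using hv
  | add a b ha hb =>
    intro d v hv
    have e : monomial (a + b) (1 : K) = monomial a 1 * monomial b 1 := by simp [monomial_mul]
    rw [e, mul_smul, map_add, add_comm a.degree, ← add_assoc]
    exact ha _ _ (hb _ _ hv)
  | single k n =>
    induction n with
    | zero =>
      intro d v hv
      simpa using hv
    | succ n ih =>
      intro d v hv
      have e : monomial (Finsupp.single k (n + 1)) (1 : K) =
          X k * monomial (Finsupp.single k n) 1 := by
        rw [X, monomial_mul, one_mul, ← Finsupp.single_add, add_comm]
      rw [e, mul_smul, Finsupp.degree_single, ← add_assoc]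
      have := hgr k _ _ (ih d v hv)
      rwa [Finsupp.degree_single] at this

theorem coverMap_mem (hgr : ∀ k d, ∀ v ∈ gr d, varMul (K := K) (σ := σ) M k v ∈ gr (d + 1))
    {j : ℕ} {v : CoverGen gr →₀ MvPolynomial σ K}
    (hv : v ∈ freePart (K := K) (coverDeg gr) j) :
    coverMap (fun k => (gr k : Set M)) v ∈ gr j := by
  rw [coverMap, Finsupp.linearCombination_apply]
  refine (gr j).sum_mem fun p _ => ?_
  change v p • p.1.2 ∈ gr j
  rw [(v p).as_sum, Finset.sum_smul]
  refine (gr j).sum_mem fun a ha => ?_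
  rw [← mem_freePart.1 hv p a (mem_support_iff.1 ha)]
  exact monomial_smul_mem hgr a p.2 _

theorem coverMap_single {j : ℕ} {v : M} (hv : v ∈ gr j) :
    coverMap (fun k => (gr k : Set M))
      (Finsupp.single ⟨(j, v), hv⟩ (1 : MvPolynomial σ K)) = v := by
  simp [coverMap]

theorem single_mem_freePart {gen : Type u} (deg : gen → ℕ) (b : gen) :
    Finsupp.single b (1 : MvPolynomial σ K) ∈ freePart (K := K) deg (deg b) := by
  classical
  rw [mem_freePart]
  intro b' a h
  rw [Finsupp.single_apply] at h
  split_ifs at h with hb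
  · rw [coeff_one] at h
    split_ifs at h with ha
    · rw [hb, ← ha, map_zero, add_zero]
    · exact absurd rfl h
  · simp at h

/-- The cover as a `K`-linear map. -/
def coverMapK (gr : ℕ → Submodule K M) :
    (CoverGen gr →₀ MvPolynomial σ K) →ₗ[K] M :=
  (coverMap fun k => (gr k : Set M)).restrictScalars K

theorem coverMapK_varMul (gr : ℕ → Submodule K M) (k : σ)
    (v : CoverGen gr →₀ MvPolynomial σ K) :
    coverMapK gr (varMul (K := K) _ k v) = varMul (K := K) M k (coverMapK gr v) :=
  map_smul (coverMap fun k => (gr k : Set M)) _ v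

/-- The graded module of syzygies of the free cover. -/
def syzGr (gr : ℕ → Submodule K M) (j : ℕ) : Submodule K (CoverGen gr →₀ MvPolynomial σ K) :=
  LinearMap.ker (coverMapK gr) ⊓ freePart (coverDeg gr) j

theorem varMul_mem_syzGr (gr : ℕ → Submodule K M) (k : σ) (d : ℕ) :
    ∀ v ∈ syzGr (σ := σ) gr d, varMul (K := K) _ k v ∈ syzGr (σ := σ) gr (d + 1) := by
  rintro v ⟨hv, hv'⟩
  refine ⟨?_, varMul_mem_freePart _ k d v hv'⟩
  rw [SetLike.mem_coe, LinearMap.mem_ker] at hv ⊢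
  rw [coverMapK_varMul, hv, map_zero]

theorem coverMapK_mem_shiftedPart
    (hgr : ∀ k d, ∀ v ∈ gr d, varMul (K := K) (σ := σ) M k v ∈ gr (d + 1)) (i j : ℕ) :
    ∀ v ∈ shiftedPart (freePart (K := K) (coverDeg gr)) i j, coverMapK (σ := σ) gr v ∈ shiftedPart gr i j := by
  intro v hv
  rw [shiftedPart] at hv ⊢
  split_ifs at hv ⊢
  · exact coverMap_mem hgr hv
  · rw [Submodule.mem_bot] at hv ⊢
    rw [hv, map_zero]

theorem exists_coverMapK_eq (i j : ℕ) :
    ∀ v ∈ shiftedPart gr i j, ∃ w ∈ shiftedPart (freePart (K := K) (coverDeg gr)) i j,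
      coverMapK (σ := σ) gr w = v := by
  intro v hv
  rw [shiftedPart] at hv ⊢
  split_ifs at hv ⊢
  · exact ⟨_, single_mem_freePart (coverDeg gr) (⟨(_, v), hv⟩ : CoverGen gr), coverMap_single hv⟩
  · rw [Submodule.mem_bot] at hv
    exact ⟨0, Submodule.zero_mem _, by simp [hv]⟩

theorem mem_shiftedPart_syzGr {i j : ℕ}
    {v : CoverGen gr →₀ MvPolynomial σ K} :
    v ∈ shiftedPart (syzGr (σ := σ) gr) i j ↔
      v ∈ shiftedPart (freePart (K := K) (coverDeg gr)) i j ∧ coverMapK gr v = 0 := by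
  rw [shiftedPart, shiftedPart]
  split_ifs
  · exact and_comm
  · rw [Submodule.mem_bot]
    exact ⟨fun h => ⟨h, by rw [h, map_zero]⟩, fun h => h.1⟩

variable [Fintype σ] [DecidableEq σ] {rk : σ → ℕ}

theorem mem_koszulPart_syzGr {i j : ℕ} {f : Finset σ →
      CoverGen gr →₀ MvPolynomial σ K} :
    f ∈ koszulPart σ (shiftedPart (syzGr (σ := σ) gr) i j) i ↔
      f ∈ koszulPart σ (shiftedPart (freePart (K := K) (coverDeg gr)) i j) i ∧ ∀ S, coverMapK gr (f S) = 0 := by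
  simp only [mem_koszulPart, mem_shiftedPart_syzGr]
  exact ⟨fun h => ⟨fun S => ⟨(h S).1.1, (h S).2⟩, fun S => (h S).1.2⟩,
    fun h S => ⟨⟨(h.1 S).1, h.2 S⟩, (h.1 S).2⟩⟩

theorem coverMapK_koszulD (gr : ℕ → Submodule K M) (f : Finset σ →
      CoverGen gr →₀ MvPolynomial σ K) :
    (koszulD rk (varMul (K := K) M) fun S => coverMapK gr (f S)) =
      fun S => coverMapK gr (koszulD rk (varMul (K := K) _) f S) :=
  koszulD_comp rk _ (coverMapK_varMul gr) f

/-- The connecting homomorphism is well defined and injective on classes. If the image of `f` bounds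
in `M`, lift the bounding chain to `h`: then `f - dh` has values in the syzygies and the same
differential as `f`. Conversely, if `df = dg` with `g` a syzygy chain, then `f - g` is a cycle of
the free module, hence a boundary, and `g` dies in `M`. -/
theorem mem_koszulBoundaries_cover_iff (hrk : Function.Injective rk)
    (hgr : ∀ k d, ∀ v ∈ gr d, varMul (K := K) (σ := σ) M k v ∈ gr (d + 1)) {i j : ℕ}
    {f : Finset σ →
      CoverGen gr →₀ MvPolynomial σ K}
    (hf : f ∈ koszulPart σ (shiftedPart (freePart (K := K) (coverDeg gr)) (i + 1) j) (i + 1)) :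
    (fun S => coverMapK gr (f S)) ∈ koszulBoundaries rk (varMul (K := K) M) gr (i + 1) j ↔
      koszulD rk (varMul (K := K) _) f ∈ koszulBoundaries rk (varMul (K := K) _)
        (syzGr (σ := σ) gr) i j := by
  constructor
  · rintro ⟨h', hh', e⟩
    obtain ⟨h, hh, rfl⟩ := exists_lift_koszulPart (coverMapK (σ := σ) gr) (exists_coverMapK_eq _ _) hh'
    refine ⟨f - koszulD rk (varMul (K := K) _) h, mem_koszulPart_syzGr.2 ⟨?_, fun S => ?_⟩, ?_⟩
    · exact Submodule.sub_mem _ hf (koszulD_mem_koszulPart rk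
        (shiftedPart_smul (varMul_mem_freePart _) _ _) hh)
    · rw [coverMapK_koszulD] at e
      simpa [sub_eq_zero] using (congrFun e S).symm
    · rw [map_sub, koszulD_koszulD hrk varMul_comm, sub_zero]
  · rintro ⟨g, hg, e⟩
    rw [SetLike.mem_coe, mem_koszulPart_syzGr] at hg
    obtain ⟨h, hh, e'⟩ := exists_koszulD_eq_of_cycle hrk (Submodule.sub_mem _ hf hg.1)
      (by rw [map_sub, e, sub_self])
    refine ⟨fun S => coverMapK gr (h S),
      comp_mem_koszulPart _ (coverMapK_mem_shiftedPart hgr _ _) hh, ?_⟩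
    rw [coverMapK_koszulD, e']
    ext S
    simp [hg.2]

/-- Dimension shifting. The correspondence consists of the chains of the free cover whose
differential vanishes in `M`: such a chain yields a cycle of `M` by projection and a cycle of the
syzygies by applying the differential. -/
theorem finrank_koszulHomology_syzGr (hrk : Function.Injective rk)
    (hgr : ∀ k d, ∀ v ∈ gr d, varMul (K := K) (σ := σ) M k v ∈ gr (d + 1)) (i j : ℕ) :
    Module.finrank K (SubQuotient (koszulCycles rk (varMul (K := K) M) gr (i + 2) j)
      (koszulBoundaries rk (varMul (K := K) M) gr (i + 2) j)) =
    Module.finrank K (SubQuotient (koszulCycles rk (varMul (K := K) _)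
        (syzGr (σ := σ) gr) (i + 1) j)
      (koszulBoundaries rk (varMul (K := K) _)
        (syzGr (σ := σ) gr) (i + 1) j)) := by
  refine finrank_subQuotient_eq
    (koszulPart σ (shiftedPart (freePart (K := K) (coverDeg gr)) (i + 2) j) (i + 2) ⊓
      LinearMap.ker ((coverMapK gr).compLeft (Finset σ) ∘ₗ koszulD rk (varMul (K := K) _)))
    ((coverMapK gr).compLeft (Finset σ)) (koszulD rk (varMul (K := K) _)) ?_ ?_ ?_ ?_ ?_
  · rintro f ⟨hf, hf'⟩
    refine ⟨comp_mem_koszulPart _ (coverMapK_mem_shiftedPart hgr _ _) hf, ?_⟩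
    exact (coverMapK_koszulD gr f).trans hf'
  · rintro f ⟨hf, hf'⟩
    refine ⟨mem_koszulPart_syzGr.2 ⟨koszulD_mem_koszulPart rk
        (shiftedPart_smul (varMul_mem_freePart _) _ _) hf, fun S => congrFun hf' S⟩, ?_⟩
    exact koszulD_koszulD hrk varMul_comm f
  · rintro z ⟨hz, hz'⟩
    obtain ⟨f, hf, rfl⟩ := exists_lift_koszulPart (coverMapK (σ := σ) gr) (exists_coverMapK_eq _ _) hz
    exact ⟨f, ⟨hf, (coverMapK_koszulD gr f).symm.trans hz'⟩, rfl⟩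
  · rintro z ⟨hz, hz'⟩
    rw [SetLike.mem_coe, mem_koszulPart_syzGr] at hz
    obtain ⟨f, hf, rfl⟩ := exists_koszulD_eq_of_cycle hrk hz.1 hz'
    exact ⟨f, ⟨hf, funext hz.2⟩, rfl⟩
  · rintro f ⟨hf, -⟩
    exact mem_koszulBoundaries_cover_iff hrk hgr hf

theorem eq_single_of_mem_koszulPart_zero {V : Submodule K M} {f : Finset σ → M}
    (hf : f ∈ koszulPart σ V 0) : f = Pi.single ∅ (f ∅) := by
  ext S
  by_cases hS : S = ∅
  · subst hS
    simp
  · rw [Pi.single_eq_of_ne hS, (mem_koszulPart.1 hf S).2 (by simpa using hS)]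

theorem single_mem_koszulPart_zero {V : Submodule K M} {v : M} (hv : v ∈ V) :
    (Pi.single ∅ v : Finset σ → M) ∈ koszulPart σ V 0 := by
  rw [mem_koszulPart]
  intro S
  by_cases hS : S = ∅
  · subst hS
    simp [hv]
  · simp [Pi.single_eq_of_ne hS]

/-- The degree `j` part of `F ⊗_R K` for the free cover `F`. -/
def redGr (gr : ℕ → Submodule K M) (j : ℕ) : Submodule K (CoverGen gr →₀ K) :=
  Finsupp.supported K K {b | coverDeg gr b = j}

/-- The map `F' ⊗_R K → F ⊗_R K` induced by a cover `F' → F` of a submodule of a free module. -/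
def redMap (σ : Type) {gen : Type u} (gr : ℕ → Submodule K (gen →₀ MvPolynomial σ K)) :
    (CoverGen gr →₀ K) →ₗ[K] (gen →₀ K) :=
  Finsupp.linearCombination K fun b =>
    Finsupp.mapRange (constantCoeff (R := K) (σ := σ)) (map_zero _)
      (coverMap (fun k => (gr k : Set _)) (Finsupp.single b (1 : MvPolynomial σ K)))

theorem redMap_apply {gen : Type u} (gr : ℕ → Submodule K (gen →₀ MvPolynomial σ K))
    (c : CoverGen gr →₀ K) (b : gen) :
    redMap σ gr c b = constantCoeff (coverMapK (σ := σ) gr (constVec c) b) := by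
  induction c using Finsupp.induction_linear with
  | zero => simp
  | add c c' h h' => simp [h, h']
  | single a r =>
    have : (Finsupp.single a (C r) : CoverGen gr →₀ MvPolynomial σ K) =
        r • Finsupp.single a (1 : MvPolynomial σ K) := by
      rw [Finsupp.smul_single, smul_eq_C_mul, mul_one]
    rw [constVec_single, this, map_smul, redMap, Finsupp.linearCombination_single]
    rw [Finsupp.smul_apply, Finsupp.smul_apply, Finsupp.mapRange_apply, smul_eq_C_mul, map_mul,
      constantCoeff_C, smul_eq_mul]
    rfl

/-- Both conditions say that the element of `M` represented by `c` lies in `(x)M`: a syzygy with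
constant part `c` differs from the constant vector `c` by a vector without constant terms, that is,
by a boundary in the free module. -/
theorem mem_map_redMap_iff (hrk : Function.Injective rk)
    (hgr : ∀ k d, ∀ v ∈ gr d, varMul (K := K) (σ := σ) M k v ∈ gr (d + 1)) {j : ℕ}
    {c : CoverGen gr →₀ K} (hc : c ∈ redGr gr j) :
    c ∈ (redGr (syzGr (σ := σ) gr) j).map (redMap σ (syzGr gr)) ↔
      (Pi.single ∅ (coverMapK (σ := σ) gr (constVec c)) : Finset σ → M) ∈
        koszulBoundaries rk (varMul (K := K) M) gr 0 j := by
  constructor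
  · rintro ⟨c', hc', rfl⟩
    have h1 : coverMapK (syzGr (σ := σ) gr) (constVec c') ∈ syzGr (σ := σ) gr j :=
      coverMap_mem (varMul_mem_syzGr gr) (constVec_mem_freePart hc')
    obtain ⟨g, hg, e⟩ := exists_koszulD_eq_of_constantCoeff hrk
      (Submodule.sub_mem _ (constVec_mem_freePart hc) h1.2) fun b => by
        rw [Finsupp.sub_apply, map_sub, constVec_apply, constantCoeff_C, redMap_apply, sub_self]
    refine ⟨fun S => coverMapK gr (g S),
      comp_mem_koszulPart _ (coverMapK_mem_shiftedPart hgr _ _) hg, ?_⟩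
    rw [coverMapK_koszulD, e]
    have h2 : coverMapK gr (coverMapK (syzGr (σ := σ) gr) (constVec c')) = 0 := h1.1
    ext S
    by_cases hS : S = ∅
    · subst hS
      simp only [Pi.single_eq_same]
      rw [map_sub, h2, sub_zero]
    · simp only [Pi.single_eq_of_ne hS, map_zero]
  · rintro ⟨h', hh', e⟩
    obtain ⟨h, hh, rfl⟩ :=
      exists_lift_koszulPart (coverMapK (σ := σ) gr) (exists_coverMapK_eq _ _) hh'
    have h1 := koszulD_mem_koszulPart rk (shiftedPart_smul (varMul_mem_freePart _) _ _) hh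
    have h2 : constVec c - koszulD rk (varMul (K := K) _) h ∅ ∈ syzGr (σ := σ) gr j := by
      refine ⟨?_, Submodule.sub_mem _ (constVec_mem_freePart hc) ?_⟩
      · rw [SetLike.mem_coe, LinearMap.mem_ker, map_sub, sub_eq_zero]
        rw [coverMapK_koszulD] at e
        simpa using (congrFun e ∅).symm
      · simpa only [shiftedPart_zero] using (mem_koszulPart.1 h1 ∅).1
    -- Every homogeneous syzygy is itself a generator of the next cover, so one basis vector is a
    -- preimage.
    refine ⟨Finsupp.single ⟨(j, _), h2⟩ 1, ?_, ?_⟩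
    · exact Finsupp.single_mem_supported K _ rfl
    · ext b
      rw [redMap_apply, constVec_single, C_1]
      have h3 : coverMapK (σ := σ) (syzGr gr) (Finsupp.single ⟨(j, _), h2⟩ 1) = _ := coverMap_single h2
      rw [h3, Finsupp.sub_apply, map_sub, constantCoeff_koszulD, constVec_apply, constantCoeff_C,
        sub_zero]

theorem finrank_gradedTor_zero (hrk : Function.Injective rk)
    (hgr : ∀ k d, ∀ v ∈ gr d, varMul (K := K) (σ := σ) M k v ∈ gr (d + 1)) (j : ℕ) :
    Module.finrank K (SubQuotient (redGr gr j)
      ((redGr (syzGr (σ := σ) gr) j).map (redMap σ (syzGr gr)))) =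
    Module.finrank K (SubQuotient (koszulCycles rk (varMul (K := K) (σ := σ) M) gr 0 j)
      (koszulBoundaries rk (varMul (K := K) M) gr 0 j)) := by
  refine finrank_subQuotient_eq (redGr gr j) LinearMap.id
    (LinearMap.single K (fun _ : Finset σ => M) ∅ ∘ₗ coverMapK (σ := σ) gr ∘ₗ constVec)
    (fun c hc => hc) ?_ (fun c hc => ⟨c, hc, rfl⟩) ?_ ?_
  · intro c hc
    have h : coverMapK (σ := σ) gr (constVec c) ∈ gr j :=
      coverMap_mem hgr (constVec_mem_freePart hc)
    have h' := single_mem_koszulPart_zero (σ := σ) h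
    refine ⟨?_, koszulD_koszulPart_zero rk _ h'⟩
    rw [shiftedPart_zero]
    exact h'
  · rintro z ⟨hz, -⟩
    have h := (mem_koszulPart.1 hz ∅).1
    rw [shiftedPart_zero] at h
    refine ⟨Finsupp.single ⟨(j, _), h⟩ 1, Finsupp.single_mem_supported K _ rfl, ?_⟩
    refine Eq.trans ?_ (eq_single_of_mem_koszulPart_zero hz).symm
    simp only [LinearMap.comp_apply, constVec_single, C_1]
    exact congrArg (Pi.single ∅) (coverMap_single h)
  · intro c hc
    exact mem_map_redMap_iff hrk hgr hc

/-- Dimension shifting from degree `1` to degree `0` differs from the higher cases, because the free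
module has homology in degree `0`: only the kernel of `Syz ⊗ K → F ⊗ K` appears. The correspondence
pairs `c` in `Syz`'s reduced cover with a `1`-chain `f` of `F` whose differential is the syzygy
represented by `c`. -/
theorem finrank_gradedTor_one (hrk : Function.Injective rk)
    (hgr : ∀ k d, ∀ v ∈ gr d, varMul (K := K) (σ := σ) M k v ∈ gr (d + 1)) (j : ℕ) :
    Module.finrank K (SubQuotient
      (redGr (syzGr (σ := σ) gr) j ⊓ LinearMap.ker (redMap σ (syzGr gr)))
      ((redGr (syzGr (σ := σ) (syzGr (σ := σ) gr)) j).map (redMap σ (syzGr (syzGr gr))))) =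
    Module.finrank K (SubQuotient (koszulCycles rk (varMul (K := K) (σ := σ) M) gr 1 j)
      (koszulBoundaries rk (varMul (K := K) M) gr 1 j)) := by
  have key : ∀ c ∈ redGr (syzGr (σ := σ) gr) j,
      coverMapK (syzGr (σ := σ) gr) (constVec c) ∈ syzGr (σ := σ) gr j := fun c hc =>
    coverMap_mem (varMul_mem_syzGr gr) (constVec_mem_freePart hc)
  refine finrank_subQuotient_eq
    (((redGr (syzGr (σ := σ) gr) j).prod
        (koszulPart σ (shiftedPart (freePart (K := K) (σ := σ) (coverDeg gr)) 1 j) 1)) ⊓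
      LinearMap.eqLocus
        (LinearMap.single K (fun _ : Finset σ => CoverGen gr →₀ MvPolynomial σ K) ∅ ∘ₗ
          coverMapK (σ := σ) (syzGr gr) ∘ₗ constVec ∘ₗ LinearMap.fst K _ _)
        (koszulD rk (varMul (K := K) _) ∘ₗ LinearMap.snd K _ _))
    (LinearMap.fst K _ _) ((coverMapK gr).compLeft (Finset σ) ∘ₗ LinearMap.snd K _ _) ?_ ?_ ?_ ?_ ?_
  · rintro ⟨c, f⟩ ⟨⟨hc, hf⟩, e⟩
    refine ⟨hc, ?_⟩
    rw [SetLike.mem_coe, LinearMap.mem_ker]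
    ext b
    have e' : coverMapK (σ := σ) (syzGr gr) (constVec c) = koszulD rk (varMul (K := K) _) f ∅ := by
      simpa using congrFun e ∅
    rw [LinearMap.fst_apply, redMap_apply, e', constantCoeff_koszulD, Finsupp.zero_apply]
  · rintro ⟨c, f⟩ ⟨⟨hc, hf⟩, e⟩
    refine ⟨comp_mem_koszulPart _ (coverMapK_mem_shiftedPart hgr _ _) hf, ?_⟩
    refine (coverMapK_koszulD gr f).trans ?_
    have e' : Pi.single ∅ (coverMapK (σ := σ) (syzGr gr) (constVec c)) =
      koszulD rk (varMul (K := K) _) f := e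
    rw [← e']
    have h2 : coverMapK gr (coverMapK (syzGr (σ := σ) gr) (constVec c)) = 0 := (key c hc).1
    ext S
    by_cases hS : S = ∅
    · subst hS
      simp only [Pi.single_eq_same]
      exact h2
    · simp only [Pi.single_eq_of_ne hS, map_zero]
      rfl
  · rintro c ⟨hc, hc'⟩
    rw [SetLike.mem_coe, LinearMap.mem_ker] at hc'
    obtain ⟨f, hf, e⟩ := exists_koszulD_eq_of_constantCoeff hrk (key c hc).2 fun b => by
      rw [← redMap_apply, hc', Finsupp.zero_apply]
    exact ⟨(c, f), ⟨⟨hc, hf⟩, e.symm⟩, rfl⟩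
  · rintro z ⟨hz, hz'⟩
    obtain ⟨f, hf, rfl⟩ :=
      exists_lift_koszulPart (coverMapK (σ := σ) gr) (exists_coverMapK_eq _ _) hz
    have h1 := koszulD_mem_koszulPart rk (shiftedPart_smul (varMul_mem_freePart _) _ _) hf
    have h2 : koszulD rk (varMul (K := K) _) f ∅ ∈ syzGr (σ := σ) gr j := by
      refine ⟨congrFun ((coverMapK_koszulD gr f).symm.trans hz') ∅, ?_⟩
      have h2 := (mem_koszulPart.1 h1 ∅).1
      rw [shiftedPart_zero] at h2
      exact h2
    refine ⟨(Finsupp.single ⟨(j, _), h2⟩ 1, f),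
      ⟨⟨Finsupp.single_mem_supported K _ rfl, hf⟩, ?_⟩, rfl⟩
    refine Eq.trans ?_ (eq_single_of_mem_koszulPart_zero h1).symm
    simp only [LinearMap.comp_apply, LinearMap.fst_apply, constVec_single, C_1]
    exact congrArg (Pi.single ∅) (coverMap_single h2)
  · rintro ⟨c, f⟩ ⟨⟨hc, hf⟩, e⟩
    refine (mem_map_redMap_iff hrk (varMul_mem_syzGr gr) hc).trans ?_
    refine Iff.trans ?_ (mem_koszulBoundaries_cover_iff hrk hgr hf).symm
    exact iff_of_eq (congrArg (· ∈ _) e)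

/-- The functorial resolution of the syzygy module is the tail of that of `M`, so on the Tor side
dimension shifting is an identity of constructions. -/
theorem resStage_syzGr (gr : ℕ → Submodule K M) (i : ℕ) :
    resStage (K := K) (σ := σ) (fun k => (gr k : Set M)) (i + 1) =
      resStage (fun k => (syzGr (σ := σ) gr k : Set (CoverGen gr →₀ MvPolynomial σ K))) i := by
  induction i with
  | zero => rfl
  | succ i ih => exact congrArg ResolutionStage.next ih

theorem finrank_gradedTor_succ (gr : ℕ → Submodule K M) (i j : ℕ) :
    Module.finrank K (GradedTor K σ (fun k => (gr k : Set M)) (i + 2) j) =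
      Module.finrank K (GradedTor K σ (fun k => (syzGr (σ := σ) gr k : Set (CoverGen gr →₀ MvPolynomial σ K))) (i + 1) j) :=
  congrArg (fun S : ResolutionStage K σ => Module.finrank K (SubQuotient
    (S.next.redPart j ⊓ LinearMap.ker S.redDiff) ((S.next.next.redPart j).map S.next.redDiff)))
    (resStage_syzGr gr i)

end Bridge

/-- Induction on `i` for all graded modules at once, since each step replaces `M` by its syzygy
module. -/
theorem finrank_gradedTor_pos {K : Type u} [Field K] {σ : Type} [Fintype σ] [DecidableEq σ]
    {rk : σ → ℕ} (hrk : Function.Injective rk) (i j : ℕ) {M : Type u} [AddCommGroup M]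
    [Module K M] [Module (MvPolynomial σ K) M] [IsScalarTower K (MvPolynomial σ K) M]
    {gr : ℕ → Submodule K M}
    (hgr : ∀ k d, ∀ v ∈ gr d, varMul (K := K) (σ := σ) M k v ∈ gr (d + 1)) :
    Module.finrank K (GradedTor K σ (fun k => (gr k : Set M)) (i + 1) j) =
    Module.finrank K (SubQuotient (koszulCycles rk (varMul (K := K) (σ := σ) M) gr (i + 1) j)
      (koszulBoundaries rk (varMul (K := K) M) gr (i + 1) j)) := by
  induction i generalizing M with
  | zero => exact finrank_gradedTor_one hrk hgr j
  | succ i ih =>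
    rw [finrank_gradedTor_succ, ih (varMul_mem_syzGr gr), finrank_koszulHomology_syzGr hrk hgr]

/-- Graded Tor is computed by Koszul homology. -/
theorem finrank_gradedTor {K : Type u} [Field K] {σ : Type} [Fintype σ] [DecidableEq σ]
    {rk : σ → ℕ} (hrk : Function.Injective rk) (i j : ℕ) {M : Type u} [AddCommGroup M]
    [Module K M] [Module (MvPolynomial σ K) M] [IsScalarTower K (MvPolynomial σ K) M]
    {gr : ℕ → Submodule K M}
    (hgr : ∀ k d, ∀ v ∈ gr d, varMul (K := K) (σ := σ) M k v ∈ gr (d + 1)) :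
    Module.finrank K (GradedTor K σ (fun k => (gr k : Set M)) i j) =
    Module.finrank K (SubQuotient (koszulCycles rk (varMul (K := K) (σ := σ) M) gr i j)
      (koszulBoundaries rk (varMul (K := K) M) gr i j)) := by
  cases i with
  | zero => exact finrank_gradedTor_zero hrk hgr j
  | succ i => exact finrank_gradedTor_pos hrk i j hgr

end

noncomputable section

/-! ## Poincaré series in terms of the ranks of the Koszul differentials -/

section Ranks

variable {K : Type*} [Field K] {σ : Type*} [Fintype σ] [DecidableEq σ]
  {M : Type*} [AddCommGroup M] [Module K M]

/-- The rank of the Koszul differential on the chains of homological degree `i` with values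
in `V`. -/
def koszulRank (rk : σ → ℕ) (x : σ → Module.End K M) (V : Submodule K M) (i : ℕ) : ℕ :=
  Module.finrank K ((koszulPart σ V i).map (koszulD rk x))

/-- The generating polynomial of the ranks of the Koszul differentials. -/
def rankPoly (rk : σ → ℕ) (x : σ → Module.End K M) (V : Submodule K M) : Polynomial ℤ :=
  ∑ i ∈ Finset.range (Fintype.card σ + 1), Polynomial.monomial i (koszulRank rk x V i : ℤ)

theorem koszulPart_eq_bot_of_card_lt (V : Submodule K M) {i : ℕ} (h : Fintype.card σ < i) :
    koszulPart σ V i = ⊥ := by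
  rw [eq_bot_iff]
  intro f hf
  ext S
  exact (mem_koszulPart.1 hf S).2 ((Finset.card_le_univ S).trans_lt h).ne

theorem coeff_rankPoly (rk : σ → ℕ) (x : σ → Module.End K M) (V : Submodule K M) (i : ℕ) :
    (rankPoly rk x V).coeff i = koszulRank rk x V i := by
  simp only [rankPoly, Polynomial.finsetSum_coeff, Polynomial.coeff_monomial,
    Finset.sum_ite_eq', Finset.mem_range]
  split_ifs with h
  · rfl
  · rw [koszulRank, koszulPart_eq_bot_of_card_lt V (by omega), Submodule.map_bot, finrank_bot,
      Nat.cast_zero]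

theorem koszulRank_zero (rk : σ → ℕ) (x : σ → Module.End K M) (V : Submodule K M) :
    koszulRank rk x V 0 = 0 := by
  have : (koszulPart σ V 0).map (koszulD rk x) = ⊥ := by
    rw [eq_bot_iff]
    rintro _ ⟨f, hf, rfl⟩
    exact koszulD_koszulPart_zero rk x hf
  rw [koszulRank, this, finrank_bot]

/-- Chains of homological degree `i` are functions on the subsets with `i` elements. -/
def koszulPartEquiv (V : Submodule K M) (i : ℕ) :
    koszulPart σ V i ≃ₗ[K] ({S : Finset σ // S.card = i} → V) where
  toFun f S := ⟨f.1 S.1, (mem_koszulPart.1 f.2 S.1).1⟩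
  map_add' _ _ := rfl
  map_smul' _ _ := rfl
  invFun g := ⟨fun S => if h : S.card = i then g ⟨S, h⟩ else 0, by
    rw [mem_koszulPart]
    intro S
    by_cases h : S.card = i <;> simp [h]⟩
  left_inv f := by
    ext S
    by_cases h : S.card = i
    · simp [h]
    · simp [h, (mem_koszulPart.1 f.2 S).2 h]
  right_inv g := by
    ext S
    simp [S.2]

instance finite_koszulPart (V : Submodule K M) [Module.Finite K V] (i : ℕ) :
    Module.Finite K (koszulPart σ V i) :=
  Module.Finite.equiv (koszulPartEquiv V i).symm

theorem finrank_koszulPart (V : Submodule K M) [Module.Finite K V] (i : ℕ) :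
    Module.finrank K (koszulPart σ V i) = (Fintype.card σ).choose i * Module.finrank K V := by
  rw [(koszulPartEquiv V i).finrank_eq, Module.finrank_pi_fintype, Finset.sum_const,
    Finset.card_univ, Fintype.card_finset_len, smul_eq_mul]

theorem finrank_map_add_finrank_inf_ker {V W : Type*} [AddCommGroup V] [Module K V]
    [AddCommGroup W] [Module K W] (f : V →ₗ[K] W) (P : Submodule K V) [Module.Finite K P] :
    Module.finrank K (P.map f) + Module.finrank K (P ⊓ LinearMap.ker f : Submodule K V) =
      Module.finrank K P := by
  have h1 := LinearMap.finrank_range_add_finrank_ker (f.comp P.subtype)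
  have h2 : LinearMap.range (f.comp P.subtype) = P.map f := by
    rw [LinearMap.range_comp, Submodule.range_subtype]
  have h3 : (LinearMap.ker (f.comp P.subtype)).map P.subtype = P ⊓ LinearMap.ker f := by
    rw [LinearMap.ker_comp, Submodule.map_comap_subtype]
  rw [h2] at h1
  rw [← h3, ← (Submodule.equivMapOfInjective P.subtype P.subtype_injective _).finrank_eq, h1]

/-- Rank-nullity: the cycles lose the rank of the outgoing differential, the quotient loses the rank
of the incoming one. All chain spaces are finite dimensional. -/
theorem finrank_koszulHomology {rk : σ → ℕ} (hrk : Function.Injective rk)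
    {x : σ → Module.End K M} (hx : ∀ k l v, x k (x l v) = x l (x k v))
    {gr : ℕ → Submodule K M} (hgr : ∀ k d, ∀ v ∈ gr d, x k v ∈ gr (d + 1))
    [∀ d, Module.Finite K (gr d)] (i j : ℕ) :
    (Module.finrank K ((koszulCycles rk x gr i j) ⧸
      (koszulBoundaries rk x gr i j).comap (koszulCycles rk x gr i j).subtype) : ℤ) =
    (Fintype.card σ).choose i * Module.finrank K (shiftedPart gr i j) -
      koszulRank rk x (shiftedPart gr i j) i -
      koszulRank rk x (shiftedPart gr (i + 1) j) (i + 1) := by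
  have hfin : ∀ i, Module.Finite K (shiftedPart gr i j) := by
    intro i
    by_cases h : i ≤ j
    · rw [shiftedPart, if_pos h]
      infer_instance
    · rw [shiftedPart, if_neg h]
      infer_instance
  have hle : koszulBoundaries rk x gr i j ≤ koszulCycles rk x gr i j := by
    rintro _ ⟨f, hf, rfl⟩
    exact ⟨koszulD_mem_koszulPart rk (shiftedPart_smul hgr i j) hf, koszulD_koszulD hrk hx f⟩
  have h1 := finrank_map_add_finrank_inf_ker (koszulD rk x)
    (koszulPart σ (shiftedPart gr i j) i)
  have : Module.Finite K (koszulCycles rk x gr i j) :=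
    Submodule.finiteDimensional_of_le (S₂ := koszulPart σ (shiftedPart gr i j) i) inf_le_left
  have h2 := Submodule.finrank_quotient_add_finrank
    ((koszulBoundaries rk x gr i j).comap (koszulCycles rk x gr i j).subtype)
  rw [(Submodule.comapSubtypeEquivOfLe hle).finrank_eq] at h2
  rw [finrank_koszulPart] at h1
  have h3 : (koszulRank rk x (shiftedPart gr (i + 1) j) (i + 1)) =
    Module.finrank K (koszulBoundaries rk x gr i j) := rfl
  have h4 : koszulRank rk x (shiftedPart gr i j) i = Module.finrank K
    ((koszulPart σ (shiftedPart gr i j) i).map (koszulD rk x)) := rfl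
  have h5 : Module.finrank K (koszulCycles rk x gr i j) = Module.finrank K
    (koszulPart σ (shiftedPart gr i j) i ⊓ LinearMap.ker (koszulD rk x) : Submodule K _) := rfl
  rw [h3, h4]
  rw [h5] at h2
  zify at h1 h2
  linarith

end Ranks

/-! ### Generating series of families of polynomials indexed by the degree -/

section Series

/-- The series `∑_d s^d G_d(st)`. -/
def gradedSeries : (ℕ → Polynomial ℤ) →+ MvPowerSeries (Fin 2) ℤ where
  toFun G m := if m 0 ≤ m 1 then (G (m 1 - m 0)).coeff (m 0) else 0
  map_zero' := by
    funext m
    simp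
    rfl
  map_add' G G' := by
    funext m
    change (if m 0 ≤ m 1 then ((G + G') (m 1 - m 0)).coeff (m 0) else 0) =
      (if m 0 ≤ m 1 then (G (m 1 - m 0)).coeff (m 0) else 0) +
      (if m 0 ≤ m 1 then (G' (m 1 - m 0)).coeff (m 0) else 0)
    split_ifs <;> simp

theorem coeff_gradedSeries (G : ℕ → Polynomial ℤ) (m : Fin 2 →₀ ℕ) :
    MvPowerSeries.coeff m (gradedSeries G) =
      if m 0 ≤ m 1 then (G (m 1 - m 0)).coeff (m 0) else 0 := rfl

theorem mvPowerSeries_coeff_X_mul (k : Fin 2) (F : MvPowerSeries (Fin 2) ℤ) (m : Fin 2 →₀ ℕ) :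
    MvPowerSeries.coeff m (MvPowerSeries.X k * F) =
      if m k ≠ 0 then MvPowerSeries.coeff (m - Finsupp.single k 1) F else 0 := by
  rw [MvPowerSeries.X, MvPowerSeries.coeff_monomial_mul, one_mul]
  simp [Nat.one_le_iff_ne_zero]

theorem gradedSeries_X_mul (G : ℕ → Polynomial ℤ) :
    gradedSeries (fun d => Polynomial.X * G d) =
      MvPowerSeries.X 1 * MvPowerSeries.X 0 * gradedSeries G := by
  ext m
  rw [mul_assoc, mvPowerSeries_coeff_X_mul, mvPowerSeries_coeff_X_mul, coeff_gradedSeries,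
    coeff_gradedSeries]
  rcases h0 : m 0 with _ | a
  · simp [h0]
  · rcases h1 : m 1 with _ | b
    · simp
    · simp [h0, h1, Polynomial.coeff_X_mul]

/-- `X` stands for `st`: for values in a fixed degree `d`, raising the homological degree by one
raises the total degree by one. -/
theorem gradedSeries_mul (p : Polynomial ℤ) (G : ℕ → Polynomial ℤ) :
    gradedSeries (fun d => p * G d) =
      Polynomial.aeval (MvPowerSeries.X 1 * MvPowerSeries.X 0) p * gradedSeries G := by
  induction p using Polynomial.induction_on generalizing G with
  | C a =>
    rw [Polynomial.aeval_C, eq_intCast (algebraMap ℤ (MvPowerSeries (Fin 2) ℤ)) a, ← zsmul_eq_mul, ← map_zsmul]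
    congr 1
    ext1 d
    simp
  | add p q hp hq =>
    rw [map_add, add_mul, ← hp, ← hq, ← map_add]
    congr 1
    ext1 d
    exact add_mul _ _ _
  | monomial n a ih =>
    have e : (fun d => Polynomial.C a * Polynomial.X ^ (n + 1) * G d) =
        fun d => Polynomial.C a * Polynomial.X ^ n * (Polynomial.X * G d) := by
      ext1 d
      ring
    rw [e, ih, gradedSeries_X_mul]
    simp only [map_mul, map_pow, Polynomial.aeval_X, Polynomial.aeval_C]
    ring

/-- Evaluates the corrections concentrated in one degree: `0` for the fiber product, `e` and `e-1`
for the connected sum. -/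
theorem gradedSeries_single (e : ℕ) (p : Polynomial ℤ) :
    gradedSeries (Pi.single e p) = MvPowerSeries.X 1 ^ e *
      Polynomial.aeval (MvPowerSeries.X 1 * MvPowerSeries.X 0 : MvPowerSeries (Fin 2) ℤ) p := by
  have h1 : gradedSeries (Pi.single e 1) = MvPowerSeries.X 1 ^ e := by
    ext m
    rw [coeff_gradedSeries, MvPowerSeries.coeff_X_pow]
    have hm : m = Finsupp.single 1 e ↔ m 0 = 0 ∧ m 1 = e := by
      constructor
      · rintro rfl
        simp
      · rintro ⟨h0, h1⟩
        ext i
        fin_cases i <;> simp [h0, h1]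
    simp only [hm, Pi.single_apply]
    split_ifs <;> simp_all [Polynomial.coeff_one]; omega
  have h2 : (Pi.single e p : ℕ → Polynomial ℤ) =
      fun d => p * (Pi.single e 1 : ℕ → Polynomial ℤ) d := by
    ext1 d
    by_cases h : d = e
    · subst h
      simp
    · simp [Pi.single_eq_of_ne h]
  rw [h2, gradedSeries_mul, h1, mul_comm]

end Series

/-! ### Poincaré series through Hilbert series and ranks -/

section Poincare

variable {K : Type u} [Field K] {σ : Type} [Fintype σ] [DecidableEq σ]
  {A : Type u} [CommRing A] [Algebra K A]

/-- Multiplication by the images of the variables. -/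
def actX (φ : MvPolynomial σ K →ₐ[K] A) (k : σ) : Module.End K A :=
  LinearMap.mulLeft K (φ (X k))

theorem actX_apply (φ : MvPolynomial σ K →ₐ[K] A) (k : σ) (a : A) :
    actX φ k a = φ (X k) * a := rfl

theorem gradedBetti_eq (φ : MvPolynomial σ K →ₐ[K] A) {gr : ℕ → Submodule K A}
    [∀ d, Module.Finite K (gr d)] (hgr : ∀ k d, ∀ v ∈ gr d, actX φ k v ∈ gr (d + 1))
    {rk : σ → ℕ} (hrk : Function.Injective rk) (i j : ℕ) :
    (gradedBetti φ gr i j : ℤ) =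
      (Fintype.card σ).choose i * Module.finrank K (shiftedPart gr i j) -
        koszulRank rk (actX φ) (shiftedPart gr i j) i -
        koszulRank rk (actX φ) (shiftedPart gr (i + 1) j) (i + 1) := by
  let : Module (MvPolynomial σ K) A := Module.compHom A (φ : MvPolynomial σ K →+* A)
  have : IsScalarTower K (MvPolynomial σ K) A := ⟨fun c p a => by
    change φ (c • p) * a = c • (φ p * a)
    rw [map_smul, smul_mul_assoc]⟩
  have h := finrank_gradedTor hrk i j (gr := gr) hgr
  rw [← finrank_koszulHomology hrk (fun k l v => mul_left_comm _ _ _) hgr]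
  exact congrArg Nat.cast h

/-- `t P = t (1 + st)^n H - (1 + t) ρ`, where `H` is the Hilbert series and `ρ` the generating
series of the ranks of the Koszul differentials. -/
theorem X_mul_poincareSeries (φ : MvPolynomial σ K →ₐ[K] A) {gr : ℕ → Submodule K A}
    [∀ d, Module.Finite K (gr d)] (hgr : ∀ k d, ∀ v ∈ gr d, actX φ k v ∈ gr (d + 1))
    {rk : σ → ℕ} (hrk : Function.Injective rk) :
    MvPowerSeries.X 0 * poincareSeries φ gr =
      MvPowerSeries.X 0 * ((1 + MvPowerSeries.X 1 * MvPowerSeries.X 0) ^ Fintype.card σ *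
        gradedSeries fun d => Polynomial.C (Module.finrank K (gr d) : ℤ)) -
      (1 + MvPowerSeries.X 0) * gradedSeries fun d => rankPoly rk (actX φ) (gr d) := by
  have e : ((1 + MvPowerSeries.X 1 * MvPowerSeries.X 0) ^ Fintype.card σ :
      MvPowerSeries (Fin 2) ℤ) = Polynomial.aeval (MvPowerSeries.X 1 * MvPowerSeries.X 0)
        ((1 + Polynomial.X) ^ Fintype.card σ : Polynomial ℤ) := by simp
  rw [e, ← gradedSeries_mul]
  have hc : ∀ m, MvPowerSeries.coeff m (poincareSeries φ gr) = gradedBetti φ gr (m 0) (m 1) :=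
    fun m => rfl
  ext m
  rw [map_sub, add_mul, one_mul, map_add]
  simp only [mvPowerSeries_coeff_X_mul, coeff_gradedSeries, hc,
    Polynomial.coeff_mul_C, Polynomial.coeff_one_add_X_pow, coeff_rankPoly]
  -- The coefficient of `t^0` vanishes on both sides because the differential is zero on `0`-chains.
  -- The coefficient of `t^(a+1)` involves the Betti number in homological degree `a` and the ranks
  -- in degrees `a` and `a+1`.
  rcases h0 : m 0 with _ | a
  · simp [koszulRank_zero]
  · have e0 : (m - Finsupp.single 0 1 : Fin 2 →₀ ℕ) 0 = a := by simp [h0]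
    have e1 : (m - Finsupp.single 0 1 : Fin 2 →₀ ℕ) 1 = m 1 := by simp
    rw [e0, e1, gradedBetti_eq φ hgr hrk]
    simp only [ne_eq, Nat.add_eq_zero_iff, one_ne_zero, and_false, not_false_eq_true, if_true]
    have hbot : ∀ i, koszulRank rk (actX φ) (⊥ : Submodule K A) i = 0 := by
      intro i
      have h : koszulPart σ (⊥ : Submodule K A) i = ⊥ := by
        rw [eq_bot_iff]
        intro f hf
        ext S
        exact (mem_koszulPart.1 hf S).1
      rw [koszulRank, h, Submodule.map_bot, finrank_bot]
    have hs : ∀ i j, i ≤ j → shiftedPart gr i j = gr (j - i) := fun i j h => if_pos h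
    have hs' : ∀ i j, ¬ i ≤ j → shiftedPart gr i j = ⊥ := fun i j h => if_neg h
    -- At the edge `a = m 1` only the outgoing rank survives: the incoming chains would have values
    -- in negative degree.
    by_cases h1 : a + 1 ≤ m 1
    · rw [hs _ _ h1, hs a _ (by omega), if_pos h1,
        if_pos (show a ≤ m 1 by omega), if_pos (show a ≤ m 1 by omega)]
      ring
    · rw [hs' _ _ h1, if_neg h1, hbot]
      by_cases h2 : a ≤ m 1
      · rw [hs _ _ h2, if_pos h2, if_pos h2]
        push_cast
        ring
      · rw [hs' _ _ h2, if_neg h2, if_neg h2, hbot, finrank_bot]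
        simp

end Poincare

end

noncomputable section

/-! ## Computing ranks of Koszul differentials -/

section RankComparison

variable {K : Type*} [Field K] {σ : Type*} [Fintype σ] [DecidableEq σ]
  {M : Type*} [AddCommGroup M] [Module K M] {M' : Type*} [AddCommGroup M'] [Module K M']

theorem finrank_map_of_injOn {V W : Type*} [AddCommGroup V] [Module K V]
    [AddCommGroup W] [Module K W] (f : V →ₗ[K] W) (P : Submodule K V)
    (h : ∀ v ∈ P, f v = 0 → v = 0) : Module.finrank K (P.map f) = Module.finrank K P := by
  have h1 : Function.Injective (f.comp P.subtype) := by
    rw [injective_iff_map_eq_zero]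
    exact fun v hv => Subtype.ext (h v v.2 hv)
  rw [← LinearMap.finrank_range_of_inj h1, LinearMap.range_comp, Submodule.range_subtype]

/-- Via `Θ` the map `D` becomes a product of the `D' i`, and `P` the product of the `P' i`; the
image of a product is the product of the images. -/
theorem finrank_map_eq_sum {C : Type*} [AddCommGroup C] [Module K C] {I : Type*} [Fintype I]
    {C' : I → Type*} [∀ i, AddCommGroup (C' i)] [∀ i, Module K (C' i)]
    (Θ : C →ₗ[K] ∀ i, C' i) (hΘ : Function.Injective Θ) (D : C →ₗ[K] C)
    (D' : ∀ i, C' i →ₗ[K] C' i) (hD : ∀ f i, Θ (D f) i = D' i (Θ f i))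
    (P : Submodule K C) (P' : ∀ i, Submodule K (C' i)) [∀ i, Module.Finite K (P' i)]
    (h : ∀ f ∈ P, ∀ i, Θ f i ∈ P' i) (h' : ∀ g, (∀ i, g i ∈ P' i) → ∃ f ∈ P, Θ f = g) :
    Module.finrank K (P.map D) = ∑ i, Module.finrank K ((P' i).map (D' i)) := by
  have key : ∀ f ∈ P.map D, ∀ i, Θ f i ∈ (P' i).map (D' i) := by
    rintro _ ⟨f, hf, rfl⟩ i
    rw [hD]
    exact ⟨_, h f hf i, rfl⟩
  let L : P.map D →ₗ[K] ∀ i, (P' i).map (D' i) :=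
    LinearMap.pi fun i => (LinearMap.proj i ∘ₗ Θ ∘ₗ (P.map D).subtype).codRestrict _
      fun f => key f f.2 i
  have hL : Function.Bijective L := by
    constructor
    · intro f g hfg
      refine Subtype.ext (hΘ (funext fun i => ?_))
      exact congrArg Subtype.val (congrFun hfg i)
    · intro g
      choose g' hg' hg'' using fun i => (g i).2
      obtain ⟨f, hf, e⟩ := h' g' hg'
      refine ⟨⟨D f, f, hf, rfl⟩, funext fun i => Subtype.ext ?_⟩
      refine (hD f i).trans ?_
      rw [e, hg'']
  rw [(LinearEquiv.ofBijective L hL).finrank_eq, Module.finrank_pi_fintype]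

/-- A rank sees only the target of the differential, so injectivity of `φ` is needed on `W` and not
on `V`. This covers degree `e` of the connected sum, where `V` is collapsed but the differential
lands in degree `e + 1`. -/
theorem koszulRank_map (rk : σ → ℕ) {x : σ → Module.End K M} {x' : σ → Module.End K M'}
    (φ : M →ₗ[K] M') (hφ : ∀ k v, φ (x k v) = x' k (φ v)) (V W : Submodule K M)
    (hV : ∀ k, ∀ v ∈ V, x k v ∈ W) (hW : ∀ w ∈ W, φ w = 0 → w = 0) (i : ℕ) :
    koszulRank rk x' (V.map φ) i = koszulRank rk x V i := by
  have h1 : (koszulPart σ (V.map φ) i).map (koszulD rk x') =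
      ((koszulPart σ V i).map (koszulD rk x)).map (φ.compLeft (Finset σ)) := by
    ext f
    constructor
    · rintro ⟨g, hg, rfl⟩
      obtain ⟨g', hg', rfl⟩ := exists_lift_koszulPart φ (V := V) (fun v hv => hv) hg
      exact ⟨_, ⟨g', hg', rfl⟩, (koszulD_comp rk φ hφ g').symm⟩
    · rintro ⟨_, ⟨g, hg, rfl⟩, rfl⟩
      exact ⟨fun S => φ (g S), comp_mem_koszulPart φ (fun v hv => Submodule.mem_map_of_mem hv) hg,
        koszulD_comp rk φ hφ g⟩
  rw [koszulRank, h1, finrank_map_of_injOn, koszulRank]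
  rintro _ ⟨g, hg, rfl⟩ h
  have hgW : ∀ S, koszulD rk x g S ∈ W := by
    intro S
    rw [koszulD_apply]
    exact W.sum_mem fun k _ => W.smul_mem _ (hV k _ (mem_koszulPart.1 hg _).1)
  ext S
  exact hW _ (hgW S) (congrFun h S)

theorem rankPoly_map (rk : σ → ℕ) {x : σ → Module.End K M} {x' : σ → Module.End K M'}
    (φ : M →ₗ[K] M') (hφ : ∀ k v, φ (x k v) = x' k (φ v)) (V W : Submodule K M)
    (hV : ∀ k, ∀ v ∈ V, x k v ∈ W) (hW : ∀ w ∈ W, φ w = 0 → w = 0) :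
    rankPoly rk x' (V.map φ) = rankPoly rk x V := by
  simp only [rankPoly, koszulRank_map rk φ hφ V W hV hW]

theorem rankPoly_pi {I : Type*} [Fintype I] {N : I → Type*} [∀ k, AddCommGroup (N k)]
    [∀ k, Module K (N k)] (rk : σ → ℕ) {x : σ → Module.End K (∀ k, N k)}
    {y : ∀ k, σ → Module.End K (N k)} (hx : ∀ p a k, x p a k = y k p (a k))
    (V : ∀ k, Submodule K (N k)) [∀ k, Module.Finite K (V k)] :
    rankPoly rk x (Submodule.pi Set.univ V) = ∑ k, rankPoly rk (y k) (V k) := by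
  ext i
  rw [Polynomial.finsetSum_coeff]
  simp only [coeff_rankPoly]
  rw [← Nat.cast_sum, Nat.cast_inj]
  refine finrank_map_eq_sum (C' := fun k => Finset σ → N k)
    (LinearMap.pi fun k => (LinearMap.proj k).compLeft (Finset σ)) ?_ _
    (fun k => koszulD rk (y k)) ?_ _ (fun k => koszulPart σ (V k) i) ?_ ?_
  · intro f g h
    ext S k
    exact congrFun (congrFun h k) S
  · intro f k
    exact (koszulD_comp rk (LinearMap.proj k) (fun p a => hx p a k) f).symm
  · intro f hf k
    exact comp_mem_koszulPart (V := Submodule.pi Set.univ V) (LinearMap.proj k)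
      (fun v hv => hv k trivial) hf
  · intro g hg
    refine ⟨fun S k => g k S, mem_koszulPart.2 fun S => ⟨fun k _ =>
      (mem_koszulPart.1 (hg k) S).1, fun hS => funext fun k =>
      (mem_koszulPart.1 (hg k) S).2 hS⟩, rfl⟩

/-- Variables acting as zero contribute a factor `1 + X`. -/
theorem rankPoly_of_embedding {τ : Type*} [Fintype τ] [DecidableEq τ] (ι : τ ↪ σ) {rk : σ → ℕ}
    {x : σ → Module.End K M} {y : τ → Module.End K M} (hxy : ∀ t, x (ι t) = y t)
    (hx : ∀ p ∉ Set.range ι, x p = 0) (V : Submodule K M) [Module.Finite K V] :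
    rankPoly rk x V =
      (1 + Polynomial.X) ^ (Fintype.card σ - Fintype.card τ) * rankPoly (rk ∘ ι) y V := by
  classical
  set s : Finset σ := (Finset.univ.map ι)ᶜ with hs
  have hmem : ∀ p, p ∈ s ↔ p ∉ Set.range ι := by simp [hs]
  have hcard : s.card = Fintype.card σ - Fintype.card τ := by
    rw [hs, Finset.card_compl, Finset.card_map, Finset.card_univ]
  -- The subsets `U` of the idle variables index the summands: as these variables act as zero, the
  -- differential preserves `S ∩ s`, and each value `U` of `S ∩ s` carries a copy of the small
  -- Koszul complex shifted by `|U|`.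
  have hpow : ((1 + Polynomial.X) ^ s.card : Polynomial ℤ) =
      ∑ U ∈ s.powerset, Polynomial.X ^ U.card := by
    have := Finset.sum_pow_mul_eq_add_pow (Polynomial.X : Polynomial ℤ) 1 s
    simp only [one_pow, mul_one] at this
    rw [this, add_comm]
  rw [← hcard, hpow, Finset.sum_mul]
  ext i
  simp only [Polynomial.finsetSum_coeff, Polynomial.coeff_X_pow_mul', coeff_rankPoly]
  rw [← Finset.sum_coe_sort]
  have hdisj : ∀ (T : Finset τ) (U : s.powerset), Disjoint (T.map ι) U.1 := by
    intro T U
    rw [Finset.disjoint_left]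
    intro p hp hpU
    obtain ⟨t, -, rfl⟩ := Finset.mem_map.1 hp
    exact (hmem _).1 (Finset.mem_powerset.1 U.2 hpU) ⟨t, rfl⟩
  have hpre : ∀ (T : Finset τ) (U : s.powerset),
      (T.map ι ∪ U.1).preimage ι ι.injective.injOn = T := by
    intro T U
    ext t
    have : ι t ∉ U.1 := fun h => (hmem _).1 (Finset.mem_powerset.1 U.2 h) ⟨t, rfl⟩
    simp only [Finset.mem_preimage, Finset.mem_union, Finset.mem_map', this, or_false]
  have hinter : ∀ (T : Finset τ) (U : s.powerset), (T.map ι ∪ U.1) ∩ s = U.1 := by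
    intro T U
    ext p
    have h1 : p ∈ U.1 → p ∈ s := fun h => Finset.mem_powerset.1 U.2 h
    have h2 : p ∈ T.map ι → p ∉ s := fun h h' => by
      obtain ⟨t, -, rfl⟩ := Finset.mem_map.1 h
      exact (hmem _).1 h' ⟨t, rfl⟩
    simp only [Finset.mem_inter, Finset.mem_union]
    tauto
  have hdecomp : ∀ S : Finset σ, (S.preimage ι ι.injective.injOn).map ι ∪ (S ∩ s) = S := by
    intro S
    ext p
    by_cases hp : p ∈ Set.range ι
    · obtain ⟨t, rfl⟩ := hp
      have : ι t ∉ s := fun h => (hmem _).1 h ⟨t, rfl⟩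
      simp [this]
    · have h1 : p ∈ s := (hmem p).2 hp
      have h2 : p ∉ (S.preimage ι ι.injective.injOn).map ι := by
        intro h
        obtain ⟨t, -, rfl⟩ := Finset.mem_map.1 h
        exact hp ⟨t, rfl⟩
      simp only [Finset.mem_inter, Finset.mem_union, h1, h2, and_true, false_or]
  have hcardU : ∀ (T : Finset τ) (U : s.powerset), (T.map ι ∪ U.1).card = T.card + U.1.card := by
    intro T U
    rw [Finset.card_union_of_disjoint (hdisj T U), Finset.card_map]
  -- The guard is essential: with truncated subtraction, `i - |U|` would be `0` for `|U| > i` and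
  -- produce spurious chains.
  let P' : s.powerset → Submodule K (Finset τ → M) := fun U =>
    if U.1.card ≤ i then koszulPart τ V (i - U.1.card) else ⊥
  have hP1 : ∀ U, U.1.card ≤ i → P' U = koszulPart τ V (i - U.1.card) := fun U h => if_pos h
  have hP0 : ∀ U, ¬ U.1.card ≤ i → P' U = ⊥ := fun U h => if_neg h
  have hP' : ∀ U g, g ∈ P' U ↔ ∀ T, g T ∈ V ∧ (T.card + U.1.card ≠ i → g T = 0) := by
    intro U g
    by_cases h : U.1.card ≤ i
    · simp only [hP1 U h, mem_koszulPart]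
      refine forall_congr' fun T => and_congr Iff.rfl ?_
      have : T.card ≠ i - U.1.card ↔ T.card + U.1.card ≠ i := by omega
      rw [this]
    · simp only [hP0 U h, Submodule.mem_bot]
      constructor
      · rintro rfl
        exact fun T => ⟨V.zero_mem, fun _ => rfl⟩
      · intro h'
        ext T
        exact (h' T).2 (by omega)
  have : ∀ U, Module.Finite K (P' U) := by
    intro U
    by_cases h : U.1.card ≤ i
    · rw [hP1 U h]
      infer_instance
    · rw [hP0 U h]
      infer_instance
  -- Twist absorbing the signs caused by the elements of `U` lying before those of `T`; without it
  -- the splitting would not commute with the differentials.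
  let ε : Finset τ → s.powerset → K := fun T U => ∏ t ∈ T, koszulSign K rk (ι t) U.1
  have hε : ∀ T U, ε T U * ε T U = 1 := by
    intro T U
    simp only [ε, ← Finset.prod_mul_distrib, koszulSign_mul_self, Finset.prod_const_one]
  have hε0 : ∀ T U, ε T U ≠ 0 := fun T U h => by simpa [h] using hε T U
  have hsign : ∀ (T : Finset τ) (U : s.powerset), ∀ t ∉ T,
      koszulSign K (rk ∘ ι) t T * ε (insert t T) U =
        ε T U * koszulSign K rk (ι t) (T.map ι ∪ U.1) := by
    intro T U t ht
    have h1 : koszulSign K rk (ι t) (T.map ι ∪ U.1) =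
        koszulSign K (rk ∘ ι) t T * koszulSign K rk (ι t) U.1 := by
      rw [koszulSign, Finset.filter_union, Finset.card_union_of_disjoint
        (Finset.disjoint_filter_filter (hdisj T U)), pow_add, Finset.filter_map, Finset.card_map]
      rfl
    rw [h1]
    simp only [ε, Finset.prod_insert ht]
    ring
  have hmain := finrank_map_eq_sum (C' := fun _ : s.powerset => Finset τ → M)
    (LinearMap.pi fun U => LinearMap.pi fun T => ε T U • LinearMap.proj (T.map ι ∪ U.1)) ?_
    (koszulD rk x)
    (fun _ => koszulD (rk ∘ ι) y) ?_ (koszulPart σ V i) P' ?_ ?_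
  · rw [koszulRank, hmain, Nat.cast_sum]
    refine Finset.sum_congr rfl fun U _ => ?_
    by_cases h : U.1.card ≤ i
    · rw [hP1 U h, if_pos h]
      rfl
    · rw [hP0 U h, if_neg h, Submodule.map_bot, finrank_bot, Nat.cast_zero]
  · intro f g h
    ext S
    rw [← hdecomp S]
    exact smul_right_injective M (hε0 _ _) (congrFun (congrFun h
      ⟨S ∩ s, Finset.mem_powerset.2 Finset.inter_subset_right⟩) (S.preimage ι ι.injective.injOn))
  · intro f U
    ext T
    change ε T U • koszulD rk x f (T.map ι ∪ U.1) =
      koszulD (rk ∘ ι) y (fun T => ε T U • f (T.map ι ∪ U.1)) T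
    rw [koszulD_apply, koszulD_apply, Finset.smul_sum]
    have hsub : Tᶜ.map ι ⊆ (T.map ι ∪ U.1)ᶜ := by
      intro p hp
      obtain ⟨t, ht, rfl⟩ := Finset.mem_map.1 hp
      have h2 : ι t ∉ U.1 := fun h => (hmem _).1 (Finset.mem_powerset.1 U.2 h) ⟨t, rfl⟩
      simpa [h2] using ht
    rw [← Finset.sum_subset hsub, Finset.sum_map]
    · refine Finset.sum_congr rfl fun t ht => ?_
      rw [map_smul, smul_smul, smul_smul, hsign T U t (by simpa using ht), hxy,
        Finset.map_insert, Finset.insert_union]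
    · intro p hp hp'
      rw [hx p, LinearMap.zero_apply, smul_zero, smul_zero]
      rintro ⟨t, rfl⟩
      apply hp'
      simp only [Finset.mem_compl, Finset.mem_union, Finset.mem_map', not_or] at hp ⊢
      exact hp.1
  · intro f hf U
    rw [hP']
    intro T
    change ε T U • f (T.map ι ∪ U.1) ∈ V ∧ (_ → ε T U • f (T.map ι ∪ U.1) = 0)
    refine ⟨V.smul_mem _ (mem_koszulPart.1 hf _).1, fun h => ?_⟩
    rw [(mem_koszulPart.1 hf _).2, smul_zero]
    rwa [hcardU]
  · intro g hg
    let W : Finset σ → s.powerset := fun S =>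
      ⟨S ∩ s, Finset.mem_powerset.2 Finset.inter_subset_right⟩
    refine ⟨fun S => ε (S.preimage ι ι.injective.injOn) (W S) •
      g (W S) (S.preimage ι ι.injective.injOn), ?_, ?_⟩
    · rw [mem_koszulPart]
      intro S
      have h1 := (hP' _ _).1 (hg (W S)) (S.preimage ι ι.injective.injOn)
      refine ⟨V.smul_mem _ h1.1, fun hS => ?_⟩
      rw [h1.2, smul_zero]
      rwa [← hcardU, hdecomp]
    · ext U T
      have hW : W (T.map ι ∪ U.1) = U := Subtype.ext (hinter T U)
      change ε T U • (ε ((T.map ι ∪ U.1).preimage ι ι.injective.injOn) (W (T.map ι ∪ U.1)) •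
        g (W (T.map ι ∪ U.1)) ((T.map ι ∪ U.1).preimage ι ι.injective.injOn)) = g U T
      rw [hpre, hW, smul_smul, hε, one_smul]

theorem koszulPart_span_singleton {v : M} {i : ℕ} {f : Finset σ → M}
    (hf : f ∈ koszulPart σ (Submodule.span K {v}) i) : ∃ c : Finset σ → K, ∀ S, f S = c S • v := by
  choose c hc using fun S => Submodule.mem_span_singleton.1 (mem_koszulPart.1 hf S).1
  exact ⟨c, fun S => (hc S).symm⟩

/-- On chains `S ↦ c_S v` the value of the differential at `S \ {k}` is a combination of the
independent vectors `x_l v` in which `x_k v` has coefficient `± c_S`. So the differential is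
injective in positive homological degrees, and zero in degree `0`; hence the `-1`. -/
theorem rankPoly_of_linearIndependent (rk : σ → ℕ) {x : σ → Module.End K M} {v : M} (hv : v ≠ 0)
    (hx : LinearIndependent K fun k => x k v) :
    rankPoly rk x (Submodule.span K {v}) = (1 + Polynomial.X) ^ Fintype.card σ - 1 := by
  ext i
  rw [coeff_rankPoly, Polynomial.coeff_sub, Polynomial.coeff_one_add_X_pow, Polynomial.coeff_one]
  rcases i with _ | i
  · simp [koszulRank_zero]
  · rw [if_neg (by simp), sub_zero, koszulRank, finrank_map_of_injOn, finrank_koszulPart,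
      finrank_span_singleton hv, mul_one]
    intro f hf h
    obtain ⟨c, hc⟩ := koszulPart_span_singleton hf
    ext S
    by_cases hS : S.card = i + 1
    · obtain ⟨k, hk⟩ := Finset.card_pos.1 (by omega : 0 < S.card)
      have h1 := congrFun h (S.erase k)
      simp only [koszulD_apply, hc, map_smul, smul_smul, Pi.zero_apply] at h1
      have h2 := linearIndependent_iff'.1 hx _ _ h1 k (by simp)
      rw [Finset.insert_erase hk, mul_eq_zero, or_iff_right (koszulSign_ne_zero _ _ _)] at h2
      rw [hc, h2, zero_smul, Pi.zero_apply]
    · exact (mem_koszulPart.1 hf S).2 hS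

/-- The dual vectors make the differential onto the chains with values in `K τ`, except at the full
set of variables, to which no index can be added. The factor `X` is there because `(i+1)`-chains map
to `i`-chains. -/
theorem rankPoly_of_dual (rk : σ → ℕ) {x : σ → Module.End K M} {V : Submodule K M} {τ : M}
    (hτ : τ ≠ 0) (hV : ∀ k, ∀ v ∈ V, x k v ∈ Submodule.span K {τ}) {w : σ → M}
    (hw : ∀ k, w k ∈ V) (hx : ∀ l k, x l (w k) = if l = k then τ else 0) :
    rankPoly rk x V = Polynomial.X *
      ((1 + Polynomial.X) ^ Fintype.card σ - Polynomial.X ^ Fintype.card σ) := by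
  ext i
  rcases i with _ | i
  · simp [coeff_rankPoly, koszulRank_zero]
  rw [coeff_rankPoly, Polynomial.coeff_X_mul, Polynomial.coeff_sub, Polynomial.coeff_one_add_X_pow,
    Polynomial.coeff_X_pow]
  rcases lt_or_ge i (Fintype.card σ) with hi | hi
  · have : (koszulPart σ V (i + 1)).map (koszulD rk x) =
        koszulPart σ (Submodule.span K {τ}) i := by
      refine le_antisymm ?_ ?_
      · rintro _ ⟨f, hf, rfl⟩
        exact koszulD_mem_koszulPart rk hV hf
      · intro f hf
        obtain ⟨c, hc⟩ := koszulPart_span_singleton hf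
        have hf' : f = ∑ S : Finset σ, Pi.single S (f S) := (Finset.univ_sum_single f).symm
        rw [hf']
        refine Submodule.sum_mem _ fun S _ => ?_
        by_cases hS : S.card = i
        · obtain ⟨k, hk⟩ : ∃ k, k ∉ S := by
            by_contra! h
            rw [Finset.eq_univ_iff_forall.2 h, Finset.card_univ] at hS
            omega
          -- The chain supported at `S ∪ {k}` with value a multiple of `w k`: removing any `l ≠ k`
          -- gives `x l (w k) = 0`, and removing `k` gives `τ` at `S`.
          refine ⟨Pi.single (insert k S) ((c S * koszulSign K rk k S) • w k), ?_, ?_⟩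
          · rw [SetLike.mem_coe, mem_koszulPart]
            intro T
            by_cases hT : T = insert k S
            · subst hT
              rw [Pi.single_eq_same, Finset.card_insert_of_notMem hk, hS]
              exact ⟨V.smul_mem _ (hw k), fun h => absurd rfl h⟩
            · rw [Pi.single_eq_of_ne hT]
              exact ⟨V.zero_mem, fun _ => rfl⟩
          · ext T
            rw [koszulD_apply]
            by_cases hT : T = S
            · subst hT
              rw [Finset.sum_eq_single k, Pi.single_eq_same, Pi.single_eq_same, map_smul, hx,
                if_pos rfl, smul_smul, hc, mul_left_comm, koszulSign_mul_self, mul_one]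
              · intro l hl hlk
                by_cases h : insert l T = insert k T
                · rw [h, Pi.single_eq_same, map_smul, hx, if_neg hlk, smul_zero, smul_zero]
                · rw [Pi.single_eq_of_ne h, map_zero, smul_zero]
              · intro h
                exact absurd (by simpa using hk) h
            · rw [Pi.single_eq_of_ne hT]
              refine Finset.sum_eq_zero fun l hl => ?_
              by_cases h : insert l T = insert k S
              · rw [h, Pi.single_eq_same, map_smul, hx, if_neg, smul_zero, smul_zero]
                rintro rfl
                apply hT
                rw [← Finset.erase_insert hk, ← h, Finset.erase_insert (by simpa using hl)]
              · rw [Pi.single_eq_of_ne h, map_zero, smul_zero]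
        · rw [(mem_koszulPart.1 hf S).2 hS, Pi.single_zero]
          exact Submodule.zero_mem _
    rw [koszulRank, this, finrank_koszulPart, finrank_span_singleton hτ, if_neg hi.ne, mul_one,
      sub_zero]
  -- For `i` equal to the number of variables, the top coefficient of `(1+X)^n` cancels against
  -- `X^n`.
  · rw [koszulRank, koszulPart_eq_bot_of_card_lt V (by omega), Submodule.map_bot, finrank_bot]
    rcases hi.eq_or_lt with h | h
    · simp [h]
    · rw [Nat.choose_eq_zero_of_lt h, if_neg h.ne']
      simp

end RankComparison

end

noncomputable section

/-! ## Standard graded quotients of polynomial rings -/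

section Quotient

variable {K : Type u} [Field K] {σ : Type} {𝔞 : Ideal (MvPolynomial σ K)}

theorem finite_homogeneousSubmodule [Finite σ] (d : ℕ) :
    Module.Finite K (homogeneousSubmodule σ K d) := by
  have : Finite {a : σ →₀ ℕ | a.degree = d} := Finsupp.finite_of_degree_eq d
  let L : homogeneousSubmodule σ K d →ₗ[K] ({a : σ →₀ ℕ | a.degree = d} → K) :=
    LinearMap.pi fun a => lcoeff K a.1 ∘ₗ (homogeneousSubmodule σ K d).subtype
  refine Module.Finite.of_injective L ?_
  rw [injective_iff_map_eq_zero]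
  intro p hp
  refine Subtype.ext (MvPolynomial.ext _ _ fun a => ?_)
  by_cases ha : a.degree = d
  · exact congrFun hp ⟨a, ha⟩
  · exact IsHomogeneous.coeff_eq_zero p.2 ha

instance finite_quotGrading [Finite σ] (d : ℕ) : Module.Finite K (quotGrading 𝔞 d) := by
  have := finite_homogeneousSubmodule (K := K) (σ := σ) d
  exact Module.Finite.map _ _

theorem mem_quotGrading {d : ℕ} {a : MvPolynomial σ K ⧸ 𝔞} :
    a ∈ quotGrading 𝔞 d ↔ ∃ p : MvPolynomial σ K, p.IsHomogeneous d ∧ Ideal.Quotient.mk 𝔞 p = a :=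
  Iff.rfl

theorem quotGrading_mul (i j : ℕ) (a b : MvPolynomial σ K ⧸ 𝔞) (ha : a ∈ quotGrading 𝔞 i)
    (hb : b ∈ quotGrading 𝔞 j) : a * b ∈ quotGrading 𝔞 (i + j) := by
  rw [mem_quotGrading] at *
  obtain ⟨p, hp, rfl⟩ := ha
  obtain ⟨q, hq, rfl⟩ := hb
  exact ⟨p * q, hp.mul hq, map_mul _ _ _⟩

theorem mk_X_mem_quotGrading (k : σ) : Ideal.Quotient.mk 𝔞 (X k) ∈ quotGrading 𝔞 1 :=
  mem_quotGrading.2 ⟨X k, isHomogeneous_X K k, rfl⟩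

theorem actX_mkₐ_mem (k : σ) (d : ℕ) (a : MvPolynomial σ K ⧸ 𝔞) (ha : a ∈ quotGrading 𝔞 d) :
    actX (Ideal.Quotient.mkₐ K 𝔞) k a ∈ quotGrading 𝔞 (d + 1) := by
  rw [add_comm]
  exact quotGrading_mul 1 d _ _ (mk_X_mem_quotGrading k) ha

theorem iSup_quotGrading : ⨆ d, quotGrading 𝔞 d = ⊤ := by
  rw [eq_top_iff]
  rintro a -
  obtain ⟨p, rfl⟩ := Ideal.Quotient.mk_surjective a
  rw [← sum_homogeneousComponent p, map_sum]
  refine Submodule.sum_mem _ fun d _ => ?_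
  exact Submodule.mem_iSup_of_mem d
    (mem_quotGrading.2 ⟨_, homogeneousComponent_isHomogeneous d p, rfl⟩)

theorem quotGrading_zero : quotGrading 𝔞 0 = Submodule.span K {1} := by
  rw [quotGrading, homogeneousSubmodule_zero, Submodule.one_eq_span, Submodule.map_span,
    Set.image_singleton]
  congr 2

theorem canonicalProj_mk (h : 𝔞 ≤ varIdeal K σ ^ 2) (p : MvPolynomial σ K) :
    canonicalProj 𝔞 h (Ideal.Quotient.mk 𝔞 p) = constantCoeff p := by
  refine (Ideal.Quotient.lift_mk _ _ _).trans ?_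
  change aeval (fun _ : σ => (0 : K)) p = _
  simp

theorem canonicalProj_eq_zero (h : 𝔞 ≤ varIdeal K σ ^ 2) {d : ℕ} (hd : d ≠ 0)
    {a : MvPolynomial σ K ⧸ 𝔞} (ha : a ∈ quotGrading 𝔞 d) : canonicalProj 𝔞 h a = 0 := by
  obtain ⟨p, hp, rfl⟩ := mem_quotGrading.1 ha
  rw [canonicalProj_mk, constantCoeff_eq]
  exact hp.coeff_eq_zero (by simpa using hd.symm)

/-- A linear form in `𝔞` lies in the square of the maximal ideal, so its coefficients vanish. -/
theorem linearIndependent_mk_X (h : 𝔞 ≤ varIdeal K σ ^ 2) :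
    LinearIndependent K fun k : σ => Ideal.Quotient.mk 𝔞 (X k) := by
  classical
  rw [linearIndependent_iff']
  intro s c hc k hk
  have h1 : ∑ l ∈ s, c l • (X l : MvPolynomial σ K) ∈ 𝔞 := by
    rw [← Ideal.Quotient.eq_zero_iff_mem, map_sum, ← hc]
    rfl
  have h2 := (mem_pow_idealOfVars_iff' 2 _).1 (h h1) (Finsupp.single k 1) (by simp)
  rw [coeff_sum] at h2
  simpa [coeff_smul, coeff_X, Finsupp.single_left_inj, hk] using h2

theorem nontrivial_quotient (h : 𝔞 ≤ varIdeal K σ ^ 2) :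
    (1 : MvPolynomial σ K ⧸ 𝔞) ≠ 0 := fun h1 => by
  have := congrArg (canonicalProj 𝔞 h) h1
  simp at this

end Quotient

/-! ### Duality in Artinian Gorenstein algebras -/

section Gorenstein

variable {K : Type u} [Field K] {A : Type u} [CommRing A] [Algebra K A] {gr : ℕ → Submodule K A}

theorem mem_gradedSocle {a : A} :
    a ∈ gradedSocle gr ↔ ∀ i, 1 ≤ i → ∀ b ∈ gr i, a * b = 0 := by
  constructor
  · intro h i hi b hb
    exact h b (Submodule.mem_iSup_of_mem i (Submodule.mem_iSup_of_mem hi hb))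
  · intro h b hb
    have : ⨆ i ∈ Set.Ici 1, gr i ≤ LinearMap.ker (LinearMap.mulLeft K a) :=
      iSup₂_le fun i hi c hc => h i hi c hc
    exact this hb

variable (hmul : ∀ i j a b, a ∈ gr i → b ∈ gr j → a * b ∈ gr (i + j)) {e : ℕ}
  (hG : IsArtinianGorenstein gr e) {f : A →ₗ[K] K} {τ : A} (hτ : τ ∈ gr e) (hfτ : f τ = 1)

include hmul hG in
theorem le_gradedSocle : gr e ≤ gradedSocle gr := by
  intro a ha
  rw [mem_gradedSocle]
  intro i hi b hb
  have := hmul e i a b ha hb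
  rwa [hG.above _ (by omega), Submodule.mem_bot] at this

include hmul hG hτ hfτ in
-- The socle is a line; `f τ = 1` shows that `τ` spans it and that `f` reads off the coordinate.
theorem gradedSocle_eq_smul {a : A} (ha : a ∈ gradedSocle gr) : a = f a • τ := by
  have hτ0 : (⟨τ, le_gradedSocle hmul hG hτ⟩ : gradedSocle gr) ≠ 0 := by
    intro h
    have : τ = 0 := congrArg Subtype.val h
    simp [this] at hfτ
  obtain ⟨c, hc⟩ := (finrank_eq_one_iff_of_nonzero' _ hτ0).1 hG.socle ⟨a, ha⟩
  have hc' : c • τ = a := congrArg Subtype.val hc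
  rw [← hc', map_smul, hfτ, smul_eq_mul, mul_one]

include hmul hG hτ hfτ in
theorem mul_thom_eq_smul (a : A) : τ * a = f (τ * a) • τ := by
  refine gradedSocle_eq_smul hmul hG hτ hfτ ?_
  rw [mem_gradedSocle]
  intro i hi b hb
  rw [mul_right_comm, mem_gradedSocle.1 (le_gradedSocle hmul hG hτ) i hi b hb, zero_mul]

include hmul hG hτ hfτ in
theorem eq_span_thom : gr e = Submodule.span K {τ} := by
  refine le_antisymm (fun a ha => ?_) (by simpa [Submodule.span_le] using hτ)
  rw [gradedSocle_eq_smul hmul hG hτ hfτ (le_gradedSocle hmul hG ha)]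
  exact Submodule.smul_mem _ _ (Submodule.mem_span_singleton_self τ)

variable (hspan : ⨆ d, gr d = ⊤)

include hmul hG hτ hfτ hspan in
-- Nondegeneracy of the pairing `f(ab)`. By descending induction `a` kills every `gr d`: once it
-- kills all higher degrees, `a y` lies in the socle, where `f` detects it.
theorem eq_zero_of_orientation {a : A} (ha : ∀ b, f (a * b) = 0) : a = 0 := by
  -- `m` measures the distance to degree `e + 1`, where everything vanishes; `d = 0` is reached with
  -- `m = e + 1`.
  have key : ∀ m d, e + 1 ≤ d + m → ∀ y ∈ gr d, a * y = 0 := by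
    intro m
    induction m with
    | zero =>
      intro d hd y hy
      rw [hG.above _ (by omega), Submodule.mem_bot] at hy
      rw [hy, mul_zero]
    | succ m ih =>
      intro d hd y hy
      have h1 : a * y ∈ gradedSocle gr := by
        rw [mem_gradedSocle]
        intro i hi b hb
        rw [mul_assoc]
        exact ih (d + i) (by omega) _ (hmul d i y b hy hb)
      rw [gradedSocle_eq_smul hmul hG hτ hfτ h1, ha, zero_smul]
  have h1 : ⨆ d, gr d ≤ LinearMap.ker (LinearMap.mulLeft K a) :=
    iSup_le fun d y hy => key (e + 1) d (by omega) y hy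
  rw [hspan] at h1
  simpa using h1 (Submodule.mem_top (x := 1))

include hmul hG hτ hfτ hspan in
/-- Linear forms in an Artinian Gorenstein algebra have a dual family in degree `e - 1`. -/
theorem exists_dual_family (hf : ∀ j, j ≠ e → ∀ a ∈ gr j, f a = 0) {d : ℕ} (hd : d + 1 = e)
    {ι : Type*} {x : ι → A} (hx : LinearIndependent K x) (hx1 : ∀ k, x k ∈ gr 1) :
    ∃ u : ι → A, (∀ k, u k ∈ gr d) ∧ ∀ l k, x l * u k = open Classical in if l = k then τ else 0 := by
  classical
  -- `g` extends the coordinate functionals of the family `x` to all of `A`; the perfect pairing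
  -- then represents them by elements.
  obtain ⟨g, hg⟩ := LinearMap.exists_leftInverse_of_injective (Finsupp.linearCombination K x)
    (LinearMap.ker_eq_bot.2 hx)
  have hgx : ∀ l, g (x l) = Finsupp.single l 1 := by
    intro l
    have := LinearMap.congr_fun hg (Finsupp.single l 1)
    simpa using this
  have := hG.finite
  let L : A →ₗ[K] Module.Dual K A := (LinearMap.mul K A).compr₂ f
  have hL : Function.Injective L := by
    rw [injective_iff_map_eq_zero]
    intro a ha
    exact eq_zero_of_orientation hmul hG hτ hfτ hspan fun b => LinearMap.congr_fun ha b
  have hL' : Function.Surjective L :=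
    (LinearMap.injective_iff_surjective_of_finrank_eq_finrank
      (Subspace.dual_finrank_eq (K := K) (V := A)).symm).1 hL
  -- Only the component of `v` in degree `d = e - 1` is seen by `f (x l * v)`, as `f` lives in
  -- degree `e` and `x l` has degree `1`. So the representing element can be taken homogeneous.
  have key : ∀ v : A, ∃ u ∈ gr d, ∀ l, f (x l * u) = f (x l * v) := by
    intro v
    have hv : v ∈ ⨆ d, gr d := hspan ▸ Submodule.mem_top
    refine Submodule.iSup_induction gr
      (motive := fun v => ∃ u ∈ gr d, ∀ l, f (x l * u) = f (x l * v)) hv ?_ ?_ ?_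
    · intro i y hy
      by_cases hi : i = d
      · exact ⟨y, hi ▸ hy, fun l => rfl⟩
      · refine ⟨0, zero_mem _, fun l => ?_⟩
        rw [mul_zero, map_zero, hf (1 + i) (by omega) _ (hmul 1 i _ _ (hx1 l) hy)]
    · exact ⟨0, zero_mem _, fun l => rfl⟩
    · intro y z hy hz
      obtain ⟨u, hu, hu'⟩ := hy
      obtain ⟨w, hw, hw'⟩ := hz
      exact ⟨u + w, add_mem hu hw, fun l => by
        rw [mul_add, mul_add, map_add, map_add, hu', hw']⟩
  have h2 : ∀ k, ∃ u ∈ gr d, ∀ l, f (x l * u) = if l = k then 1 else 0 := by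
    intro k
    obtain ⟨v, hv⟩ := hL' (Finsupp.lapply k ∘ₗ g)
    obtain ⟨u, hu, hu'⟩ := key v
    refine ⟨u, hu, fun l => ?_⟩
    rw [hu', mul_comm]
    have h3 : f (v * x l) = g (x l) k := LinearMap.congr_fun hv (x l)
    rw [h3, hgx, Finsupp.single_apply]
  choose u hu hu' using h2
  refine ⟨u, hu, fun l k => ?_⟩
  have h3 : x l * u k ∈ gr e := by
    rw [← hd, add_comm]
    exact hmul 1 d _ _ (hx1 l) (hu k)
  rw [gradedSocle_eq_smul hmul hG hτ hfτ (le_gradedSocle hmul hG h3), hu']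
  split_ifs <;> simp

end Gorenstein

end

noncomputable section

/-! ## The fiber product -/

section FiberProduct

variable {K : Type u} [Field K] {r : ℕ} {n : Fin r → ℕ}
  (𝔞 : ∀ i, Ideal (MvPolynomial (Fin (n i)) K)) (h : ∀ i, 𝔞 i ≤ varIdeal K (Fin (n i)) ^ 2)

/-- The fiber product of the algebras `R_i / 𝔞_i`. -/
def FiberRing : Type u := fiberProduct (projFamily 𝔞 h)

instance : CommRing (FiberRing 𝔞 h) := inferInstanceAs (CommRing (fiberProduct (projFamily 𝔞 h)))

instance : Algebra K (FiberRing 𝔞 h) :=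
  inferInstanceAs (Algebra K (fiberProduct (projFamily 𝔞 h)))

/-- The grading of the fiber product. -/
def fiberGr (d : ℕ) : Submodule K (FiberRing 𝔞 h) :=
  fiberProductGrading (projFamily 𝔞 h) (fun i => quotGrading (𝔞 i)) d

/-- The structure map `Q → A_1 ×_K ⋯ ×_K A_r`. -/
def fiberMap : MvPolynomial (Σ i, Fin (n i)) K →ₐ[K] FiberRing 𝔞 h := toFiberProduct 𝔞 h

/-- The inclusion of the fiber product into the product. -/
def fiberVal : FiberRing 𝔞 h →ₐ[K] ∀ i, MvPolynomial (Fin (n i)) K ⧸ 𝔞 i :=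
  (fiberProduct (projFamily 𝔞 h)).val

theorem mem_fiberGr {d : ℕ} {v : FiberRing 𝔞 h} :
    v ∈ fiberGr 𝔞 h d ↔ ∀ k, fiberVal 𝔞 h v k ∈ quotGrading (𝔞 k) d :=
  ⟨fun hv k => hv k trivial, fun hv k _ => hv k⟩

theorem fiberVal_injective : Function.Injective (fiberVal 𝔞 h) := Subtype.val_injective

theorem projFamily_fiberVal (v : FiberRing 𝔞 h) (i j : Fin r) :
    projFamily 𝔞 h i (fiberVal 𝔞 h v i) = projFamily 𝔞 h j (fiberVal 𝔞 h v j) :=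
  v.2 i j

theorem exists_fiberVal_eq {a : ∀ i, MvPolynomial (Fin (n i)) K ⧸ 𝔞 i}
    (ha : ∀ i, projFamily 𝔞 h i (a i) = 0) : ∃ v, fiberVal 𝔞 h v = a :=
  ⟨⟨a, fun i j => by rw [ha, ha]⟩, rfl⟩

/-- The action of the variables of `Q` on a factor. -/
def factorAct (k : Fin r) (p : Σ i, Fin (n i)) : Module.End K (MvPolynomial (Fin (n k)) K ⧸ 𝔞 k) :=
  LinearMap.mulLeft K ((Pi.single p.1 (Ideal.Quotient.mk (𝔞 p.1) (X p.2)) :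
    ∀ i, MvPolynomial (Fin (n i)) K ⧸ 𝔞 i) k)

theorem factorAct_apply (k : Fin r) (p : Σ i, Fin (n i)) (a : MvPolynomial (Fin (n k)) K ⧸ 𝔞 k) :
    factorAct 𝔞 k p a = (Pi.single p.1 (Ideal.Quotient.mk (𝔞 p.1) (X p.2)) :
      ∀ i, MvPolynomial (Fin (n i)) K ⧸ 𝔞 i) k * a := rfl

theorem fiberVal_fiberMap_X (p : Σ i, Fin (n i)) :
    fiberVal 𝔞 h (fiberMap 𝔞 h (X p)) = Pi.single p.1 (Ideal.Quotient.mk (𝔞 p.1) (X p.2)) :=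
  congrArg Subtype.val (aeval_X _ p)

theorem fiberVal_actX (p : Σ i, Fin (n i)) (v : FiberRing 𝔞 h) (k : Fin r) :
    fiberVal 𝔞 h (actX (fiberMap 𝔞 h) p v) k = factorAct 𝔞 k p (fiberVal 𝔞 h v k) := by
  rw [actX_apply, map_mul, fiberVal_fiberMap_X, factorAct_apply, Pi.mul_apply]

theorem factorAct_mk (k : Fin r) (t : Fin (n k)) :
    factorAct 𝔞 k ⟨k, t⟩ = actX (Ideal.Quotient.mkₐ K (𝔞 k)) t := by
  refine LinearMap.ext fun a => ?_
  rw [factorAct_apply, actX_apply, Ideal.Quotient.mkₐ_eq_mk]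
  exact congrArg (· * a) (Pi.single_eq_same _ _)

theorem factorAct_of_ne {k : Fin r} {p : Σ i, Fin (n i)} (hp : k ≠ p.1) :
    factorAct 𝔞 k p = 0 := by
  refine LinearMap.ext fun a => ?_
  rw [factorAct_apply, Pi.single_eq_of_ne hp, zero_mul, LinearMap.zero_apply]

theorem factorAct_mem (k : Fin r) (p : Σ i, Fin (n i)) (d : ℕ) :
    ∀ a ∈ quotGrading (𝔞 k) d, factorAct 𝔞 k p a ∈ quotGrading (𝔞 k) (d + 1) := by
  intro a ha
  by_cases hp : k = p.1
  · obtain ⟨i, t⟩ := p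
    subst hp
    rw [factorAct_mk]
    exact actX_mkₐ_mem t d a ha
  · rw [factorAct_of_ne 𝔞 hp]
    exact zero_mem _

theorem actX_fiberMap_mem (p : Σ i, Fin (n i)) (d : ℕ) :
    ∀ v ∈ fiberGr 𝔞 h d, actX (fiberMap 𝔞 h) p v ∈ fiberGr 𝔞 h (d + 1) := by
  intro v hv
  rw [mem_fiberGr] at hv ⊢
  intro k
  rw [fiberVal_actX]
  exact factorAct_mem 𝔞 k p d _ (hv k)

/-- In positive degree the projections to `K` vanish, so any tuple satisfies the gluing condition.
-/
theorem map_fiberVal {d : ℕ} (hd : d ≠ 0) : (fiberGr 𝔞 h d).map (fiberVal 𝔞 h).toLinearMap =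
    Submodule.pi Set.univ fun k => quotGrading (𝔞 k) d := by
  ext a
  constructor
  · rintro ⟨v, hv, rfl⟩
    exact fun k _ => (mem_fiberGr 𝔞 h).1 hv k
  · intro ha
    obtain ⟨v, rfl⟩ := exists_fiberVal_eq 𝔞 h fun k =>
      canonicalProj_eq_zero (h k) hd (ha k trivial)
    exact ⟨v, (mem_fiberGr 𝔞 h).2 fun k => ha k trivial, rfl⟩

instance free_quotGrading {σ : Type} (𝔟 : Ideal (MvPolynomial σ K)) (d : ℕ) :
    Module.Free K (quotGrading 𝔟 d) := Module.Free.of_divisionRing _ _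


end FiberProduct
end

noncomputable section

/-! ### Dimensions and Koszul ranks of the fiber product -/

section FiberProductRanks

variable {K : Type u} [Field K] {r : ℕ} {n : Fin r → ℕ}
  (𝔞 : ∀ i, Ideal (MvPolynomial (Fin (n i)) K)) (h : ∀ i, 𝔞 i ≤ varIdeal K (Fin (n i)) ^ 2)

/-- The components of a homogeneous element of the fiber product. -/
def fiberComponents (d : ℕ) : fiberGr 𝔞 h d →ₗ[K] ∀ k, quotGrading (𝔞 k) d :=
  LinearMap.pi fun k => LinearMap.codRestrict _
    (LinearMap.proj k ∘ₗ (fiberVal 𝔞 h).toLinearMap ∘ₗ (fiberGr 𝔞 h d).subtype)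
    fun v => (mem_fiberGr 𝔞 h).1 v.2 k

theorem fiberComponents_injective (d : ℕ) : Function.Injective (fiberComponents 𝔞 h d) := by
  intro v w hvw
  exact Subtype.ext (fiberVal_injective 𝔞 h
    (funext fun k => congrArg Subtype.val (congrFun hvw k)))

theorem fiberComponents_surjective {d : ℕ} (hd : d ≠ 0) :
    Function.Surjective (fiberComponents 𝔞 h d) := by
  intro a
  obtain ⟨v, hv⟩ := exists_fiberVal_eq 𝔞 h (a := fun k => a k) fun k =>
    canonicalProj_eq_zero (h k) hd (a k).2
  refine ⟨⟨v, (mem_fiberGr 𝔞 h).2 fun k => ?_⟩, funext fun k => Subtype.ext (congrFun hv k)⟩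
  rw [hv]
  exact (a k).2

instance finite_fiberGr (d : ℕ) : Module.Finite K (fiberGr 𝔞 h d) := by
  have (k : Fin r) : IsNoetherian K (quotGrading (𝔞 k) d) :=
    IsNoetherian.iff_fg.2 (finite_quotGrading d)
  have : IsNoetherian K (∀ k, quotGrading (𝔞 k) d) :=
    isNoetherian_pi (R := K) (M := fun k => quotGrading (𝔞 k) d)
  exact Module.Finite.of_injective _ (fiberComponents_injective 𝔞 h d)

theorem finrank_fiberGr {d : ℕ} (hd : d ≠ 0) :
    Module.finrank K (fiberGr 𝔞 h d) = ∑ k, Module.finrank K (quotGrading (𝔞 k) d) := by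
  rw [(LinearEquiv.ofBijective _ ⟨fiberComponents_injective 𝔞 h d,
    fiberComponents_surjective 𝔞 h hd⟩).finrank_eq, Module.finrank_pi_fintype]

/-- Degree `0` entries are scalars, and the gluing condition forces them to be equal. -/
theorem fiberGr_zero [NeZero r] : fiberGr 𝔞 h 0 = Submodule.span K {1} := by
  ext v
  rw [mem_fiberGr, Submodule.mem_span_singleton]
  simp only [quotGrading_zero, Submodule.mem_span_singleton]
  constructor
  · intro hv
    choose c hc using hv
    have h1 : ∀ k, projFamily 𝔞 h k (fiberVal 𝔞 h v k) = c k := by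
      intro k
      rw [← hc, map_smul, map_one, smul_eq_mul, mul_one]
    refine ⟨c 0, fiberVal_injective 𝔞 h (funext fun k => ?_)⟩
    rw [map_smul, map_one, ← hc, ← h1 k, projFamily_fiberVal 𝔞 h v k 0, h1]
    rfl
  · rintro ⟨c, rfl⟩ k
    refine ⟨c, ?_⟩
    rw [map_smul, map_one]
    rfl

theorem fiberRing_one_ne_zero [NeZero r] : (1 : FiberRing 𝔞 h) ≠ 0 := by
  intro h1
  have h2 := congrFun (congrArg (fiberVal 𝔞 h) h1) 0
  rw [map_one, map_zero] at h2
  exact nontrivial_quotient (h 0) h2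

theorem linearIndependent_fiberMap :
    LinearIndependent K fun p : Σ i, Fin (n i) => fiberMap 𝔞 h (X p) := by
  rw [Fintype.linearIndependent_iff]
  rintro c hc ⟨k, t⟩
  have h1 := congrFun (congrArg (fiberVal 𝔞 h) hc) k
  have h2 : ∑ t : Fin (n k), c ⟨k, t⟩ • Ideal.Quotient.mk (𝔞 k) (X t) = 0 := by
    refine Eq.trans ?_ (h1.trans (by rw [map_zero]; rfl))
    rw [map_sum, Finset.sum_apply, Fintype.sum_sigma]
    rw [Finset.sum_eq_single k]
    · refine Finset.sum_congr rfl fun t _ => ?_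
      rw [map_smul, Pi.smul_apply, fiberVal_fiberMap_X]
      congr 1
      symm
      exact Pi.single_eq_same _ _
    · intro i _ hi
      refine Finset.sum_eq_zero fun t _ => ?_
      rw [map_smul, Pi.smul_apply, fiberVal_fiberMap_X, Pi.single_eq_of_ne hi.symm, smul_zero]
    · simp
  exact Fintype.linearIndependent_iff.1 (linearIndependent_mk_X (h k)) _ h2 t

/-- The inclusions of the sets of variables. -/
abbrev varEmb (n : Fin r → ℕ) (k : Fin r) : Fin (n k) ↪ Σ i, Fin (n i) :=
  Function.Embedding.sigmaMk (β := fun i => Fin (n i)) k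

/-- The rank polynomials of the factors. -/
def factorRank (rk : (Σ i, Fin (n i)) → ℕ) (k : Fin r) (d : ℕ) : Polynomial ℤ :=
  rankPoly (rk ∘ varEmb n k) (actX (Ideal.Quotient.mkₐ K (𝔞 k))) (quotGrading (𝔞 k) d)

theorem factorRank_zero (rk : (Σ i, Fin (n i)) → ℕ) (k : Fin r)
    (h : 𝔞 k ≤ varIdeal K (Fin (n k)) ^ 2) :
    factorRank 𝔞 rk k 0 = (1 + Polynomial.X) ^ n k - 1 := by
  rw [factorRank, quotGrading_zero, rankPoly_of_linearIndependent _ (nontrivial_quotient h),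
    Fintype.card_fin]
  have : (fun t => actX (Ideal.Quotient.mkₐ K (𝔞 k)) t 1) =
      fun t : Fin (n k) => Ideal.Quotient.mk (𝔞 k) (X t) := by
    ext1 t
    rw [actX_apply, mul_one]
    rfl
  rw [this]
  exact linearIndependent_mk_X h

theorem rankPoly_fiberGr_zero [NeZero r] (rk : (Σ i, Fin (n i)) → ℕ) :
    rankPoly rk (actX (fiberMap 𝔞 h)) (fiberGr 𝔞 h 0) =
      (1 + Polynomial.X) ^ (∑ i, n i) - 1 := by
  rw [fiberGr_zero, rankPoly_of_linearIndependent _ (fiberRing_one_ne_zero 𝔞 h),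
    Fintype.card_sigma]
  · simp
  · have : (fun p => actX (fiberMap 𝔞 h) p 1) =
        fun p : Σ i, Fin (n i) => fiberMap 𝔞 h (X p) := by
      ext1 p
      rw [actX_apply, mul_one]
    rw [this]
    exact linearIndependent_fiberMap 𝔞 h

/-- In positive degree the complex splits over the factors, and the `N - n_k` variables foreign to
the factor `k` act on it as zero. -/
theorem rankPoly_fiberGr (rk : (Σ i, Fin (n i)) → ℕ) {d : ℕ} (hd : d ≠ 0) :
    rankPoly rk (actX (fiberMap 𝔞 h)) (fiberGr 𝔞 h d) =
      ∑ k, (1 + Polynomial.X) ^ (∑ i, n i - n k) * factorRank 𝔞 rk k d := by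
  have h1 := rankPoly_map rk (x := actX (fiberMap 𝔞 h))
    (x' := fun p => LinearMap.pi fun k => factorAct 𝔞 k p ∘ₗ LinearMap.proj k)
    (fiberVal 𝔞 h).toLinearMap (fun p v => funext fun k => fiberVal_actX 𝔞 h p v k)
    (fiberGr 𝔞 h d) ⊤
    (fun _ _ _ => trivial) fun v _ hv => fiberVal_injective 𝔞 h (hv.trans (map_zero _).symm)
  rw [← h1, map_fiberVal 𝔞 h hd, rankPoly_pi rk (y := fun k p => factorAct 𝔞 k p)
    (fun p a k => rfl)]
  refine Finset.sum_congr rfl fun k _ => ?_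
  rw [rankPoly_of_embedding (varEmb n k) (y := actX (Ideal.Quotient.mkₐ K (𝔞 k)))
    (factorAct_mk 𝔞 k), Fintype.card_sigma]
  · simp [factorRank]
  · intro p hp
    refine factorAct_of_ne 𝔞 ?_
    rintro rfl
    exact hp ⟨p.2, rfl⟩

end FiberProductRanks

end

noncomputable section

/-! ## The connected sum -/

section ConnectedSumIdeal

variable {K : Type u} [Field K] {I : Type} [DecidableEq I] {A : I → Type u} [∀ i, CommRing (A i)]
  [∀ i, Algebra K (A i)] {π : ∀ i, A i →ₐ[K] K} {o : I} {τ : ∀ i, A i}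

theorem connectedSumMk_eq_zero {z : fiberProduct π} :
    connectedSumMk π o τ z = 0 ↔ z ∈ connectedSumIdeal π o τ :=
  Ideal.Quotient.eq_zero_iff_mem

/-- The ideal is just the linear span of its generators: an element `a` of the fiber product acts on
every `τ_k` by the same scalar. The relation is `c_o = ∑_{k ≠ o} c_k`, written with a sum over all
indices. -/
theorem exists_of_mem_connectedSumIdeal [Fintype I] (hτ : ∀ i a, a * τ i = π i a • τ i)
    {z : fiberProduct π} (hz : z ∈ connectedSumIdeal π o τ) :
    ∃ c : I → K, (∀ k, (z : ∀ i, A i) k = c k • τ k) ∧ c o + c o = ∑ k, c k := by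
  refine Submodule.span_induction (R := fiberProduct π) (M := fiberProduct π)
    (p := fun z _ => ∃ c : I → K, (∀ k, (z : ∀ i, A i) k = c k • τ k) ∧
      c o + c o = ∑ k, c k) ?_ ?_ ?_ ?_ hz
  · rintro x ⟨i, hi, hx⟩
    refine ⟨Pi.single o 1 + Pi.single i 1, fun k => ?_, ?_⟩
    · rw [hx, Pi.add_apply, Pi.add_apply, add_smul]
      congr 1
      · by_cases hk : k = o
        · subst hk
          rw [Pi.single_eq_same, Pi.single_eq_same, one_smul]
        · rw [Pi.single_eq_of_ne hk, Pi.single_eq_of_ne hk, zero_smul]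
      · by_cases hk : k = i
        · subst hk
          rw [Pi.single_eq_same, Pi.single_eq_same, one_smul]
        · rw [Pi.single_eq_of_ne hk, Pi.single_eq_of_ne hk, zero_smul]
    · simp [Finset.sum_add_distrib, Pi.single_eq_of_ne hi.symm]
  · exact ⟨0, fun k => by rw [Pi.zero_apply, zero_smul]; rfl, by simp⟩
  · rintro x y _ _ ⟨c, hc, hc'⟩ ⟨c₁, hc₁, hc₁'⟩
    refine ⟨c + c₁, fun k => ?_, ?_⟩
    · rw [Pi.add_apply, add_smul, ← hc, ← hc₁]
      rfl
    · simp only [Pi.add_apply, Finset.sum_add_distrib]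
      rw [← hc', ← hc₁']
      ring
  · rintro a x _ ⟨c, hc, hc'⟩
    refine ⟨fun k => π o ((a : ∀ i, A i) o) * c k, fun k => ?_, ?_⟩
    · refine Eq.trans (b := (a : ∀ i, A i) k * (x : ∀ i, A i) k) rfl ?_
      beta_reduce
      rw [a.2 o k, hc, mul_smul_comm, hτ, smul_smul, mul_comm]
    · rw [← Finset.mul_sum, ← hc', mul_add]

end ConnectedSumIdeal

/-! ### Dimensions and Koszul ranks of the connected sum -/

section ConnectedSumRanks

variable {K : Type u} [Field K] {r : ℕ} [NeZero r] {n : Fin r → ℕ}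
  (𝔞 : ∀ i, Ideal (MvPolynomial (Fin (n i)) K)) (h : ∀ i, 𝔞 i ≤ varIdeal K (Fin (n i)) ^ 2)
  (τ : ∀ i, MvPolynomial (Fin (n i)) K ⧸ 𝔞 i)

/-- The connected sum of the algebras `R_i / 𝔞_i`. -/
def ConnRing : Type u := ConnectedSum (projFamily 𝔞 h) 0 τ

instance : CommRing (ConnRing 𝔞 h τ) :=
  inferInstanceAs (CommRing (ConnectedSum (projFamily 𝔞 h) 0 τ))

instance : Algebra K (ConnRing 𝔞 h τ) :=
  inferInstanceAs (Algebra K (ConnectedSum (projFamily 𝔞 h) 0 τ))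

/-- The projection from the fiber product to the connected sum. -/
def connMk : FiberRing 𝔞 h →ₐ[K] ConnRing 𝔞 h τ := connectedSumMk (projFamily 𝔞 h) 0 τ

/-- The grading of the connected sum. -/
def connGr (d : ℕ) : Submodule K (ConnRing 𝔞 h τ) :=
  (fiberGr 𝔞 h d).map (connMk 𝔞 h τ).toLinearMap

/-- The structure map `Q → A_1 #_K ⋯ #_K A_r`. -/
def connMap : MvPolynomial (Σ i, Fin (n i)) K →ₐ[K] ConnRing 𝔞 h τ :=
  (connMk 𝔞 h τ).comp (fiberMap 𝔞 h)

instance finite_connGr (d : ℕ) : Module.Finite K (connGr 𝔞 h τ d) :=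
  Module.Finite.map _ _

theorem connMk_actX (p : Σ i, Fin (n i)) (v : FiberRing 𝔞 h) :
    (connMk 𝔞 h τ).toLinearMap (actX (fiberMap 𝔞 h) p v) =
      actX (connMap 𝔞 h τ) p ((connMk 𝔞 h τ).toLinearMap v) := by
  rw [actX_apply, actX_apply]
  exact map_mul (connMk 𝔞 h τ) _ _

theorem actX_connMap_mem (p : Σ i, Fin (n i)) (d : ℕ) :
    ∀ v ∈ connGr 𝔞 h τ d, actX (connMap 𝔞 h τ) p v ∈ connGr 𝔞 h τ (d + 1) := by
  rintro _ ⟨v, hv, rfl⟩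
  rw [← connMk_actX]
  exact ⟨_, actX_fiberMap_mem 𝔞 h p d v hv, rfl⟩

open Classical in
/-- The tuple with a single entry in the augmentation ideal. -/
def fiberSingle (k : Fin r) (a : MvPolynomial (Fin (n k)) K ⧸ 𝔞 k) : FiberRing 𝔞 h :=
  if ha : ∀ i, projFamily 𝔞 h i
      ((Pi.single k a : ∀ i, MvPolynomial (Fin (n i)) K ⧸ 𝔞 i) i) = 0
    then (exists_fiberVal_eq 𝔞 h ha).choose else 0

theorem fiberVal_fiberSingle (k : Fin r) {a : MvPolynomial (Fin (n k)) K ⧸ 𝔞 k}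
    (ha : projFamily 𝔞 h k a = 0) : fiberVal 𝔞 h (fiberSingle 𝔞 h k a) = Pi.single k a := by
  have h1 : ∀ i, projFamily 𝔞 h i
      ((Pi.single k a : ∀ i, MvPolynomial (Fin (n i)) K ⧸ 𝔞 i) i) = 0 := by
    intro i
    by_cases hi : i = k
    · subst hi
      rwa [Pi.single_eq_same]
    · rw [Pi.single_eq_of_ne hi, map_zero]
  rw [fiberSingle, dif_pos h1]
  exact (exists_fiberVal_eq 𝔞 h h1).choose_spec

theorem fiberSingle_mem {k : Fin r} {d : ℕ} (hd : d ≠ 0) {a : MvPolynomial (Fin (n k)) K ⧸ 𝔞 k}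
    (ha : a ∈ quotGrading (𝔞 k) d) : fiberSingle 𝔞 h k a ∈ fiberGr 𝔞 h d := by
  rw [mem_fiberGr, fiberVal_fiberSingle 𝔞 h k (canonicalProj_eq_zero (h k) hd ha)]
  intro i
  by_cases hi : i = k
  · subst hi
    rwa [Pi.single_eq_same]
  · rw [Pi.single_eq_of_ne hi]
    exact zero_mem _

variable {e : ℕ} (he : 3 ≤ e) (hG : ∀ i, IsArtinianGorenstein (quotGrading (𝔞 i)) e)
  {f : ∀ i, (MvPolynomial (Fin (n i)) K ⧸ 𝔞 i) →ₗ[K] K}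
  (hf : ∀ i, IsOrientation (quotGrading (𝔞 i)) e (f i)) {τ}
  (hτ : ∀ i, IsThomClass (quotGrading (𝔞 i)) (f i) LinearMap.id (projFamily 𝔞 h i) e (τ i))

include hτ in
theorem orientation_thom (k : Fin r) : f k (τ k) = 1 := by
  have h1 := (hτ k).2 1
  rwa [mul_one, map_one] at h1

include hτ hG in
-- `τ_k a` lies in the socle, hence is `f(τ_k a) τ_k`, and the Thom property evaluates the scalar.
theorem mul_thom (k : Fin r) (a : MvPolynomial (Fin (n k)) K ⧸ 𝔞 k) :
    a * τ k = projFamily 𝔞 h k a • τ k := by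
  have h1 := mul_thom_eq_smul (gr := quotGrading (𝔞 k)) (f := f k) (τ := τ k) quotGrading_mul
    (hG k) (hτ k).1 (orientation_thom 𝔞 h hτ k) a
  rw [(hτ k).2] at h1
  rw [mul_comm]
  exact h1

include hτ hG in
theorem quotGrading_top (k : Fin r) : quotGrading (𝔞 k) e = Submodule.span K {τ k} :=
  eq_span_thom (gr := quotGrading (𝔞 k)) (f := f k) quotGrading_mul (hG k) (hτ k).1
    (orientation_thom 𝔞 h hτ k)

include hτ in
theorem thom_ne_zero (k : Fin r) : τ k ≠ 0 := by
  intro h0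
  have h1 := orientation_thom 𝔞 h hτ k
  rw [h0, map_zero] at h1
  exact zero_ne_one h1

include hτ hG in
theorem exists_of_connMk_eq_zero {z : FiberRing 𝔞 h} (hz : connMk 𝔞 h τ z = 0) :
    ∃ c : Fin r → K, (∀ k, fiberVal 𝔞 h z k = c k • τ k) ∧ c 0 + c 0 = ∑ k, c k := by
  exact exists_of_mem_connectedSumIdeal (mul_thom 𝔞 h hG hτ) (connectedSumMk_eq_zero.1 hz)

include hG hf hτ in
-- The kernel consists of tuples `c_k τ_k`. In degree `d ≠ e` the orientations vanish, whereas `f_k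
-- (c_k τ_k) = c_k`.
theorem eq_zero_of_connMk_eq_zero {d : ℕ} (hd : d ≠ e) :
    ∀ z ∈ fiberGr 𝔞 h d, (connMk 𝔞 h τ).toLinearMap z = 0 → z = 0 := by
  intro z hz hz0
  obtain ⟨c, hc, -⟩ := exists_of_connMk_eq_zero 𝔞 h hG hτ hz0
  refine fiberVal_injective 𝔞 h (funext fun k => ?_)
  have h1 : f k (fiberVal 𝔞 h z k) = 0 := (hf k).2 d hd _ ((mem_fiberGr 𝔞 h).1 hz k)
  rw [hc, map_smul, orientation_thom 𝔞 h hτ, smul_eq_mul, mul_one] at h1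
  rw [hc, h1, zero_smul, map_zero]
  rfl

include hG hf hτ in
theorem finrank_connGr {d : ℕ} (hd : d ≠ e) :
    Module.finrank K (connGr 𝔞 h τ d) = Module.finrank K (fiberGr 𝔞 h d) :=
  finrank_map_of_injOn _ _ (eq_zero_of_connMk_eq_zero 𝔞 h hG hf hτ hd)

include hG hf hτ in
-- The quotient map is injective on the target degree `d + 1 ≠ e`, which suffices even when `d = e`.
theorem rankPoly_connGr (rk : (Σ i, Fin (n i)) → ℕ) {d : ℕ} (hd : d + 1 ≠ e) :
    rankPoly rk (actX (connMap 𝔞 h τ)) (connGr 𝔞 h τ d) =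
      rankPoly rk (actX (fiberMap 𝔞 h)) (fiberGr 𝔞 h d) :=
  rankPoly_map rk _ (connMk_actX 𝔞 h τ) _ (fiberGr 𝔞 h (d + 1))
    (fun p => actX_fiberMap_mem 𝔞 h p d) (eq_zero_of_connMk_eq_zero 𝔞 h hG hf hτ hd)

include he hτ in
theorem projFamily_thom (k : Fin r) : projFamily 𝔞 h k (τ k) = 0 :=
  canonicalProj_eq_zero (h k) (by omega) (hτ k).1

variable (τ) in
/-- The common image of the Thom classes. -/
def connThom : ConnRing 𝔞 h τ := connMk 𝔞 h τ (fiberSingle 𝔞 h 0 (τ 0))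

/-- The signs with which the Thom classes are identified. -/
def thomSign (K : Type u) [Field K] (k : Fin r) : K := if k = 0 then 1 else -1

theorem thomSign_mul_self (k : Fin r) : thomSign K k * thomSign K k = 1 := by
  rw [thomSign]
  split_ifs <;> simp

include he hτ in
theorem connMk_fiberSingle_thom (k : Fin r) :
    connMk 𝔞 h τ (fiberSingle 𝔞 h k (τ k)) = thomSign K k • connThom 𝔞 h τ := by
  by_cases hk : k = 0
  · subst hk
    rw [thomSign, if_pos rfl, one_smul, connThom]
  · rw [thomSign, if_neg hk, neg_smul, one_smul, connThom, eq_neg_iff_add_eq_zero, add_comm,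
      ← map_add]
    refine connectedSumMk_eq_zero.2 (Ideal.subset_span ⟨k, hk, ?_⟩)
    rw [← fiberVal_fiberSingle 𝔞 h 0 (projFamily_thom 𝔞 h he hτ 0),
      ← fiberVal_fiberSingle 𝔞 h k (projFamily_thom 𝔞 h he hτ k)]
    rfl

include he hG hτ in
-- Were `(τ_0, 0, …, 0)` in the ideal, its coefficients `(1, 0, …, 0)` would satisfy `1 + 1 = 1`.
-- This argument is valid in every characteristic.
theorem connThom_ne_zero : connThom 𝔞 h τ ≠ 0 := by
  intro h0
  obtain ⟨c, hc, hc'⟩ := exists_of_connMk_eq_zero 𝔞 h hG hτ h0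
  rw [fiberVal_fiberSingle 𝔞 h 0 (projFamily_thom 𝔞 h he hτ 0)] at hc
  have h1 : ∀ k, c k = f k ((Pi.single 0 (τ 0) : ∀ i, MvPolynomial (Fin (n i)) K ⧸ 𝔞 i) k) := by
    intro k
    rw [hc, map_smul, orientation_thom 𝔞 h hτ, smul_eq_mul, mul_one]
  have h2 : c 0 = 1 := by rw [h1, Pi.single_eq_same, orientation_thom 𝔞 h hτ]
  rw [Finset.sum_eq_single 0, h2] at hc'
  · simp at hc'
  · intro k _ hk
    rw [h1, Pi.single_eq_of_ne hk, map_zero]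
  · simp

include he hG hτ in
theorem connGr_top : connGr 𝔞 h τ e = Submodule.span K {connThom 𝔞 h τ} := by
  refine le_antisymm ?_ ?_
  · rintro _ ⟨v, hv, rfl⟩
    have h1 : ∀ k, ∃ c : K, c • τ k = fiberVal 𝔞 h v k := fun k => by
      rw [← Submodule.mem_span_singleton, ← quotGrading_top 𝔞 h hG hτ k]
      exact (mem_fiberGr 𝔞 h).1 hv k
    choose c hc using h1
    have h2 : v = ∑ k, c k • fiberSingle 𝔞 h k (τ k) := by
      refine fiberVal_injective 𝔞 h (funext fun k => ?_)
      rw [map_sum, Finset.sum_apply, Finset.sum_eq_single k, map_smul,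
        fiberVal_fiberSingle 𝔞 h k (projFamily_thom 𝔞 h he hτ k), Pi.smul_apply,
        Pi.single_eq_same, hc]
      · intro i _ hi
        rw [map_smul, fiberVal_fiberSingle 𝔞 h i (projFamily_thom 𝔞 h he hτ i), Pi.smul_apply,
          Pi.single_eq_of_ne hi.symm, smul_zero]
      · simp
    rw [h2, map_sum]
    refine Submodule.sum_mem _ fun k _ => ?_
    rw [map_smul]
    refine Submodule.smul_mem _ _ ?_
    have h3 := connMk_fiberSingle_thom 𝔞 h he hτ k
    rw [AlgHom.toLinearMap_apply, h3]
    exact Submodule.smul_mem _ _ (Submodule.mem_span_singleton_self _)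
  · rw [Submodule.span_singleton_le_iff_mem]
    exact ⟨_, fiberSingle_mem 𝔞 h (by omega) (hτ 0).1, rfl⟩

include he hG hτ in
theorem finrank_connGr_top : Module.finrank K (connGr 𝔞 h τ e) = 1 := by
  rw [connGr_top 𝔞 h he hG hτ, finrank_span_singleton (connThom_ne_zero 𝔞 h he hG hτ)]

include he hG hτ in
theorem finrank_fiberGr_top : Module.finrank K (fiberGr 𝔞 h e) = r := by
  rw [finrank_fiberGr 𝔞 h (by omega)]
  have h1 : ∀ k, Module.finrank K (quotGrading (𝔞 k) e) = 1 := by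
    intro k
    rw [quotGrading_top 𝔞 h hG hτ k, finrank_span_singleton (thom_ne_zero 𝔞 h hτ k)]
  simp [h1]

include hG hf hτ in
theorem exists_dual_variables {d : ℕ} (hd : d + 1 = e) (k : Fin r) :
    ∃ u : Fin (n k) → MvPolynomial (Fin (n k)) K ⧸ 𝔞 k, (∀ t, u t ∈ quotGrading (𝔞 k) d) ∧
      ∀ t t', Ideal.Quotient.mk (𝔞 k) (X t) * u t' = if t = t' then τ k else 0 := by
  obtain ⟨u, hu, hu'⟩ := exists_dual_family (gr := quotGrading (𝔞 k)) (f := f k)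
    (τ := τ k) quotGrading_mul (hG k) (hτ k).1
    (orientation_thom 𝔞 h hτ k) iSup_quotGrading (hf k).2 hd (linearIndependent_mk_X (h k))
    mk_X_mem_quotGrading
  refine ⟨u, hu, fun t t' => ?_⟩
  rw [hu']
  split_ifs <;> rfl

include hG hf hτ in
theorem factorRank_dual (rk : (Σ i, Fin (n i)) → ℕ) {d : ℕ} (hd : d + 1 = e) (k : Fin r) :
    factorRank 𝔞 rk k d =
      Polynomial.X * ((1 + Polynomial.X) ^ n k - Polynomial.X ^ n k) := by
  obtain ⟨u, hu, hu'⟩ := exists_dual_variables 𝔞 h hG hf hτ hd k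
  rw [factorRank, rankPoly_of_dual _ (thom_ne_zero 𝔞 h hτ k) (fun t v hv => ?_) hu hu',
    Fintype.card_fin]
  rw [← quotGrading_top 𝔞 h hG hτ k, ← hd]
  exact actX_mkₐ_mem t d v hv

include he hG hf hτ in
-- The dual families of the factors, put together, are dual to all variables: products between
-- different factors vanish, and `x_{k,t} u_{k,t}` becomes `τ_k`, whose class is plus or minus the
-- common socle generator. The same sign is built into the family, so that it squares away.
theorem rankPoly_connGr_dual (rk : (Σ i, Fin (n i)) → ℕ) {d : ℕ} (hd : d + 1 = e) :
    rankPoly rk (actX (connMap 𝔞 h τ)) (connGr 𝔞 h τ d) =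
      Polynomial.X * ((1 + Polynomial.X) ^ (∑ i, n i) - Polynomial.X ^ (∑ i, n i)) := by
  choose u hu hu' using exists_dual_variables 𝔞 h hG hf hτ hd
  have hd0 : d ≠ 0 := by omega
  have hcard : Fintype.card (Σ i, Fin (n i)) = ∑ i, n i := by simp
  rw [rankPoly_of_dual rk (connThom_ne_zero 𝔞 h he hG hτ) (fun p v hv => ?_)
    (w := fun p => thomSign K p.1 • connMk 𝔞 h τ (fiberSingle 𝔞 h p.1 (u p.1 p.2)))
    (fun p => Submodule.smul_mem _ _ (Submodule.mem_map_of_mem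
      (fiberSingle_mem 𝔞 h hd0 (hu p.1 p.2)))) ?_, hcard]
  · rintro ⟨l, t⟩ ⟨k, t'⟩
    have h1 : fiberMap 𝔞 h (X ⟨l, t⟩) * fiberSingle 𝔞 h k (u k t') =
        if (⟨l, t⟩ : Σ i, Fin (n i)) = ⟨k, t'⟩ then fiberSingle 𝔞 h k (τ k) else 0 := by
      refine fiberVal_injective 𝔞 h ?_
      rw [map_mul, fiberVal_fiberMap_X,
        fiberVal_fiberSingle 𝔞 h k (canonicalProj_eq_zero (h k) hd0 (hu k t'))]
      by_cases hlk : l = k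
      · subst hlk
        rw [← Pi.single_mul, hu']
        by_cases htt : t = t'
        · subst htt
          rw [if_pos rfl, if_pos rfl, fiberVal_fiberSingle 𝔞 h l (projFamily_thom 𝔞 h he hτ l)]
        · rw [if_neg htt, if_neg (fun h0 => htt (by simpa using h0)), Pi.single_zero, map_zero]
      · rw [if_neg (fun h0 => hlk (congrArg Sigma.fst h0)), map_zero]
        funext i
        rw [Pi.mul_apply]
        by_cases hi : i = l
        · have h3 : (Pi.single k (u k t') : ∀ i, MvPolynomial (Fin (n i)) K ⧸ 𝔞 i) i = 0 :=
            Pi.single_eq_of_ne (hi.trans_ne hlk) _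
          rw [h3, mul_zero]
          rfl
        · rw [Pi.single_eq_of_ne hi, zero_mul]
          rfl
    rw [map_smul]
    have h2 : actX (connMap 𝔞 h τ) ⟨l, t⟩ (connMk 𝔞 h τ (fiberSingle 𝔞 h k (u k t'))) =
        connMk 𝔞 h τ (fiberMap 𝔞 h (X ⟨l, t⟩) * fiberSingle 𝔞 h k (u k t')) :=
      (connMk_actX 𝔞 h τ _ _).symm
    rw [h2, h1]
    split_ifs
    · rw [connMk_fiberSingle_thom 𝔞 h he hτ, smul_smul, thomSign_mul_self, one_smul]
    · rw [map_zero, smul_zero]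
  · rw [← connGr_top 𝔞 h he hG hτ, ← hd]
    exact actX_connMap_mem 𝔞 h τ p d v hv

end ConnectedSumRanks

end

noncomputable section

/-! ## The Poincaré series of fiber products and connected sums -/

section SeriesFormulas

local notation "𝐭" => (MvPowerSeries.X 0 : MvPowerSeries (Fin 2) ℤ)
local notation "𝐬" => (MvPowerSeries.X 1 : MvPowerSeries (Fin 2) ℤ)
local notation "𝐲" => (1 + 𝐬 * 𝐭)

variable {K : Type u} [Field K] {r : ℕ} {n : Fin r → ℕ}
  (𝔞 : ∀ i, Ideal (MvPolynomial (Fin (n i)) K)) (h : ∀ i, 𝔞 i ≤ varIdeal K (Fin (n i)) ^ 2)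

/-- The Hilbert series of a factor, in the form entering the Koszul homology. -/
def factorHilbert (k : Fin r) : MvPowerSeries (Fin 2) ℤ :=
  gradedSeries fun d => Polynomial.C (Module.finrank K (quotGrading (𝔞 k) d) : ℤ)

/-- The Poincaré series of a factor. -/
def factorSeries (k : Fin r) : MvPowerSeries (Fin 2) ℤ :=
  poincareSeries (A := MvPolynomial (Fin (n k)) K ⧸ 𝔞 k) (Ideal.Quotient.mkₐ K (𝔞 k))
    (quotGrading (𝔞 k))

theorem X_mul_factorSeries {rk : (Σ i, Fin (n i)) → ℕ} (hrk : Function.Injective rk)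
    (k : Fin r) : 𝐭 * factorSeries 𝔞 k =
      𝐭 * (𝐲 ^ n k * factorHilbert 𝔞 k) -
        (1 + 𝐭) * gradedSeries (factorRank 𝔞 rk k) := by
  have h1 := X_mul_poincareSeries (A := MvPolynomial (Fin (n k)) K ⧸ 𝔞 k)
    (rk := rk ∘ varEmb n k) (Ideal.Quotient.mkₐ K (𝔞 k)) (gr := quotGrading (𝔞 k)) actX_mkₐ_mem
    (hrk.comp (varEmb n k).injective)
  rw [Fintype.card_fin] at h1
  exact h1

variable [NeZero r]

/-- The correction is in degree `0`, where the product has dimension `r` and the fiber product has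
dimension `1`. -/
theorem hilbert_fiber : (gradedSeries fun d =>
      Polynomial.C (Module.finrank K (fiberGr 𝔞 h d) : ℤ)) =
    ∑ k, factorHilbert 𝔞 k + (1 - (r : MvPowerSeries (Fin 2) ℤ)) := by
  have h1 : (fun d => Polynomial.C (Module.finrank K (fiberGr 𝔞 h d) : ℤ)) =
      ∑ k, (fun d => Polynomial.C (Module.finrank K (quotGrading (𝔞 k) d) : ℤ)) +
        Pi.single 0 (1 - (r : Polynomial ℤ)) := by
    funext d
    rw [Pi.add_apply, Finset.sum_apply]
    by_cases hd : d = 0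
    · subst hd
      rw [fiberGr_zero, finrank_span_singleton (fiberRing_one_ne_zero 𝔞 h), Pi.single_eq_same]
      have h2 : ∀ k, Module.finrank K (quotGrading (𝔞 k) 0) = 1 := fun k => by
        rw [quotGrading_zero, finrank_span_singleton (nontrivial_quotient (h k))]
      simp [h2]
    · rw [finrank_fiberGr 𝔞 h hd, Pi.single_eq_of_ne hd, add_zero, Nat.cast_sum, map_sum]
  rw [h1, map_add, map_sum, gradedSeries_single]
  simp [factorHilbert]

theorem rank_fiber (rk : (Σ i, Fin (n i)) → ℕ) :
    (gradedSeries fun d => rankPoly rk (actX (fiberMap 𝔞 h)) (fiberGr 𝔞 h d)) =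
    ∑ k, 𝐲 ^ (∑ i, n i - n k) *
        gradedSeries (factorRank 𝔞 rk k) +
      (𝐲 ^ (∑ i, n i) - 1 -
        ∑ k, 𝐲 ^ (∑ i, n i - n k) *
          (𝐲 ^ n k - 1)) := by
  have h1 : (fun d => rankPoly rk (actX (fiberMap 𝔞 h)) (fiberGr 𝔞 h d)) =
      ∑ k, (fun d => (1 + Polynomial.X) ^ (∑ i, n i - n k) * factorRank 𝔞 rk k d) +
        Pi.single 0 ((1 + Polynomial.X) ^ (∑ i, n i) - 1 -
          ∑ k, (1 + Polynomial.X) ^ (∑ i, n i - n k) * ((1 + Polynomial.X) ^ n k - 1)) := by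
    funext d
    rw [Pi.add_apply, Finset.sum_apply]
    by_cases hd : d = 0
    · subst hd
      rw [rankPoly_fiberGr_zero, Pi.single_eq_same]
      simp only [factorRank_zero 𝔞 rk _ (h _)]
      ring
    · rw [rankPoly_fiberGr 𝔞 h rk hd, Pi.single_eq_of_ne hd, add_zero]
  rw [h1, map_add, map_sum, gradedSeries_single]
  simp only [gradedSeries_mul]
  simp

/-- Multiplying the identity of the `k`-th factor by `(1+st)^(N - n_k)` gives exactly the
contribution of this factor to the Hilbert and rank series, so both disappear in favour of its
Poincaré series. -/
theorem X_mul_fiberSeries :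
    𝐭 * poincareSeries (fiberMap 𝔞 h) (fiberGr 𝔞 h) =
      ∑ k, 𝐲 ^ (∑ i, n i - n k) *
          (𝐭 * factorSeries 𝔞 k) +
        𝐭 * 𝐲 ^ (∑ i, n i) * (1 - (r : MvPowerSeries (Fin 2) ℤ)) -
        (1 + 𝐭) *
          (𝐲 ^ (∑ i, n i) - 1 -
            ∑ k, 𝐲 ^ (∑ i, n i - n k) *
              (𝐲 ^ n k - 1)) := by
  obtain ⟨rk, hrk⟩ := exists_injective_nat (Σ i, Fin (n i))
  have hcard : Fintype.card (Σ i, Fin (n i)) = ∑ i, n i := by simp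
  rw [X_mul_poincareSeries (rk := rk) (fiberMap 𝔞 h) (gr := fiberGr 𝔞 h) (actX_fiberMap_mem 𝔞 h) hrk,
    hilbert_fiber, rank_fiber, hcard]
  have h1 : ∀ k, 𝐲 ^ (∑ i, n i - n k) *
      (𝐭 * factorSeries 𝔞 k) =
      𝐭 * (𝐲 ^ (∑ i, n i) *
        factorHilbert 𝔞 k) - (1 + 𝐭) *
        (𝐲 ^ (∑ i, n i - n k) *
          gradedSeries (factorRank 𝔞 rk k)) := by
    intro k
    have h2 : 𝐲 ^ (∑ i, n i) =
        𝐲 ^ (∑ i, n i - n k) *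
          𝐲 ^ n k := by
      rw [← pow_add, Nat.sub_add_cancel (Finset.single_le_sum (f := n)
        (fun _ _ => Nat.zero_le _) (Finset.mem_univ k))]
    rw [X_mul_factorSeries 𝔞 hrk, h2]
    ring
  simp only [h1, Finset.sum_sub_distrib, ← Finset.mul_sum]
  ring

variable {e : ℕ} (he : 3 ≤ e) (hG : ∀ i, IsArtinianGorenstein (quotGrading (𝔞 i)) e)
  {f : ∀ i, (MvPolynomial (Fin (n i)) K ⧸ 𝔞 i) →ₗ[K] K}
  (hf : ∀ i, IsOrientation (quotGrading (𝔞 i)) e (f i))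
  {τ : ∀ i, MvPolynomial (Fin (n i)) K ⧸ 𝔞 i}
  (hτ : ∀ i, IsThomClass (quotGrading (𝔞 i)) (f i) LinearMap.id (projFamily 𝔞 h i) e (τ i))

include he hG hf hτ in
theorem hilbert_conn : (gradedSeries fun d =>
      Polynomial.C (Module.finrank K (connGr 𝔞 h τ d) : ℤ)) =
    (gradedSeries fun d => Polynomial.C (Module.finrank K (fiberGr 𝔞 h d) : ℤ)) +
      𝐬 ^ e * (1 - (r : MvPowerSeries (Fin 2) ℤ)) := by
  have h1 : (fun d => Polynomial.C (Module.finrank K (connGr 𝔞 h τ d) : ℤ)) =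
      (fun d => Polynomial.C (Module.finrank K (fiberGr 𝔞 h d) : ℤ)) +
        Pi.single e (1 - (r : Polynomial ℤ)) := by
    funext d
    rw [Pi.add_apply]
    by_cases hd : d = e
    · subst hd
      rw [finrank_connGr_top 𝔞 h he hG hτ, finrank_fiberGr_top 𝔞 h he hG hτ, Pi.single_eq_same]
      simp
    · rw [finrank_connGr 𝔞 h hG hf hτ hd, Pi.single_eq_of_ne hd, add_zero]
  rw [h1, map_add, gradedSeries_single, map_sub, map_one, map_natCast]

include he hG hf hτ in
-- Only degree `d = e - 1` differs. There both rank polynomials are known by duality, whatever the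
-- algebras are.
theorem rank_conn (rk : (Σ i, Fin (n i)) → ℕ) {d : ℕ} (hd : d + 1 = e) :
    (gradedSeries fun d => rankPoly rk (actX (connMap 𝔞 h τ)) (connGr 𝔞 h τ d)) =
    (gradedSeries fun d => rankPoly rk (actX (fiberMap 𝔞 h)) (fiberGr 𝔞 h d)) +
      𝐬 ^ d * (𝐬 * 𝐭 *
        (𝐲 ^ (∑ i, n i) -
          (𝐬 * 𝐭) ^ (∑ i, n i)) -
        ∑ k, 𝐲 ^ (∑ i, n i - n k) *
          (𝐬 * 𝐭 *
            (𝐲 ^ n k -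
              (𝐬 * 𝐭) ^ n k))) := by
  have h1 : (fun d => rankPoly rk (actX (connMap 𝔞 h τ)) (connGr 𝔞 h τ d)) =
      (fun d => rankPoly rk (actX (fiberMap 𝔞 h)) (fiberGr 𝔞 h d)) +
        Pi.single d (Polynomial.X * ((1 + Polynomial.X) ^ (∑ i, n i) - Polynomial.X ^ (∑ i, n i)) -
          ∑ k, (1 + Polynomial.X) ^ (∑ i, n i - n k) *
            (Polynomial.X * ((1 + Polynomial.X) ^ n k - Polynomial.X ^ n k))) := by
    funext j
    rw [Pi.add_apply]
    by_cases hj : j = d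
    · subst hj
      rw [rankPoly_connGr_dual 𝔞 h he hG hf hτ rk hd, rankPoly_fiberGr 𝔞 h rk (by omega),
        Pi.single_eq_same]
      simp only [factorRank_dual 𝔞 h hG hf hτ rk hd]
      ring
    · rw [rankPoly_connGr 𝔞 h hG hf hτ rk (by omega), Pi.single_eq_of_ne hj, add_zero]
  rw [h1, map_add, gradedSeries_single]
  simp

include he hG hf hτ in
theorem X_mul_connSeries {d : ℕ} (hd : d + 1 = e) :
    𝐭 * poincareSeries (connMap 𝔞 h τ) (connGr 𝔞 h τ) =
      𝐭 * poincareSeries (fiberMap 𝔞 h) (fiberGr 𝔞 h) +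
        𝐭 * 𝐲 ^ (∑ i, n i) *
          (𝐬 ^ e * (1 - (r : MvPowerSeries (Fin 2) ℤ))) -
        (1 + 𝐭) *
          (𝐬 ^ d * (𝐬 * 𝐭 *
            (𝐲 ^ (∑ i, n i) -
              (𝐬 * 𝐭) ^ (∑ i, n i)) -
            ∑ k, 𝐲 ^ (∑ i, n i - n k) *
              (𝐬 * 𝐭 *
                (𝐲 ^ n k -
                  (𝐬 * 𝐭) ^ n k)))) := by
  obtain ⟨rk, hrk⟩ := exists_injective_nat (Σ i, Fin (n i))
  rw [X_mul_poincareSeries (rk := rk) (connMap 𝔞 h τ) (gr := connGr 𝔞 h τ) (actX_connMap_mem 𝔞 h τ) hrk,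
    X_mul_poincareSeries (rk := rk) (fiberMap 𝔞 h) (gr := fiberGr 𝔞 h) (actX_fiberMap_mem 𝔞 h) hrk,
    hilbert_conn 𝔞 h he hG hf hτ, rank_conn 𝔞 h he hG hf hτ rk hd, Fintype.card_sigma]
  simp only [Fintype.card_fin]
  ring

end SeriesFormulas

end

/-! ### Rewriting the identities in the stated closed form -/

section FieldIdentities

variable {F : Type*} [Field F] {r : ℕ} {n : Fin r → ℕ} {t s : F} (P : Fin r → F)

/-- The linear terms of the closed form cancel because `(r-1)N = ∑ (N - n_i)`, and its constants
over `t` add up to `1/t`; the rest is division by `t`. -/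
theorem fiber_identity (ht : t ≠ 0) {PF : F}
    (hP : t * PF = ∑ k, (1 + s * t) ^ (∑ i, n i - n k) * (t * P k) +
      t * (1 + s * t) ^ (∑ i, n i) * (1 - r) -
      (1 + t) * ((1 + s * t) ^ (∑ i, n i) - 1 -
        ∑ k, (1 + s * t) ^ (∑ i, n i - n k) * ((1 + s * t) ^ n k - 1))) {N : ℕ}
    (hN : N = ∑ i, n i) :
    PF = ∑ i, (P i - 1) * (1 + s * t) ^ (N - n i)
      + ((r : F) - 1) * (((1 + s * t) ^ N - N * (s * t) - 1) / t)
      - ∑ i, ((1 + s * t) ^ (N - n i) - ((N : F) - n i) * (s * t) - 1) / t + 1 := by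
  have hle : ∀ k, n k ≤ N := fun k =>
    hN ▸ Finset.single_le_sum (f := n) (fun _ _ => Nat.zero_le _) (Finset.mem_univ k)
  have hNF : (N : F) = ∑ i, (n i : F) := by rw [hN, Nat.cast_sum]
  rw [← hN] at hP
  have e1 : ∑ k, (1 + s * t) ^ (N - n k) * (t * P k) = t * ∑ k, P k * (1 + s * t) ^ (N - n k) := by
    rw [Finset.mul_sum]
    exact Finset.sum_congr rfl fun k _ => by ring
  have e2 : ∑ k, (1 + s * t) ^ (N - n k) * ((1 + s * t) ^ n k - 1) =
      r * (1 + s * t) ^ N - ∑ k, (1 + s * t) ^ (N - n k) := by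
    simp only [mul_sub, mul_one, ← pow_add, Nat.sub_add_cancel (hle _), Finset.sum_sub_distrib]
    simp
  have e3 : ∑ i, (P i - 1) * (1 + s * t) ^ (N - n i) =
      ∑ i, P i * (1 + s * t) ^ (N - n i) - ∑ i, (1 + s * t) ^ (N - n i) := by
    simp only [sub_mul, one_mul, Finset.sum_sub_distrib]
  have e4 : ∑ i, ((1 + s * t) ^ (N - n i) - ((N : F) - n i) * (s * t) - 1) / t =
      (∑ i, (1 + s * t) ^ (N - n i) - (r * N - N) * (s * t) - r) / t := by
    rw [← Finset.sum_div, Finset.sum_sub_distrib, Finset.sum_sub_distrib, ← Finset.sum_mul,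
      Finset.sum_sub_distrib, ← hNF]
    simp
  rw [e1, e2] at hP
  rw [e3, e4]
  refine mul_left_cancel₀ ht ?_
  rw [hP]
  field_simp
  ring

/-- With `S = ∑ (1+st)^(N-n_k) (st)^(n_k)`, both forms of the difference between the two series
equal `s^e (t (r-1) (1+st)^N + (1+t) ((st)^N - S))`. The terms linear in `1/(st)` cancel as in the
fiber product. -/
theorem connected_identity (ht : t ≠ 0) (hs : s ≠ 0) {PF PC : F} {d e : ℕ} (hd : d + 1 = e)
    (hC : t * PC = t * PF + t * (1 + s * t) ^ (∑ i, n i) * (s ^ e * (1 - r)) -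
      (1 + t) * (s ^ d * (s * t * ((1 + s * t) ^ (∑ i, n i) - (s * t) ^ (∑ i, n i)) -
        ∑ k, (1 + s * t) ^ (∑ i, n i - n k) * (s * t * ((1 + s * t) ^ n k - (s * t) ^ n k)))))
    {N : ℕ} (hN : N = ∑ i, n i)
    (hF : PF = ∑ i, (P i - 1) * (1 + s * t) ^ (N - n i)
      + ((r : F) - 1) * (((1 + s * t) ^ N - N * (s * t) - 1) / t)
      - ∑ i, ((1 + s * t) ^ (N - n i) - ((N : F) - n i) * (s * t) - 1) / t + 1) :
    PC = ∑ i, (P i - 1 - s ^ (n i + e) * t ^ n i) * (1 + s * t) ^ (N - n i)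
      + 1 + s ^ (N + e) * t ^ N
      + ((r : F) - 1) * (((1 + s * t) ^ N - N * (s * t) - 1) / t)
      - ∑ i, ((1 + s * t) ^ (N - n i) - ((N : F) - n i) * (s * t) - 1) / t
      + ((r : F) - 1) * (s ^ (N + e) * t ^ (N + 1)) *
          ((1 + s⁻¹ * t⁻¹) ^ N - N / (s * t) - 1)
      - s ^ (N + e) * t ^ (N + 1) *
          ∑ i, ((1 + s⁻¹ * t⁻¹) ^ (N - n i) - ((N : F) - n i) / (s * t) - 1) := by
  have hle : ∀ k, n k ≤ N := fun k =>
    hN ▸ Finset.single_le_sum (f := n) (fun _ _ => Nat.zero_le _) (Finset.mem_univ k)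
  have hNF : (N : F) = ∑ i, (n i : F) := by rw [hN, Nat.cast_sum]
  rw [← hN] at hC
  set S := ∑ k, (1 + s * t) ^ (N - n k) * (s * t) ^ n k with hS
  have e1 : ∑ k, (1 + s * t) ^ (N - n k) * (s * t * ((1 + s * t) ^ n k - (s * t) ^ n k)) =
      s * t * (r * (1 + s * t) ^ N - S) := by
    have h1 : ∀ k, (1 + s * t) ^ (N - n k) * (s * t * ((1 + s * t) ^ n k - (s * t) ^ n k)) =
        s * t * ((1 + s * t) ^ N - (1 + s * t) ^ (N - n k) * (s * t) ^ n k) := by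
      intro k
      rw [← pow_sub_mul_pow (1 + s * t) (hle k)]
      ring
    simp only [h1, ← Finset.mul_sum, Finset.sum_sub_distrib]
    simp [hS]
  have e2 : ∑ i, (P i - 1 - s ^ (n i + e) * t ^ n i) * (1 + s * t) ^ (N - n i) =
      ∑ i, (P i - 1) * (1 + s * t) ^ (N - n i) - s ^ e * S := by
    rw [hS, Finset.mul_sum, ← Finset.sum_sub_distrib]
    exact Finset.sum_congr rfl fun k _ => by ring
  -- Clearing denominators with `(st)^N` uses `st (1 + 1/(st)) = 1 + st`, and turns the brackets
  -- with negative powers into the terms of `S`.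
  have hinv : ∀ m, m ≤ N → (s * t) ^ N * (1 + s⁻¹ * t⁻¹) ^ (N - m) =
      (s * t) ^ m * (1 + s * t) ^ (N - m) := by
    intro m hm
    rw [← pow_sub_mul_pow (s * t) hm, mul_right_comm, ← mul_pow, mul_comm]
    congr 2
    field_simp
    ring
  have e3 : (s * t) ^ N * ∑ i, ((1 + s⁻¹ * t⁻¹) ^ (N - n i) - ((N : F) - n i) / (s * t) - 1) =
      S - (s * t) ^ N * ((r * N - N) / (s * t) + r) := by
    have h1 : ∑ i, ((1 + s⁻¹ * t⁻¹) ^ (N - n i) - ((N : F) - n i) / (s * t) - 1) =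
        ∑ i, (1 + s⁻¹ * t⁻¹) ^ (N - n i) - ((r * N - N) / (s * t) + r) := by
      rw [Finset.sum_sub_distrib, Finset.sum_sub_distrib, ← Finset.sum_div,
        Finset.sum_sub_distrib, ← hNF]
      simp
      ring
    rw [h1, mul_sub, Finset.mul_sum]
    congr 1
    exact Finset.sum_congr rfl fun k _ => by rw [hinv _ (hle k), mul_comm]
  have e4 : (s * t) ^ N * (1 + s⁻¹ * t⁻¹) ^ N = (1 + s * t) ^ N := by
    simpa using hinv 0 (Nat.zero_le _)
  have e5 : s ^ (N + e) * t ^ (N + 1) = s ^ e * t * (s * t) ^ N := by ring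
  have e6 : s ^ (N + e) * t ^ N = s ^ e * (s * t) ^ N := by ring
  have hPC : PC = PF + (1 + s * t) ^ N * (s ^ e * (1 - r)) -
      (1 + t) * (s ^ e * ((1 + s * t) ^ N - (s * t) ^ N - (r * (1 + s * t) ^ N - S))) := by
    refine mul_left_cancel₀ ht ?_
    rw [hC, e1, ← hd]
    ring
  have e7 : ((r : F) - 1) * (s ^ e * t * (s * t) ^ N) *
      ((1 + s⁻¹ * t⁻¹) ^ N - N / (s * t) - 1) =
      ((r : F) - 1) * (s ^ e * t * (1 + s * t) ^ N) -
        ((r : F) - 1) * (s ^ e * t * (s * t) ^ N) * (N / (s * t) + 1) := by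
    rw [← e4]
    ring
  rw [e2, e5, e6, mul_assoc (s ^ e * t) ((s * t) ^ N), e3, e7, hPC, hF]
  ring

end FieldIdentities

theorem mvPowerSeries_X_ne_zero (i : Fin 2) : (MvPowerSeries.X i : MvPowerSeries (Fin 2) ℤ) ≠ 0 := by
  intro h
  have h1 := congrArg (MvPowerSeries.coeff (Finsupp.single i 1)) h
  simp at h1

theorem tVar_ne_zero : tVar ≠ 0 := by
  rw [tVar, ne_eq, FaithfulSMul.algebraMap_eq_zero_iff]
  exact mvPowerSeries_X_ne_zero 0

theorem sVar_ne_zero : sVar ≠ 0 := by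
  rw [sVar, ne_eq, FaithfulSMul.algebraMap_eq_zero_iff]
  exact mvPowerSeries_X_ne_zero 1

theorem mainTheorem8 {K : Type u} [Field K] {r : ℕ} [NeZero r] (n : Fin r → ℕ)
    (𝔞 : ∀ i, Ideal (MvPolynomial (Fin (n i)) K))
    (hhom : ∀ i, (𝔞 i).IsHomogeneous (MvPolynomial.homogeneousSubmodule (Fin (n i)) K))
    (hsq : ∀ i, 𝔞 i ≤ varIdeal K (Fin (n i)) ^ 2)
    (N : ℕ) (hN : N = ∑ i, n i) :
    fiberProductSeries 𝔞 hsq =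
      ∑ i, (quotientSeries (𝔞 i) - 1) *
          (1 + sVar * tVar) ^ (N - n i)
      + ((r : SeriesField) - 1) * (((1 + sVar * tVar) ^ N - N * (sVar * tVar) - 1) / tVar)
      - ∑ i, ((1 + sVar * tVar) ^ (N - n i)
          - ((N : SeriesField) - n i) * (sVar * tVar) - 1) / tVar
      + 1 ∧
    ∀ e : ℕ, 3 ≤ e →
      (∀ i, IsArtinianGorenstein (quotGrading (𝔞 i)) e) →
      ∀ f : ∀ i, (MvPolynomial (Fin (n i)) K ⧸ 𝔞 i) →ₗ[K] K,
      (∀ i, IsOrientation (quotGrading (𝔞 i)) e (f i)) →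
      ∀ τ : ∀ i, MvPolynomial (Fin (n i)) K ⧸ 𝔞 i,
      (∀ i, IsThomClass (quotGrading (𝔞 i)) (f i) LinearMap.id (projFamily 𝔞 hsq i) e (τ i)) →
      connectedSumSeries 𝔞 hsq τ =
        ∑ i, (quotientSeries (𝔞 i) - 1
            - sVar ^ (n i + e) * tVar ^ n i) * (1 + sVar * tVar) ^ (N - n i)
        + 1 + sVar ^ (N + e) * tVar ^ N
        + ((r : SeriesField) - 1) * (((1 + sVar * tVar) ^ N - N * (sVar * tVar) - 1) / tVar)
        - ∑ i, ((1 + sVar * tVar) ^ (N - n i)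
            - ((N : SeriesField) - n i) * (sVar * tVar) - 1) / tVar
        + ((r : SeriesField) - 1) * (sVar ^ (N + e) * tVar ^ (N + 1)) *
            ((1 + sVar⁻¹ * tVar⁻¹) ^ N - N / (sVar * tVar) - 1)
        - sVar ^ (N + e) * tVar ^ (N + 1) *
            ∑ i, ((1 + sVar⁻¹ * tVar⁻¹) ^ (N - n i)
              - ((N : SeriesField) - n i) / (sVar * tVar) - 1) := by
  have hF := fiber_identity (fun i => quotientSeries (𝔞 i)) tVar_ne_zero
    (PF := fiberProductSeries 𝔞 hsq) (s := sVar) (by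
      have h1 := congrArg (algebraMap (MvPowerSeries (Fin 2) ℤ) SeriesField)
        (X_mul_fiberSeries 𝔞 hsq)
      simp only [map_add, map_sub, map_mul, map_pow, map_sum, map_one, map_natCast] at h1
      exact h1) hN
  refine ⟨hF, fun e he hG f hf τ hτ => ?_⟩
  -- `d = e - 1` is the degree whose Koszul differential lands in the socle.
  obtain ⟨d, hd⟩ : ∃ d, d + 1 = e := ⟨e - 1, by omega⟩
  refine connected_identity (fun i => quotientSeries (𝔞 i)) tVar_ne_zero sVar_ne_zero hd ?_ hN hF
  have h1 := congrArg (algebraMap (MvPowerSeries (Fin 2) ℤ) SeriesField)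
    (X_mul_connSeries 𝔞 hsq he hG hf hτ hd)
  simp only [map_add, map_sub, map_mul, map_pow, map_sum, map_one, map_natCast] at h1
  exact h1
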